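/- Let $n\ge 2$, let $A$ be a commutative associative unital $\mathbb{C}$-algebra, and let $\mathfrak{q}=\mathfrak{q}(n)$ be the queer Lie superalgebra, i.e. the quotient by $\mathbb{C}I$ of the Lie superalgebra of block matrices $\begin{pmatrix}X&Y\\Y&X\end{pmatrix}$ with $X,Y\in M_{n+1}(\mathbb{C})$, $\operatorname{tr}Y=0$ (even part $Y=0$, odd part $X=0$). Let $\mathfrak{h}=\mathfrak{h}_{\bar 0}\oplus\mathfrak{h}_{\bar 1}$ and $\mathfrak{n}^+$ be its subalgebras given by diagonal and by strictly upper triangular $X,Y$, and let $\mathfrak{b}=\mathfrak{h}\oplus\mathfrak{n}^+$. Modules and submodules are $\mathbb{Z}/2$-graded, and isomorphisms of modules are linear bijections commuting with the action, not necessarily homogeneous. Let $\mathcal{L}(\mathfrak{h}\otimes A)$ be the space of linear functionals $\psi$ on $\mathfrak{h}_{\bar 0}\otimes A$ with $\psi(\mathfrak{h}_{\bar 0}\otimes I)=0$ for some ideal $I\subseteq A$ of finite codimension. For such $\psi$ let $H(\psi)$ be the (up to isomorphism unique) irreducible finite-dimensional $\mathfrak{h}\otimes A$-module on which every $x\in\mathfrak{h}_{\bar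 0}\otimes A$ acts as the scalar $\psi(x)$, and let $V(\psi)$ be the quotient of $U(\mathfrak{q}\otimes A)\otimes_{U(\mathfrak{b}\otimes A)}H(\psi)$ by its unique maximal proper submodule, where $\mathfrak{n}^+\otimes A$ acts on $H(\psi)$ by zero. The support of a $\mathfrak{q}\otimes A$-module $V$ is the set of maximal ideals of $A$ that contain the sum of all ideals $I\subseteq A$ with $(\mathfrak{q}\otimes I)V=0$. For irreducible finite-dimensional modules $V^1$, $V^2$ over Lie superalgebras $\mathfrak{g}^1$, $\mathfrak{g}^2$, the irreducible product $V^1\widehat\otimes V^2$ is the $\mathfrak{g}^1\oplus\mathfrak{g}^2$-module $V^1\otimes V^2$ if this is irreducible; otherwise there are odd $\varphi_i\in\operatorname{End}_{\mathfrak{g}^i}(V^i)$ (elements supercommuting with $\mathfrak g^i$) with $\varphi_i^2=-1$, and $V^1\widehat\otimes V^2=\{v\in V^1\otimes V^2\mid(\sqrt{-1}\,\varphi_1\otimes\varphi_2)v=v\}$, where $(\varphi_1\otimes\varphi_2)(v\otimes w)=(-1)^{|v|}\varphi_1v\otimes\varphi_2w$ for homogeneous $v$. Put $V^1\widehat\otimes\cdots\widehat\otimes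 V^k=(V^1\widehat\otimes\cdots\widehat\otimes V^{k-1})\widehat\otimes V^k$; for $\mathfrak{g}^1=\dots=\mathfrak{g}^k=\mathfrak{q}\otimes A$ this is regarded as a $\mathfrak{q}\otimes A$-module through the diagonal embedding. (1) If $\psi_1,\psi_2\in\mathcal{L}(\mathfrak{h}\otimes A)$ and $V(\psi_1)$, $V(\psi_2)$ are finite-dimensional with disjoint supports, then, as $\mathfrak{q}\otimes A$-modules, $$V(\psi_1)\otimes V(\psi_2)\cong V(\psi_1+\psi_2)\quad\text{or}\quad V(\psi_1)\otimes V(\psi_2)\cong V(\psi_1+\psi_2)\oplus V(\psi_1+\psi_2).$$ (2) If $k\ge 1$, $\psi_1,\dots,\psi_k\in\mathcal{L}(\mathfrak{h}\otimes A)$, and $V(\psi_1),\dots,V(\psi_k)$ are finite-dimensional with pairwise disjoint supports, then, as $\mathfrak{q}\otimes A$-modules, $$V(\psi_1)\widehat\otimes\cdots\widehat\otimes V(\psi_k)\cong V\Big(\sum_{i=1}^k\psi_i\Big).$$ -/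

import Mathlib

open scoped TensorProduct

noncomputable section

namespace MapQueer

universe u v w

/-! ### Super vector spaces -/

/-- A complex super vector space, i.e. a `ℤ/2`-grading `V = V₀ ⊕ V₁`. The grading is recorded by its
parity involution, which is `+1` on `V₀` and `-1` on `V₁`; conversely the eigenspaces of any
linear involution give a grading, see `homog` and `isCompl_homog`. -/
class SuperSpace (V : Type*) [AddCommGroup V] [Module ℂ V] where
  parity : V →ₗ[ℂ] V
  parity_parity : ∀ v, parity (parity v) = v

open SuperSpace (parity parity_parity)

/-- The sign `(-1)^i`. -/
def sgn (i : ZMod 2) : ℂ := if i = 0 then 1 else -1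

theorem zmod2_cases (i : ZMod 2) : i = 0 ∨ i = 1 := by
  revert i; decide

@[simp] theorem sgn_zero : sgn 0 = 1 := by simp [sgn]

@[simp] theorem sgn_one : sgn 1 = -1 := by simp [sgn]

section SuperSpace

variable {V : Type*} [AddCommGroup V] [Module ℂ V] [SuperSpace V]

/-- The homogeneous part `V_i`, `i ∈ ℤ/2`. -/
def homog (V : Type*) [AddCommGroup V] [Module ℂ V] [SuperSpace V] (i : ZMod 2) :
    Submodule ℂ V where
  carrier := {v | parity v = sgn i • v}
  add_mem' := by
    intro a b ha hb
    simp only [Set.mem_ofPred_eq] at *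
    rw [map_add, ha, hb, smul_add]
  zero_mem' := by simp
  smul_mem' := by
    intro c a ha
    simp only [Set.mem_ofPred_eq] at *
    rw [map_smul, ha, smul_comm]

theorem mem_homog {i : ZMod 2} {v : V} : v ∈ homog V i ↔ parity v = sgn i • v := Iff.rfl

/-- The projection onto the even part. -/
def evenProj : V →ₗ[ℂ] V := (1 / 2 : ℂ) • (LinearMap.id + parity)

/-- The projection onto the odd part. -/
def oddProj : V →ₗ[ℂ] V := (1 / 2 : ℂ) • (LinearMap.id - parity)

theorem evenProj_apply (v : V) : evenProj v = (1 / 2 : ℂ) • (v + parity v) := rfl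

theorem oddProj_apply (v : V) : oddProj v = (1 / 2 : ℂ) • (v - parity v) := rfl

theorem evenProj_add_oddProj (v : V) : evenProj v + oddProj v = v := by
  rw [evenProj_apply, oddProj_apply]; module

theorem parity_evenProj (v : V) : parity (evenProj v) = evenProj v := by
  simp only [evenProj_apply, map_smul, map_add, parity_parity]; module

theorem parity_oddProj (v : V) : parity (oddProj v) = -oddProj v := by
  simp only [oddProj_apply, map_smul, map_sub, parity_parity]; module

theorem evenProj_parity (v : V) : evenProj (parity v) = evenProj v := by
  simp only [evenProj_apply, parity_parity]; module

theorem oddProj_parity (v : V) : oddProj (parity v) = -oddProj v := by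
  simp only [oddProj_apply, parity_parity]; module

theorem evenProj_of_even {v : V} (h : v ∈ homog V 0) : evenProj v = v := by
  rw [mem_homog, sgn_zero, one_smul] at h
  rw [evenProj_apply, h]; module

theorem oddProj_of_even {v : V} (h : v ∈ homog V 0) : oddProj v = 0 := by
  rw [mem_homog, sgn_zero, one_smul] at h
  rw [oddProj_apply, h]; module

theorem evenProj_of_odd {v : V} (h : v ∈ homog V 1) : evenProj v = 0 := by
  rw [mem_homog, sgn_one] at h
  rw [evenProj_apply, h]; module

theorem oddProj_of_odd {v : V} (h : v ∈ homog V 1) : oddProj v = v := by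
  rw [mem_homog, sgn_one] at h
  rw [oddProj_apply, h]; module

theorem evenProj_mem (v : V) : evenProj v ∈ homog V 0 := by
  rw [mem_homog, parity_evenProj]; simp

theorem oddProj_mem (v : V) : oddProj v ∈ homog V 1 := by
  rw [mem_homog, parity_oddProj]; simp

/-- The involution really encodes a decomposition `V = V₀ ⊕ V₁`. -/
theorem isCompl_homog : IsCompl (homog V 0) (homog V 1) := by
  constructor
  · rw [Submodule.disjoint_def]
    intro x h0 h1
    rw [← evenProj_of_even h0, evenProj_of_odd h1]
  · rw [codisjoint_iff, Submodule.eq_top_iff']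
    intro x
    rw [← evenProj_add_oddProj x]
    exact Submodule.add_mem_sup (evenProj_mem x) (oddProj_mem x)

end SuperSpace

/-! ### Lie superalgebras -/

/-- Complex Lie superalgebras. -/
class LieSuperalgebra (g : Type*) [AddCommGroup g] [Module ℂ g] extends SuperSpace g where
  /-- the superbracket -/
  br : g →ₗ[ℂ] g →ₗ[ℂ] g
  /-- `[g_i, g_j] ⊆ g_{i+j}` -/
  parity_br : ∀ x y, parity (br x y) = br (parity x) (parity y)
  /-- skew-supersymmetry -/
  br_skew : ∀ (i j : ZMod 2) (x y : g), x ∈ homog g i → y ∈ homog g j →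
    br x y = -(sgn (i * j) • br y x)
  /-- super Jacobi identity -/
  br_jacobi : ∀ (i j k : ZMod 2) (x y z : g), x ∈ homog g i → y ∈ homog g j → z ∈ homog g k →
    br x (br y z) = br (br x y) z + sgn (i * j) • br y (br x z)

open LieSuperalgebra (br parity_br br_skew br_jacobi)

/-- Homomorphisms of Lie superalgebras. -/
structure LieSuperHom (g : Type*) (g' : Type*) [AddCommGroup g] [Module ℂ g] [LieSuperalgebra g]
    [AddCommGroup g'] [Module ℂ g'] [LieSuperalgebra g'] where
  toLin : g →ₗ[ℂ] g'
  map_parity : ∀ x, toLin (parity x) = parity (toLin x)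
  map_br : ∀ x y, toLin (br x y) = br (toLin x) (toLin y)

/-- (Graded) subalgebras of a Lie superalgebra. -/
structure LieSubsuperalgebra (g : Type*) [AddCommGroup g] [Module ℂ g] [LieSuperalgebra g]
    extends Submodule ℂ g where
  parity_mem : ∀ x ∈ toSubmodule, parity x ∈ toSubmodule
  br_mem : ∀ x ∈ toSubmodule, ∀ y ∈ toSubmodule, br x y ∈ toSubmodule

instance (g : Type*) [AddCommGroup g] [Module ℂ g] [LieSuperalgebra g] :
    CoeSort (LieSubsuperalgebra g) (Type _) := ⟨fun S => ↥S.toSubmodule⟩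

/-- (Graded) ideals of a Lie superalgebra. -/
structure LieSuperideal (g : Type*) [AddCommGroup g] [Module ℂ g] [LieSuperalgebra g]
    extends Submodule ℂ g where
  parity_mem : ∀ x ∈ toSubmodule, parity x ∈ toSubmodule
  br_mem : ∀ x, ∀ y ∈ toSubmodule, br x y ∈ toSubmodule
  br_mem' : ∀ x, ∀ y ∈ toSubmodule, br y x ∈ toSubmodule

section Constructions

variable {g : Type*} [AddCommGroup g] [Module ℂ g] [LieSuperalgebra g]

theorem br_mem_homog {i j : ZMod 2} {x y : g} (hx : x ∈ homog g i) (hy : y ∈ homog g j) :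
    br x y ∈ homog g (i + j) := by
  rw [mem_homog] at *
  rw [parity_br, hx, hy]
  rcases zmod2_cases i with rfl | rfl <;> rcases zmod2_cases j with rfl | rfl <;>
    simp [show (1 + 1 : ZMod 2) = 0 from rfl]

instance (S : LieSubsuperalgebra g) : LieSuperalgebra S where
  parity := parity.restrict S.parity_mem
  parity_parity := fun v => Subtype.ext (parity_parity (v : g))
  br := LinearMap.mk₂ ℂ (fun x y => ⟨br (x : g) (y : g), S.br_mem _ x.2 _ y.2⟩)
    (by intros; ext; simp) (by intros; ext; simp) (by intros; ext; simp) (by intros; ext; simp)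
  parity_br := fun x y => Subtype.ext (parity_br (x : g) (y : g))
  br_skew := fun i j x y hx hy => Subtype.ext (br_skew i j (x : g) (y : g)
    (congrArg Subtype.val hx) (congrArg Subtype.val hy))
  br_jacobi := fun i j k x y z hx hy hz => Subtype.ext (br_jacobi i j k (x : g) (y : g) (z : g)
    (congrArg Subtype.val hx) (congrArg Subtype.val hy) (congrArg Subtype.val hz))

theorem LieSubsuperalgebra.coe_br (S : LieSubsuperalgebra g) (x y : S) :
    ((br x y : S) : g) = br (x : g) (y : g) := rfl

theorem LieSubsuperalgebra.coe_parity (S : LieSubsuperalgebra g) (x : S) :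
    ((parity x : S) : g) = parity (x : g) := rfl

/-- Homogeneous elements of a quotient lift to homogeneous elements. -/
theorem exists_homog_lift (I : Submodule ℂ g) (h : ∀ x ∈ I, parity x ∈ I) (i : ZMod 2)
    (x : g ⧸ I) (hx : I.mapQ I parity h x = sgn i • x) :
    ∃ y ∈ homog g i, I.mkQ y = x := by
  obtain ⟨z, rfl⟩ := I.mkQ_surjective x
  replace hx : I.mkQ (parity z) = sgn i • I.mkQ z := hx
  rcases zmod2_cases i with rfl | rfl
  · refine ⟨evenProj z, evenProj_mem z, ?_⟩
    rw [evenProj_apply, map_smul, map_add, hx, sgn_zero]; module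
  · refine ⟨oddProj z, oddProj_mem z, ?_⟩
    rw [oddProj_apply, map_smul, map_sub, hx, sgn_one]; module

instance (I : LieSuperideal g) : LieSuperalgebra (g ⧸ I.toSubmodule) where
  parity := I.toSubmodule.mapQ I.toSubmodule parity I.parity_mem
  parity_parity := by
    intro v
    obtain ⟨z, rfl⟩ := I.toSubmodule.mkQ_surjective v
    simp [parity_parity]
  br := LinearMap.liftQ₂ I.toSubmodule I.toSubmodule (br.compr₂ I.toSubmodule.mkQ)
    (by
      intro x hx
      rw [LinearMap.mem_ker]
      ext y
      simpa using I.br_mem' y x hx)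
    (by
      intro x hx
      rw [LinearMap.mem_ker]
      ext y
      simpa using I.br_mem y x hx)
  parity_br := by
    intro x y
    obtain ⟨x, rfl⟩ := I.toSubmodule.mkQ_surjective x
    obtain ⟨y, rfl⟩ := I.toSubmodule.mkQ_surjective y
    simp [parity_br]
  br_skew := by
    intro i j x y hx hy
    obtain ⟨x, hx', rfl⟩ := exists_homog_lift _ I.parity_mem i x hx
    obtain ⟨y, hy', rfl⟩ := exists_homog_lift _ I.parity_mem j y hy
    simpa using congrArg I.toSubmodule.mkQ (br_skew i j x y hx' hy')
  br_jacobi := by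
    intro i j k x y z hx hy hz
    obtain ⟨x, hx', rfl⟩ := exists_homog_lift _ I.parity_mem i x hx
    obtain ⟨y, hy', rfl⟩ := exists_homog_lift _ I.parity_mem j y hy
    obtain ⟨z, hz', rfl⟩ := exists_homog_lift _ I.parity_mem k z hz
    simpa using congrArg I.toSubmodule.mkQ (br_jacobi i j k x y z hx' hy' hz')

/-- The direct sum `g ⊕ ⋯ ⊕ g` of finitely many copies of `g`. -/
instance (k : ℕ) : LieSuperalgebra (Fin k → g) where
  parity := LinearMap.pi fun i => parity ∘ₗ LinearMap.proj i
  parity_parity := fun v => funext fun i => parity_parity (v i)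
  br := LinearMap.mk₂ ℂ (fun x y i => br (x i) (y i))
    (by intros; ext; simp) (by intros; ext; simp) (by intros; ext; simp) (by intros; ext; simp)
  parity_br := fun x y => funext fun i => parity_br (x i) (y i)
  br_skew := fun i j x y hx hy => funext fun l => br_skew i j (x l) (y l)
    (congrFun hx l) (congrFun hy l)
  br_jacobi := fun i j k x y z hx hy hz => funext fun l => br_jacobi i j k (x l) (y l) (z l)
    (congrFun hx l) (congrFun hy l) (congrFun hz l)

/-- The `i`-th coordinate projection `g ⊕ ⋯ ⊕ g → g`. -/
def LieSuperHom.proj (g : Type*) [AddCommGroup g] [Module ℂ g] [LieSuperalgebra g] {k : ℕ}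
    (i : Fin k) : LieSuperHom (Fin k → g) g where
  toLin := LinearMap.proj i
  map_parity := fun _ => rfl
  map_br := fun _ _ => rfl

/-- The diagonal embedding `g → g ⊕ ⋯ ⊕ g`. -/
def LieSuperHom.diag (g : Type*) [AddCommGroup g] [Module ℂ g] [LieSuperalgebra g] (k : ℕ) :
    LieSuperHom g (Fin k → g) where
  toLin := LinearMap.pi fun _ => LinearMap.id
  map_parity := fun _ => rfl
  map_br := fun _ _ => rfl

end Constructions

/-! ### Map Lie superalgebras `g ⊗ A` -/

section MapAlgebra

variable {g : Type*} [AddCommGroup g] [Module ℂ g] {A : Type*} [CommRing A] [Algebra ℂ A]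

/-- `(g ⊗ A)_i = g_i ⊗ A`. -/
instance [SuperSpace g] : SuperSpace (g ⊗[ℂ] A) where
  parity := parity.rTensor A
  parity_parity := by
    intro v
    induction v using TensorProduct.induction_on with
    | zero => simp
    | tmul x a => simp [parity_parity]
    | add x y hx hy => simp [hx, hy]

theorem parity_tmul [SuperSpace g] (x : g) (a : A) :
    parity (x ⊗ₜ[ℂ] a) = parity x ⊗ₜ[ℂ] a := rfl

theorem evenProj_tmul [SuperSpace g] (x : g) (a : A) :
    evenProj (x ⊗ₜ[ℂ] a) = evenProj x ⊗ₜ[ℂ] a := by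
  simp only [evenProj_apply, parity_tmul, ← TensorProduct.add_tmul, TensorProduct.smul_tmul']

theorem oddProj_tmul [SuperSpace g] (x : g) (a : A) :
    oddProj (x ⊗ₜ[ℂ] a) = oddProj x ⊗ₜ[ℂ] a := by
  simp only [oddProj_apply, parity_tmul, ← TensorProduct.sub_tmul, TensorProduct.smul_tmul']

theorem homog_tensor_induction [SuperSpace g] {i : ZMod 2} {p : g ⊗[ℂ] A → Prop}
    (h0 : p 0) (ht : ∀ x ∈ homog g i, ∀ a : A, p (x ⊗ₜ a)) (ha : ∀ x y, p x → p y → p (x + y))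
    (z : g ⊗[ℂ] A) (hz : z ∈ homog (g ⊗[ℂ] A) i) : p z := by
  rcases zmod2_cases i with rfl | rfl
  · rw [← evenProj_of_even hz]
    clear hz
    induction z using TensorProduct.induction_on with
    | zero => simpa using h0
    | tmul x a => rw [evenProj_tmul]; exact ht _ (evenProj_mem x) a
    | add x y hx hy => rw [map_add]; exact ha _ _ hx hy
  · rw [← oddProj_of_odd hz]
    clear hz
    induction z using TensorProduct.induction_on with
    | zero => simpa using h0
    | tmul x a => rw [oddProj_tmul]; exact ht _ (oddProj_mem x) a
    | add x y hx hy => rw [map_add]; exact ha _ _ hx hy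

/-- `[x ⊗ a, y ⊗ b] = [x, y] ⊗ ab`. -/
instance [LieSuperalgebra g] : LieSuperalgebra (g ⊗[ℂ] A) where
  br := TensorProduct.map₂ br (LinearMap.mul ℂ A)
  parity_br := by
    intro x y
    induction x using TensorProduct.induction_on with
    | zero => simp
    | add x x' hx hx' => simp only [map_add, LinearMap.add_apply, hx, hx']
    | tmul x a =>
      induction y using TensorProduct.induction_on with
      | zero => simp
      | add y y' hy hy' => simp only [map_add, hy, hy']
      | tmul y b =>
        change parity (br x y) ⊗ₜ[ℂ] (a * b) = br (parity x) (parity y) ⊗ₜ[ℂ] (a * b)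
        rw [parity_br]
  br_skew := by
    intro i j x y hx hy
    refine homog_tensor_induction (i := i)
      (p := fun x => TensorProduct.map₂ br (LinearMap.mul ℂ A) x y
        = -(sgn (i * j) • TensorProduct.map₂ br (LinearMap.mul ℂ A) y x)) ?_ ?_ ?_ x hx
    · simp
    · intro x hx a
      refine homog_tensor_induction (i := j)
        (p := fun y => TensorProduct.map₂ br (LinearMap.mul ℂ A) (x ⊗ₜ[ℂ] a) y
          = -(sgn (i * j) • TensorProduct.map₂ br (LinearMap.mul ℂ A) y (x ⊗ₜ[ℂ] a))) ?_ ?_ ?_ y hy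
      · simp
      · intro y hy b
        change br x y ⊗ₜ[ℂ] (a * b) = -(sgn (i * j) • (br y x ⊗ₜ[ℂ] (b * a)))
        rw [br_skew i j x y hx hy, mul_comm b a, TensorProduct.neg_tmul, TensorProduct.smul_tmul']
      · intro y y' hy hy'
        simp only [map_add, LinearMap.add_apply, hy, hy']; module
    · intro x x' hx hx'
      simp only [map_add, LinearMap.add_apply, hx, hx']; module
  br_jacobi := by
    intro i j k x y z hx hy hz
    generalize hβ : TensorProduct.map₂ (br (g := g)) (LinearMap.mul ℂ A) = β
    have hβt : ∀ (x y : g) (a b : A), β (x ⊗ₜ[ℂ] a) (y ⊗ₜ[ℂ] b) = br x y ⊗ₜ[ℂ] (a * b) := by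
      subst hβ; intros; rfl
    refine homog_tensor_induction (i := i)
      (p := fun x => β x (β y z) = β (β x y) z + sgn (i * j) • β y (β x z)) ?_ ?_ ?_ x hx
    · simp
    · intro x hx a
      refine homog_tensor_induction (i := j)
        (p := fun y => β (x ⊗ₜ[ℂ] a) (β y z)
          = β (β (x ⊗ₜ[ℂ] a) y) z + sgn (i * j) • β y (β (x ⊗ₜ[ℂ] a) z)) ?_ ?_ ?_ y hy
      · simp
      · intro y hy b
        refine homog_tensor_induction (i := k)
          (p := fun z => β (x ⊗ₜ[ℂ] a) (β (y ⊗ₜ[ℂ] b) z)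
            = β (β (x ⊗ₜ[ℂ] a) (y ⊗ₜ[ℂ] b)) z
              + sgn (i * j) • β (y ⊗ₜ[ℂ] b) (β (x ⊗ₜ[ℂ] a) z)) ?_ ?_ ?_ z hz
        · simp
        · intro z hz c
          simp only [hβt]
          rw [br_jacobi i j k x y z hx hy hz, mul_left_comm b a c, ← mul_assoc,
            TensorProduct.add_tmul, TensorProduct.smul_tmul']
        · intro z z' hz hz'
          simp only [map_add, hz, hz']; module
      · intro y y' hy hy'
        simp only [map_add, LinearMap.add_apply, hy, hy']; module
    · intro x x' hx hx'
      simp only [map_add, LinearMap.add_apply, hx, hx']; module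

theorem br_tmul [LieSuperalgebra g] (x y : g) (a b : A) :
    br (x ⊗ₜ[ℂ] a) (y ⊗ₜ[ℂ] b) = br x y ⊗ₜ[ℂ] (a * b) := rfl

/-- The inclusion `S ⊗ A → g ⊗ A` for a subalgebra `S ⊆ g`. -/
def LieSubsuperalgebra.mapIncl [LieSuperalgebra g] (S : LieSubsuperalgebra g) (A : Type*)
    [CommRing A] [Algebra ℂ A] : LieSuperHom (S ⊗[ℂ] A) (g ⊗[ℂ] A) where
  toLin := S.toSubmodule.subtype.rTensor A
  map_parity := by
    intro x
    induction x using TensorProduct.induction_on with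
    | zero => simp
    | tmul x a => rfl
    | add x y hx hy => simp only [map_add, hx, hy]
  map_br := by
    intro x y
    induction x using TensorProduct.induction_on with
    | zero => simp
    | add x x' hx hx' => simp only [map_add, LinearMap.add_apply, hx, hx']
    | tmul x a =>
      induction y using TensorProduct.induction_on with
      | zero => simp
      | add y y' hy hy' => simp only [map_add, hy, hy']
      | tmul y b => rfl

/-- The homomorphism `g ⊗ A → g ⊗ B` induced by an algebra homomorphism `A → B`. -/
def LieSuperHom.mapCoeff [LieSuperalgebra g] {B : Type*} [CommRing B] [Algebra ℂ B]
    (f : A →ₐ[ℂ] B) : LieSuperHom (g ⊗[ℂ] A) (g ⊗[ℂ] B) where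
  toLin := f.toLinearMap.lTensor g
  map_parity := by
    intro x
    induction x using TensorProduct.induction_on with
    | zero => simp
    | tmul x a => rfl
    | add x y hx hy => simp only [map_add, hx, hy]
  map_br := by
    intro x y
    induction x using TensorProduct.induction_on with
    | zero => simp
    | add x x' hx hx' => simp only [map_add, LinearMap.add_apply, hx, hx']
    | tmul x a =>
      induction y using TensorProduct.induction_on with
      | zero => simp
      | add y y' hy hy' => simp only [map_add, hy, hy']
      | tmul y b => simp [br_tmul]

end MapAlgebra

/-! ### The queer Lie superalgebra `q(n)` -/

/-- The superalgebra `Q(m)`: the pair `(X, Y)` stands for the block matrix `[[X, Y], [Y, X]]`, with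
even part `Y = 0` and odd part `X = 0`. -/
abbrev QMat (m : ℕ) : Type := Matrix (Fin m) (Fin m) ℂ × Matrix (Fin m) (Fin m) ℂ

/-- The block matrix `[[X, Y], [Y, X]]`. -/
def QMat.toBlock {m : ℕ} (x : QMat m) : Matrix (Fin m ⊕ Fin m) (Fin m ⊕ Fin m) ℂ :=
  Matrix.fromBlocks x.1 x.2 x.2 x.1

/-- The superbracket `[a, b] = ab - (-1)^{|a||b|} ba` of block matrices, see
`QMat.toBlock_br`. -/
def QMat.bracket {m : ℕ} : QMat m →ₗ[ℂ] QMat m →ₗ[ℂ] QMat m :=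
  LinearMap.mk₂ ℂ
    (fun x y => (x.1 * y.1 - y.1 * x.1 + (x.2 * y.2 + y.2 * x.2),
      x.1 * y.2 - y.2 * x.1 + (x.2 * y.1 - y.1 * x.2)))
    (by intros; ext1 <;> simp <;> noncomm_ring)
    (by intros; ext1 <;> simp [smul_sub, smul_add])
    (by intros; ext1 <;> simp <;> noncomm_ring)
    (by intros; ext1 <;> simp [smul_sub, smul_add])

theorem QMat.bracket_apply {m : ℕ} (x y : QMat m) : QMat.bracket x y =
    (x.1 * y.1 - y.1 * x.1 + (x.2 * y.2 + y.2 * x.2),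
      x.1 * y.2 - y.2 * x.1 + (x.2 * y.1 - y.1 * x.2)) := rfl

instance (m : ℕ) : SuperSpace (QMat m) where
  parity := LinearMap.prodMap LinearMap.id (-LinearMap.id)
  parity_parity := fun v => by simp

theorem QMat.parity_apply {m : ℕ} (x : QMat m) : parity x = (x.1, -x.2) := rfl

theorem QMat.mem_homog_zero {m : ℕ} {x : QMat m} : x ∈ homog (QMat m) 0 ↔ x.2 = 0 := by
  rw [mem_homog, QMat.parity_apply, sgn_zero, one_smul, Prod.ext_iff]
  simp [neg_eq_iff_add_eq_zero, ← two_smul ℂ]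

theorem QMat.mem_homog_one {m : ℕ} {x : QMat m} : x ∈ homog (QMat m) 1 ↔ x.1 = 0 := by
  rw [mem_homog, QMat.parity_apply, sgn_one, Prod.ext_iff]
  simp [eq_neg_iff_add_eq_zero, ← two_smul ℂ]

instance (m : ℕ) : LieSuperalgebra (QMat m) where
  br := QMat.bracket
  parity_br := by
    intro x y
    simp only [QMat.bracket_apply, QMat.parity_apply]
    ext1
    · simp
    · simp; noncomm_ring
  br_skew := by
    intro i j x y hx hy
    simp only [QMat.bracket_apply]
    rcases zmod2_cases i with rfl | rfl <;> rcases zmod2_cases j with rfl | rfl <;>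
      simp only [QMat.mem_homog_zero, QMat.mem_homog_one] at hx hy <;>
      ext1 <;> simp [hx, hy, add_comm]
  br_jacobi := by
    intro i j k x y z hx hy hz
    simp only [QMat.bracket_apply]
    rcases zmod2_cases i with rfl | rfl <;> rcases zmod2_cases j with rfl | rfl <;>
      simp only [QMat.mem_homog_zero, QMat.mem_homog_one] at hx hy <;>
      ext1 <;> simp [hx, hy] <;> noncomm_ring

/-- The bracket is the supercommutator of block matrices. -/
theorem QMat.toBlock_br {m : ℕ} (i j : ZMod 2) (x y : QMat m) (hx : x ∈ homog (QMat m) i)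
    (hy : y ∈ homog (QMat m) j) :
    QMat.toBlock (br x y) = x.toBlock * y.toBlock - sgn (i * j) • (y.toBlock * x.toBlock) := by
  change QMat.toBlock (QMat.bracket x y) = _
  simp only [QMat.bracket_apply, QMat.toBlock, Matrix.fromBlocks_multiply,
    Matrix.fromBlocks_smul, sub_eq_add_neg, Matrix.fromBlocks_neg, Matrix.fromBlocks_add]
  rcases zmod2_cases i with rfl | rfl <;> rcases zmod2_cases j with rfl | rfl <;>
    simp only [QMat.mem_homog_zero, QMat.mem_homog_one] at hx hy <;>
    simp [hx, hy, add_comm]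

/-- `q̃(n)`: the subalgebra of `Q(n+1)` of all `[[X, Y], [Y, X]]` with `tr Y = 0`. -/
def qTilde (n : ℕ) : LieSubsuperalgebra (QMat (n + 1)) where
  carrier := {x | x.2.trace = 0}
  add_mem' := by
    intro a b ha hb
    simp only [Set.mem_ofPred_eq] at *
    simp [ha, hb]
  zero_mem' := by simp
  smul_mem' := by
    intro c a ha
    simp only [Set.mem_ofPred_eq] at *
    simp [ha]
  parity_mem := by
    intro x (hx : x.2.trace = 0)
    change (-x.2).trace = 0
    simp [hx]
  br_mem := by
    intro x _ y _
    change (x.1 * y.2 - y.2 * x.1 + (x.2 * y.1 - y.1 * x.2)).trace = 0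
    simp [Matrix.trace_mul_comm x.1 y.2, Matrix.trace_mul_comm x.2 y.1]

theorem mem_qTilde {n : ℕ} {x : QMat (n + 1)} :
    x ∈ (qTilde n).toSubmodule ↔ x.2.trace = 0 := Iff.rfl

/-- The one-dimensional centre `ℂ I ⊆ q̃(n)`. -/
def qCenter (n : ℕ) : LieSuperideal (qTilde n) where
  carrier := {x | ∃ c : ℂ, (x : QMat (n + 1)) = (c • 1, 0)}
  add_mem' := by
    rintro a b ⟨c, hc⟩ ⟨d, hd⟩
    exact ⟨c + d, by simp [hc, hd, add_smul]⟩
  zero_mem' := ⟨0, by simp; rfl⟩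
  smul_mem' := by
    rintro r a ⟨c, hc⟩
    exact ⟨r * c, by simp [hc, mul_smul]⟩
  parity_mem := by
    rintro x ⟨c, hc⟩
    exact ⟨c, by rw [LieSubsuperalgebra.coe_parity, hc, QMat.parity_apply]; simp⟩
  br_mem := by
    rintro x y ⟨c, hc⟩
    exact ⟨0, by
      rw [LieSubsuperalgebra.coe_br, hc]
      change QMat.bracket _ _ = _
      simp [QMat.bracket_apply]⟩
  br_mem' := by
    rintro x y ⟨c, hc⟩
    exact ⟨0, by
      rw [LieSubsuperalgebra.coe_br, hc]
      change QMat.bracket _ _ = _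
      simp [QMat.bracket_apply]⟩

/-- The queer Lie superalgebra `q(n) = q̃(n) / ℂ I`. -/
abbrev Queer (n : ℕ) : Type := (qTilde n) ⧸ (qCenter n).toSubmodule

/-- The projection `q̃(n) → q(n)`. -/
def qMk (n : ℕ) : (qTilde n) →ₗ[ℂ] Queer n := (qCenter n).toSubmodule.mkQ

theorem qMk_br (n : ℕ) (x y : qTilde n) : br (qMk n x) (qMk n y) = qMk n (br x y) := rfl

theorem qMk_parity (n : ℕ) (x : qTilde n) : parity (qMk n x) = qMk n (parity x) := rfl

/-- The standard Cartan subalgebra `h ⊆ q(n)`: the image of the `[[X, Y], [Y, X]]` with `X`, `Y`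
diagonal and `tr Y = 0`. (As scalar matrices are zero in `q(n)`, it makes no difference whether
`tr X = 0` is also required.) -/
def cartan (n : ℕ) : LieSubsuperalgebra (Queer n) where
  carrier := {z | ∃ x : qTilde n, x.1.1.IsDiag ∧ x.1.2.IsDiag ∧ qMk n x = z}
  add_mem' := by
    rintro _ _ ⟨x, hx, hx', rfl⟩ ⟨y, hy, hy', rfl⟩
    exact ⟨x + y, hx.add hy, hx'.add hy', map_add _ _ _⟩
  zero_mem' := ⟨0, Matrix.isDiag_zero, Matrix.isDiag_zero, map_zero _⟩
  smul_mem' := by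
    rintro c _ ⟨x, hx, hx', rfl⟩
    exact ⟨c • x, hx.smul c, hx'.smul c, map_smul _ _ _⟩
  parity_mem := by
    rintro _ ⟨x, hx, hx', rfl⟩
    exact ⟨parity x, hx, hx'.neg, rfl⟩
  br_mem := by
    rintro _ ⟨x, hx, hx', rfl⟩ _ ⟨y, hy, hy', rfl⟩
    have key : ∀ a b : Matrix (Fin (n + 1)) (Fin (n + 1)) ℂ, a.IsDiag → b.IsDiag →
        (a * b).IsDiag := by
      intro a b ha hb
      rw [← ha.diagonal_diag, ← hb.diagonal_diag, Matrix.diagonal_mul_diagonal]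
      exact Matrix.isDiag_diagonal _
    refine ⟨br x y, ?_, ?_, (qMk_br n x y).symm⟩
    · exact ((key _ _ hx hy).sub (key _ _ hy hx)).add ((key _ _ hx' hy').add (key _ _ hy' hx'))
    · exact ((key _ _ hx hy').sub (key _ _ hy' hx)).add ((key _ _ hx' hy).sub (key _ _ hy hx'))

/-- `n⁺ ⊆ q(n)`: the image of the `[[X, Y], [Y, X]]` with `X`, `Y` strictly upper triangular. -/
def nPlus (n : ℕ) : Submodule ℂ (Queer n) where
  carrier := {z | ∃ x : qTilde n, (∀ i j, j ≤ i → x.1.1 i j = 0) ∧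
    (∀ i j, j ≤ i → x.1.2 i j = 0) ∧ qMk n x = z}
  add_mem' := by
    rintro _ _ ⟨x, hx, hx', rfl⟩ ⟨y, hy, hy', rfl⟩
    refine ⟨x + y, fun i j h => ?_, fun i j h => ?_, map_add _ _ _⟩
    · simp [hx i j h, hy i j h]
    · simp [hx' i j h, hy' i j h]
  zero_mem' := ⟨0, fun _ _ _ => rfl, fun _ _ _ => rfl, map_zero _⟩
  smul_mem' := by
    rintro c _ ⟨x, hx, hx', rfl⟩
    refine ⟨c • x, fun i j h => ?_, fun i j h => ?_, map_smul _ _ _⟩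
    · simp [hx i j h]
    · simp [hx' i j h]

theorem parity_mem_nPlus {n : ℕ} {x : Queer n} (hx : x ∈ nPlus n) : parity x ∈ nPlus n := by
  obtain ⟨x, hx, hx', rfl⟩ := hx
  refine ⟨parity x, hx, fun i j h => ?_, rfl⟩
  change (-x.1.2) i j = 0
  simp [hx' i j h]

/-- `h₀`, the even part of the Cartan subalgebra. -/
abbrev cartanEven (n : ℕ) : Submodule ℂ (cartan n) := homog (cartan n) 0

/-! ### Modules over Lie superalgebras -/

/-- Supermodules `V = V₀ ⊕ V₁` over a Lie superalgebra `g`. -/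
structure SuperModule (g : Type u) [AddCommGroup g] [Module ℂ g] [LieSuperalgebra g] where
  carrier : Type v
  [addCommGroup : AddCommGroup carrier]
  [module : Module ℂ carrier]
  [superSpace : SuperSpace carrier]
  act : g →ₗ[ℂ] Module.End ℂ carrier
  /-- `g_i V_j ⊆ V_{i+j}` -/
  parity_act : ∀ x v, parity (act x v) = act (parity x) (parity v)
  act_br : ∀ (i j : ZMod 2) (x y : g), x ∈ homog g i → y ∈ homog g j → ∀ v,
    act (br x y) v = act x (act y v) - sgn (i * j) • act y (act x v)

namespace SuperModule

attribute [instance] addCommGroup module superSpace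

instance (g : Type u) [AddCommGroup g] [Module ℂ g] [LieSuperalgebra g] :
    CoeSort (SuperModule.{u, v} g) (Type v) := ⟨SuperModule.carrier⟩

variable {g : Type u} [AddCommGroup g] [Module ℂ g] [LieSuperalgebra g]
variable {h : Type w} [AddCommGroup h] [Module ℂ h] [LieSuperalgebra h]

/-- Isomorphism of modules: a linear bijection commuting with the action. As usual for queer Lie
superalgebras, it is not required to be homogeneous. -/
def Iso (M N : SuperModule g) : Prop :=
  ∃ e : M ≃ₗ[ℂ] N, ∀ x v, e (M.act x v) = N.act x (e v)

/-- (Graded) submodules. -/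
def IsSub (M : SuperModule g) (W : Submodule ℂ M) : Prop :=
  (∀ v ∈ W, parity v ∈ W) ∧ ∀ x, ∀ v ∈ W, M.act x v ∈ W

/-- A module is irreducible if it is nonzero and has no nontrivial graded submodule. -/
def IsIrreducible (M : SuperModule g) : Prop :=
  Nontrivial M ∧ ∀ W, M.IsSub W → W = ⊥ ∨ W = ⊤

/-- A graded submodule as a module. -/
def sub (M : SuperModule g) (W : Submodule ℂ M) (hW : M.IsSub W) : SuperModule g where
  carrier := W
  superSpace :=
    { parity := parity.restrict hW.1
      parity_parity := fun v => Subtype.ext (parity_parity (v : M)) }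
  act :=
    { toFun := fun x => (M.act x).restrict (hW.2 x)
      map_add' := fun x y => by ext; simp
      map_smul' := fun c x => by ext; simp }
  parity_act := fun x v => Subtype.ext (M.parity_act x v)
  act_br := fun i j x y hx hy v => Subtype.ext (M.act_br i j x y hx hy v)

/-- The quotient by a graded submodule. -/
def quot (M : SuperModule g) (W : Submodule ℂ M) (hW : M.IsSub W) : SuperModule g where
  carrier := M ⧸ W
  superSpace :=
    { parity := W.mapQ W parity hW.1
      parity_parity := fun v => by
        obtain ⟨v, rfl⟩ := W.mkQ_surjective v
        simp [parity_parity] }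
  act :=
    { toFun := fun x => W.mapQ W (M.act x) (hW.2 x)
      map_add' := fun x y => by ext; simp
      map_smul' := fun c x => by ext; simp }
  parity_act := fun x v => by
    obtain ⟨v, rfl⟩ := W.mkQ_surjective v
    exact congrArg W.mkQ (M.parity_act x v)
  act_br := fun i j x y hx hy v => by
    obtain ⟨v, rfl⟩ := W.mkQ_surjective v
    exact congrArg W.mkQ (M.act_br i j x y hx hy v)

/-- The pullback of a module along a homomorphism of Lie superalgebras. -/
def comap (f : LieSuperHom h g) (M : SuperModule g) : SuperModule h where
  carrier := M
  act := M.act ∘ₗ f.toLin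
  parity_act := fun x v => by simp [M.parity_act, f.map_parity]
  act_br := fun i j x y hx hy v => by
    have hx' : f.toLin x ∈ homog g i := by
      rw [mem_homog] at *; rw [← f.map_parity, hx, map_smul]
    have hy' : f.toLin y ∈ homog g j := by
      rw [mem_homog] at *; rw [← f.map_parity, hy, map_smul]
    simp [f.map_br, M.act_br i j _ _ hx' hy']

/-- The direct sum `M ⊕ N`. -/
def directSum (M N : SuperModule g) : SuperModule g where
  carrier := M × N
  superSpace :=
    { parity := parity.prodMap parity
      parity_parity := fun v => Prod.ext (parity_parity v.1) (parity_parity v.2) }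
  act :=
    { toFun := fun x => (M.act x).prodMap (N.act x)
      map_add' := fun x y => by ext <;> simp
      map_smul' := fun c x => by ext <;> simp }
  parity_act := fun x v => Prod.ext (M.parity_act x v.1) (N.parity_act x v.2)
  act_br := fun i j x y hx hy v =>
    Prod.ext (M.act_br i j x y hx hy v.1) (N.act_br i j x y hx hy v.2)

/-- The operator by which `x` acts on `M ⊗ N`:
`x (v ⊗ w) = xv ⊗ w + (-1)^{|x||v|} v ⊗ xw` for homogeneous `x` and `v`. -/
def tensorAct (M N : SuperModule g) : g →ₗ[ℂ] Module.End ℂ (M ⊗[ℂ] N) where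
  toFun x := TensorProduct.map (M.act x) LinearMap.id
    + TensorProduct.map LinearMap.id (N.act (evenProj x))
    + TensorProduct.map parity (N.act (oddProj x))
  map_add' := fun x y => by
    simp only [map_add, TensorProduct.map_add_left, TensorProduct.map_add_right]; abel
  map_smul' := fun c x => by
    simp only [map_smul, TensorProduct.map_smul_left, TensorProduct.map_smul_right, smul_add,
      RingHom.id_apply]

theorem tensorAct_tmul (M N : SuperModule g) (x : g) (v : M) (w : N) :
    tensorAct M N x (v ⊗ₜ w) = M.act x v ⊗ₜ w + v ⊗ₜ N.act (evenProj x) w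
      + parity v ⊗ₜ N.act (oddProj x) w := rfl

theorem tensorAct_even (M N : SuperModule g) {x : g} (hx : x ∈ homog g 0) (v : M) (w : N) :
    tensorAct M N x (v ⊗ₜ w) = M.act x v ⊗ₜ w + v ⊗ₜ N.act x w := by
  rw [tensorAct_tmul, evenProj_of_even hx, oddProj_of_even hx]; simp

theorem tensorAct_odd (M N : SuperModule g) {x : g} (hx : x ∈ homog g 1) (v : M) (w : N) :
    tensorAct M N x (v ⊗ₜ w) = M.act x v ⊗ₜ w + parity v ⊗ₜ N.act x w := by
  rw [tensorAct_tmul, evenProj_of_odd hx, oddProj_of_odd hx]; simp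

theorem parity_act_even (M : SuperModule g) {x : g} (hx : x ∈ homog g 0) (v : M) :
    parity (M.act x v) = M.act x (parity v) := by
  rw [M.parity_act, mem_homog.1 hx]; simp

theorem parity_act_odd (M : SuperModule g) {x : g} (hx : x ∈ homog g 1) (v : M) :
    parity (M.act x v) = -M.act x (parity v) := by
  rw [M.parity_act, mem_homog.1 hx]; simp

/-- The tensor product `M ⊗ N` of two modules over `g`. -/
def tensor (M N : SuperModule g) : SuperModule g where
  carrier := M ⊗[ℂ] N
  superSpace :=
    { parity := TensorProduct.map parity parity
      parity_parity := fun v => by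
        induction v using TensorProduct.induction_on with
        | zero => simp
        | tmul v w => simp [parity_parity]
        | add v w hv hw => simp only [map_add, hv, hw] }
  act := tensorAct M N
  parity_act := fun x v => by
    induction v using TensorProduct.induction_on with
    | zero => simp
    | tmul v w =>
      simp [tensorAct_tmul, M.parity_act, N.parity_act, evenProj_parity, oddProj_parity,
        parity_evenProj, parity_oddProj]
    | add v w hv hw => simp only [map_add]; exact congrArg₂ (· + ·) hv hw
  act_br := fun i j x y hx hy v => by
    induction v using TensorProduct.induction_on with
    | zero => simp
    | add v w hv hw => simp only [map_add, hv, hw]; module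
    | tmul v w =>
      have hxy := br_mem_homog hx hy
      rcases zmod2_cases i with rfl | rfl <;> rcases zmod2_cases j with rfl | rfl
      · rw [add_zero] at hxy
        simp only [tensorAct_even M N hxy, tensorAct_even M N hx, tensorAct_even M N hy, map_add,
          M.act_br 0 0 x y hx hy, N.act_br 0 0 x y hx hy, TensorProduct.sub_tmul,
          TensorProduct.tmul_sub, mul_zero, sgn_zero, one_smul]
        abel
      · rw [zero_add] at hxy
        simp only [tensorAct_odd M N hxy, tensorAct_even M N hx, tensorAct_odd M N hy, map_add,
          M.act_br 0 1 x y hx hy, N.act_br 0 1 x y hx hy, TensorProduct.sub_tmul,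
          TensorProduct.tmul_sub, zero_mul, sgn_zero, one_smul, parity_act_even M hx]
        abel
      · rw [add_zero] at hxy
        simp only [tensorAct_odd M N hxy, tensorAct_odd M N hx, tensorAct_even M N hy, map_add,
          M.act_br 1 0 x y hx hy, N.act_br 1 0 x y hx hy, TensorProduct.sub_tmul,
          TensorProduct.tmul_sub, mul_zero, sgn_zero, one_smul, parity_act_even M hy]
        abel
      · rw [show (1 + 1 : ZMod 2) = 0 from rfl] at hxy
        simp only [tensorAct_even M N hxy, tensorAct_odd M N hx, tensorAct_odd M N hy, map_add,
          M.act_br 1 1 x y hx hy, N.act_br 1 1 x y hx hy, TensorProduct.sub_tmul,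
          TensorProduct.tmul_sub, mul_one, sgn_one, neg_smul, one_smul, parity_act_odd M hx,
          parity_act_odd M hy, parity_parity, TensorProduct.neg_tmul,
          TensorProduct.tmul_neg]
        abel

/-! ### The irreducible product -/

/-- `φ` is an odd element of `End_g(M)` with `φ² = -1`; here `End_g(M)` is taken in the super sense,
`φ(xv) = (-1)^{|x|} x φ(v)` for odd `φ`. -/
structure IsOddSchur (M : SuperModule g) (φ : Module.End ℂ M) : Prop where
  odd : ∀ v, parity (φ v) = -φ (parity v)
  comm : ∀ x v, φ (M.act x v) = M.act (parity x) (φ v)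
  sq : ∀ v, φ (φ v) = -v

/-- The operator `√-1 φ₁ ⊗ φ₂` on `M ⊗ N` for odd `φ₁`, `φ₂`, with the usual sign
`(φ₁ ⊗ φ₂)(v ⊗ w) = (-1)^{|v|} φ₁ v ⊗ φ₂ w`. -/
def hatOp (M N : SuperModule g) (φ₁ : Module.End ℂ M) (φ₂ : Module.End ℂ N) :
    Module.End ℂ (M.tensor N) :=
  Complex.I • TensorProduct.map (φ₁ ∘ₗ parity) φ₂

/-- The submodule `{v ∈ M ⊗ N | (√-1 φ₁ ⊗ φ₂) v = v}`. -/
def hatSub (M N : SuperModule g) (φ₁ : Module.End ℂ M) (φ₂ : Module.End ℂ N) :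
    Submodule ℂ (M.tensor N) :=
  LinearMap.eqLocus (hatOp M N φ₁ φ₂) LinearMap.id

theorem isSub_hatSub (M N : SuperModule g) {φ₁ : Module.End ℂ M} {φ₂ : Module.End ℂ N}
    (h₁ : M.IsOddSchur φ₁) (h₂ : N.IsOddSchur φ₂) : (M.tensor N).IsSub (hatSub M N φ₁ φ₂) := by
  have hp : ∀ v : M.tensor N, hatOp M N φ₁ φ₂ (parity v) = parity (hatOp M N φ₁ φ₂ v) := by
    intro v
    change (Complex.I • TensorProduct.map (φ₁ ∘ₗ parity) φ₂) (TensorProduct.map parity parity v)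
      = TensorProduct.map parity parity ((Complex.I • TensorProduct.map (φ₁ ∘ₗ parity) φ₂) v)
    induction v using TensorProduct.induction_on with
    | zero => simp
    | tmul v w => simp [h₁.odd, h₂.odd, parity_parity, TensorProduct.neg_tmul,
        TensorProduct.tmul_neg]
    | add v w hv hw => simp only [map_add, hv, hw]
  have ha : ∀ (x : g) (v : M.tensor N),
      hatOp M N φ₁ φ₂ ((M.tensor N).act x v) = (M.tensor N).act x (hatOp M N φ₁ φ₂ v) := by
    intro x v
    change (Complex.I • TensorProduct.map (φ₁ ∘ₗ parity) φ₂) (tensorAct M N x v)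
      = tensorAct M N x ((Complex.I • TensorProduct.map (φ₁ ∘ₗ parity) φ₂) v)
    induction v using TensorProduct.induction_on with
    | zero => simp
    | tmul v w =>
      simp only [tensorAct_tmul, map_add, LinearMap.smul_apply, TensorProduct.map_tmul,
        LinearMap.comp_apply, map_smul, M.parity_act, h₁.comm, h₂.comm, parity_parity,
        parity_evenProj, parity_oddProj, h₁.odd, map_neg, LinearMap.neg_apply,
        TensorProduct.tmul_neg, TensorProduct.neg_tmul, smul_add]
    | add v w hv hw => simp only [map_add, hv, hw]
  constructor
  · intro v (hv : hatOp M N φ₁ φ₂ v = v)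
    change hatOp M N φ₁ φ₂ (parity v) = parity v
    rw [hp, hv]
  · intro x v (hv : hatOp M N φ₁ φ₂ v = v)
    change hatOp M N φ₁ φ₂ ((M.tensor N).act x v) = (M.tensor N).act x v
    rw [ha, hv]

open Classical in
/-- The irreducible product `M ⊗̂ N`. It is `M ⊗ N` if that is irreducible, and the submodule
`{v | (√-1 φ₁ ⊗ φ₂) v = v}` otherwise, where `φ₁`, `φ₂` are odd endomorphisms with square `-1`,
which exist if `M` and `N` are irreducible and finite-dimensional modules over `g¹` and `g²`,
regarded as modules over `g = g¹ ⊕ g²`, and `M ⊗ N` is not irreducible. (Hence the last case is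
only a dummy value for other `M`, `N`.) -/
def irrProd (M N : SuperModule.{u, v} g) : SuperModule.{u, v} g :=
  if (M.tensor N).IsIrreducible then M.tensor N
  else if H : ∃ φ : Module.End ℂ M × Module.End ℂ N, M.IsOddSchur φ.1 ∧ N.IsOddSchur φ.2 then
    (M.tensor N).sub (hatSub M N H.choose.1 H.choose.2)
      (isSub_hatSub M N H.choose_spec.1 H.choose_spec.2)
  else M.tensor N

/-- The left-bracketed product `((V₀ ⊗̂ V₁) ⊗̂ ⋯ ) ⊗̂ V_k`. -/
def iterIrrProd : (k : ℕ) → (Fin (k + 1) → SuperModule.{u, v} g) → SuperModule.{u, v} g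
  | 0, V => V 0
  | k + 1, V => irrProd (iterIrrProd k fun i => V i.castSucc) (V (Fin.last (k + 1)))

/-- The irreducible product `V₀ ⊗̂ ⋯ ⊗̂ V_k` of `g`-modules. It is formed over
`g ⊕ ⋯ ⊕ g`, where the `i`-th summand acts on `V_i` and the others act on `V_i` by zero, and it
becomes a `g`-module through the diagonal embedding. -/
def irrProdFamily (k : ℕ) (V : Fin (k + 1) → SuperModule.{u, v} g) : SuperModule.{u, v} g :=
  (iterIrrProd k fun i => (V i).comap (LieSuperHom.proj g i)).comap (LieSuperHom.diag g (k + 1))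

/-! ### The largest proper submodule -/

theorem isSub_sSup (M : SuperModule g) (S : Set (Submodule ℂ M)) (hS : ∀ W ∈ S, M.IsSub W) :
    M.IsSub (sSup S) := by
  constructor
  · intro v hv
    have : sSup S ≤ (sSup S).comap parity := sSup_le fun W hW v hv =>
      (le_sSup hW : W ≤ sSup S) ((hS W hW).1 v hv)
    exact this hv
  · intro x v hv
    have : sSup S ≤ (sSup S).comap (M.act x) := sSup_le fun W hW v hv =>
      (le_sSup hW : W ≤ sSup S) ((hS W hW).2 x v hv)
    exact this hv

/-- The sum of all proper graded submodules. -/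
def maxSub (M : SuperModule g) : Submodule ℂ M := sSup {W | M.IsSub W ∧ W ≠ ⊤}

theorem isSub_maxSub (M : SuperModule g) : M.IsSub M.maxSub :=
  M.isSub_sSup _ fun _ hW => hW.1

end SuperModule

/-! ### Enveloping superalgebras and induced modules -/

/-- The relations `xy - (-1)^{|x||y|} yx = [x, y]`. -/
inductive EnvRel (g : Type u) [AddCommGroup g] [Module ℂ g] [LieSuperalgebra g] :
    TensorAlgebra ℂ g → TensorAlgebra ℂ g → Prop
  | mk (i j : ZMod 2) (x y : g) (hx : x ∈ homog g i) (hy : y ∈ homog g j) :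
    EnvRel g (TensorAlgebra.ι ℂ x * TensorAlgebra.ι ℂ y)
      (sgn (i * j) • (TensorAlgebra.ι ℂ y * TensorAlgebra.ι ℂ x) + TensorAlgebra.ι ℂ (br x y))

/-- The universal enveloping superalgebra `U(g)`. -/
def Env (g : Type u) [AddCommGroup g] [Module ℂ g] [LieSuperalgebra g] : Type u :=
  RingQuot (EnvRel g)

namespace Env

variable {g : Type u} [AddCommGroup g] [Module ℂ g] [LieSuperalgebra g]

instance : Ring (Env g) := inferInstanceAs (Ring (RingQuot (EnvRel g)))

instance : Algebra ℂ (Env g) := inferInstanceAs (Algebra ℂ (RingQuot (EnvRel g)))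

/-- The canonical map `g → U(g)`. -/
def ι (g : Type u) [AddCommGroup g] [Module ℂ g] [LieSuperalgebra g] : g →ₗ[ℂ] Env g :=
  (RingQuot.mkAlgHom ℂ (EnvRel g)).toLinearMap ∘ₗ TensorAlgebra.ι ℂ

theorem ι_mul_ι {i j : ZMod 2} {x y : g} (hx : x ∈ homog g i) (hy : y ∈ homog g j) :
    ι g x * ι g y = sgn (i * j) • (ι g y * ι g x) + ι g (br x y) := by
  have := RingQuot.mkAlgHom_rel ℂ (EnvRel.mk i j x y hx hy)
  rw [map_mul, map_add, map_smul, map_mul] at this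
  exact this

/-- The parity automorphism of `U(g)`. -/
def parityHom (g : Type u) [AddCommGroup g] [Module ℂ g] [LieSuperalgebra g] :
    Env g →ₐ[ℂ] Env g :=
  RingQuot.liftAlgHom ℂ ⟨TensorAlgebra.lift ℂ (ι g ∘ₗ parity), by
    rintro _ _ ⟨i, j, x, y, hx, hy⟩
    simp only [map_mul, map_add, map_smul, TensorAlgebra.lift_ι_apply, LinearMap.comp_apply]
    have hx' : parity x ∈ homog g i := by
      rw [mem_homog] at *; rw [hx, map_smul, hx]
    have hy' : parity y ∈ homog g j := by
      rw [mem_homog] at *; rw [hy, map_smul, hy]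
    rw [ι_mul_ι hx' hy', parity_br]⟩

theorem parityHom_ι (x : g) : parityHom g (ι g x) = ι g (parity x) := by
  have : parityHom g (RingQuot.mkAlgHom ℂ (EnvRel g) (TensorAlgebra.ι ℂ x))
    = TensorAlgebra.lift ℂ (ι g ∘ₗ parity) (TensorAlgebra.ι ℂ x) :=
    RingQuot.liftAlgHom_mkAlgHom_apply ℂ _ _ _
  rw [TensorAlgebra.lift_ι_apply] at this
  exact this

theorem parityHom_parityHom (u : Env g) : parityHom g (parityHom g u) = u := by
  have : (parityHom g).comp (parityHom g) = AlgHom.id ℂ (Env g) := by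
    apply RingQuot.ringQuot_ext'
    ext x
    change parityHom g (parityHom g (ι g x)) = ι g x
    rw [parityHom_ι, parityHom_ι, parity_parity]
  exact DFunLike.congr_fun this u

end Env

section Induced

variable {g : Type u} [AddCommGroup g] [Module ℂ g] [LieSuperalgebra g]
variable {h : Type w} [AddCommGroup h] [Module ℂ h] [LieSuperalgebra h]

/-- The module `U(g) ⊗ M` with `g` acting by left multiplication. -/
def envTensor (g : Type u) [AddCommGroup g] [Module ℂ g] [LieSuperalgebra g]
    (M : SuperModule.{w, v} h) : SuperModule.{u, max u v} g where
  carrier := Env g ⊗[ℂ] M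
  superSpace :=
    { parity := TensorProduct.map (Env.parityHom g).toLinearMap parity
      parity_parity := fun v => by
        induction v using TensorProduct.induction_on with
        | zero => simp
        | tmul v w => simp [parity_parity, Env.parityHom_parityHom]
        | add v w hv hw => simp only [map_add, hv, hw] }
  act :=
    { toFun := fun x => (LinearMap.mulLeft ℂ (Env.ι g x)).rTensor M
      map_add' := fun x y => by ext; simp [add_mul, TensorProduct.add_tmul]
      map_smul' := fun c x => by ext; simp [TensorProduct.smul_tmul'] }
  parity_act := fun x v => by
    induction v using TensorProduct.induction_on with
    | zero => simp
    | tmul v w => simp [Env.parityHom_ι]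
    | add v w hv hw => simp only [map_add]; exact congrArg₂ (· + ·) hv hw
  act_br := fun i j x y hx hy v => by
    induction v using TensorProduct.induction_on with
    | zero => simp
    | tmul v w =>
      have := Env.ι_mul_ι hx hy
      simp only [LinearMap.coe_mk, AddHom.coe_mk, LinearMap.rTensor_tmul, LinearMap.mulLeft_apply]
      rw [← mul_assoc, ← mul_assoc, this, add_mul, TensorProduct.add_tmul, smul_mul_assoc,
        TensorProduct.smul_tmul']
      abel
    | add v w hv hw => simp only [map_add, hv, hw]; module

/-- The span of all `u x ⊗ v - u ⊗ x v` for `x ∈ h` and all `u y ⊗ v` for `y ∈ n`. -/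
def inducedRel (f : LieSuperHom h g) (n : Submodule ℂ g) (M : SuperModule.{w, v} h) :
    Submodule ℂ (envTensor g M) :=
  Submodule.span ℂ
    ({z | ∃ (u : Env g) (x : h) (m : M),
        z = (u * Env.ι g (f.toLin x)) ⊗ₜ[ℂ] m - u ⊗ₜ[ℂ] M.act x m} ∪
      {z | ∃ (u : Env g), ∃ y ∈ n, ∃ m : M, z = (u * Env.ι g y) ⊗ₜ[ℂ] m})

theorem isSub_inducedRel (f : LieSuperHom h g) (n : Submodule ℂ g) (hn : ∀ y ∈ n, parity y ∈ n)
    (M : SuperModule.{w, v} h) : (envTensor g M).IsSub (inducedRel f n M) := by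
  constructor
  · intro z hz
    have : inducedRel f n M ≤ (inducedRel f n M).comap parity := by
      refine Submodule.span_le.2 ?_
      rintro _ (⟨u, x, m, rfl⟩ | ⟨u, y, hy, m, rfl⟩)
      · refine Submodule.subset_span (Or.inl ⟨Env.parityHom g u, parity x, parity m, ?_⟩)
        change TensorProduct.map (Env.parityHom g).toLinearMap parity _ = _
        simp [Env.parityHom_ι, f.map_parity, M.parity_act]
      · refine Submodule.subset_span (Or.inr ⟨Env.parityHom g u, parity y, hn y hy, parity m, ?_⟩)
        change TensorProduct.map (Env.parityHom g).toLinearMap parity _ = _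
        simp [Env.parityHom_ι]
    exact this hz
  · intro w z hz
    have : inducedRel f n M ≤ (inducedRel f n M).comap ((envTensor g M).act w) := by
      refine Submodule.span_le.2 ?_
      rintro _ (⟨u, x, m, rfl⟩ | ⟨u, y, hy, m, rfl⟩)
      · refine Submodule.subset_span (Or.inl ⟨Env.ι g w * u, x, m, ?_⟩)
        change (LinearMap.mulLeft ℂ (Env.ι g w)).rTensor M _ = _
        simp [mul_assoc]
      · refine Submodule.subset_span (Or.inr ⟨Env.ι g w * u, y, hy, m, ?_⟩)
        change (LinearMap.mulLeft ℂ (Env.ι g w)).rTensor M _ = _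
        simp [mul_assoc]
    exact this hz

/-- The induced module `U(g) ⊗_{U(b)} M`, where `b = h ⊕ n ⊆ g` and the `h`-module `M` is made a
`b`-module by letting `n` act by zero. As `U(b)` is generated by `h` and `n`, the relations
`ub ⊗ v = u ⊗ bv` are needed only for `b` in `h` or in `n`. -/
def induced (f : LieSuperHom h g) (n : Submodule ℂ g) (hn : ∀ y ∈ n, parity y ∈ n)
    (M : SuperModule.{w, v} h) : SuperModule.{u, max u v} g :=
  (envTensor g M).quot (inducedRel f n M) (isSub_inducedRel f n hn M)

end Induced

/-! ### Existence of irreducible submodules and Clifford modules -/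

section Existence

variable {h : Type w} [AddCommGroup h] [Module ℂ h] [LieSuperalgebra h]

theorem SuperModule.exists_irreducible_sub (M : SuperModule.{w, v} h) [FiniteDimensional ℂ M]
    [Nontrivial M] : ∃ (W : Submodule ℂ M) (hW : M.IsSub W), (M.sub W hW).IsIrreducible := by
  have hne : {W : Submodule ℂ M | M.IsSub W ∧ W ≠ ⊥}.Nonempty :=
    ⟨⊤, ⟨fun _ _ => trivial, fun _ _ _ => trivial⟩, top_ne_bot⟩
  obtain ⟨W, ⟨hW, hW0⟩, hmin⟩ := WellFounded.has_min (wellFounded_lt (α := Submodule ℂ M)) _ hne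
  refine ⟨W, hW, (Submodule.nontrivial_iff_ne_bot).2 hW0, fun U hU => ?_⟩
  by_contra! hcon
  let U' : Submodule ℂ M := Submodule.map W.subtype U
  refine hmin U' ⟨⟨?_, ?_⟩, ?_⟩ ?_
  · rintro _ ⟨y, hy, rfl⟩
    exact ⟨_, hU.1 y hy, rfl⟩
  · rintro x _ ⟨y, hy, rfl⟩
    exact ⟨_, hU.2 x y hy, rfl⟩
  · intro h0
    refine hcon.1 ((Submodule.eq_bot_iff U).2 fun y hy => ?_)
    exact Subtype.ext ((Submodule.eq_bot_iff U').1 h0 _ ⟨y, hy, rfl⟩)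
  · refine lt_of_le_of_ne (Submodule.map_subtype_le W U) fun heq => hcon.2 ?_
    refine (Submodule.eq_top_iff').2 fun y => ?_
    have hy : W.subtype y ∈ U' := by rw [heq]; exact (y : W).2
    obtain ⟨z, hz, hzy⟩ := hy
    rwa [← show z = y from Subtype.ext hzy]

theorem finite_cliffordAlgebra {V : Type*} [AddCommGroup V] [Module ℂ V] [FiniteDimensional ℂ V]
    (Q : QuadraticForm ℂ V) : FiniteDimensional ℂ (CliffordAlgebra Q) := by
  have : FiniteDimensional ℂ (ExteriorAlgebra ℂ V) := by
    have htop := (DirectSum.Decomposition.isInternal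
      (fun i : ℕ => ⋀[ℂ]^i V)).submodule_iSup_eq_top
    have hle : (⨆ i : ℕ, ⋀[ℂ]^i V) ≤ ⨆ i : Fin (Module.finrank ℂ V + 1), ⋀[ℂ]^(i : ℕ) V := by
      refine iSup_le fun i => ?_
      by_cases hi : i < Module.finrank ℂ V + 1
      · exact le_iSup (fun i : Fin (Module.finrank ℂ V + 1) => ⋀[ℂ]^(i : ℕ) V) ⟨i, hi⟩
      · have : Module.finrank ℂ (⋀[ℂ]^i V) = 0 := by
          rw [exteriorPower.finrank_eq]; exact Nat.choose_eq_zero_of_lt (by omega)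
        rw [Submodule.finrank_eq_zero.1 this]
        exact bot_le
    rw [htop, top_le_iff] at hle
    refine Module.Finite.of_fg_top ?_
    rw [← hle]
    exact Submodule.fg_iSup _ fun i => Module.Finite.iff_fg.1 inferInstance
  exact Module.Finite.equiv (CliffordAlgebra.equivExterior Q).symm

/-- The quadratic form `x ↦ ½ l([x₁, x₁])`, where `x₁` is the odd part of `x`. -/
def cliffordForm (l : h →ₗ[ℂ] ℂ) : QuadraticForm ℂ h :=
  LinearMap.BilinMap.toQuadraticMap ((1 / 2 : ℂ) • (br.compl₁₂ oddProj oddProj).compr₂ l)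

theorem cliffordForm_polar (l : h →ₗ[ℂ] ℂ) {x y : h} (hx : x ∈ homog h 1) (hy : y ∈ homog h 1) :
    QuadraticMap.polar (cliffordForm l) x y = l (br x y) := by
  have h1 : br y x = br x y := by
    rw [br_skew 1 1 y x hy hx]; simp
  rw [cliffordForm, LinearMap.BilinMap.polar_toQuadraticMap]
  simp only [LinearMap.smul_apply, LinearMap.compr₂_apply, LinearMap.compl₁₂_apply,
    oddProj_of_odd hx, oddProj_of_odd hy, h1, smul_eq_mul]
  ring

/-- If `h₀` is central in `h` and `l` vanishes on `h₁`, then `h` acts on the Clifford algebra of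
`cliffordForm l`: even `x` act by `l x` and odd `x` by multiplication. -/
def cliffordModule (l : h →ₗ[ℂ] ℂ) (hl : ∀ x ∈ homog h 1, l x = 0)
    (hc : ∀ x ∈ homog h 0, ∀ y, br x y = 0) : SuperModule.{w, w} h where
  carrier := CliffordAlgebra (cliffordForm l)
  superSpace :=
    { parity := CliffordAlgebra.involute.toLinearMap
      parity_parity := fun v => by simp }
  act := LinearMap.mul ℂ _ ∘ₗ
    (Algebra.linearMap ℂ _ ∘ₗ l + CliffordAlgebra.ι (cliffordForm l) ∘ₗ oddProj)
  parity_act := fun x v => by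
    have : l (parity x) = l x := by
      conv_lhs => rw [← evenProj_add_oddProj x]
      conv_rhs => rw [← evenProj_add_oddProj x]
      simp [parity_evenProj, parity_oddProj, hl _ (oddProj_mem x)]
    change CliffordAlgebra.involute _ = _ * CliffordAlgebra.involute v
    simp [this, oddProj_parity, add_mul]
  act_br := fun i j x y hx hy v => by
    have h0 : ∀ z ∈ homog h 0, ∀ v : CliffordAlgebra (cliffordForm l),
        (LinearMap.mul ℂ _ ∘ₗ (Algebra.linearMap ℂ _ ∘ₗ l +
          CliffordAlgebra.ι (cliffordForm l) ∘ₗ oddProj)) z v = l z • v := by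
      intro z hz v
      simp [oddProj_of_even hz, Algebra.smul_def]
    have h1 : ∀ z ∈ homog h 1, ∀ v : CliffordAlgebra (cliffordForm l),
        (LinearMap.mul ℂ _ ∘ₗ (Algebra.linearMap ℂ _ ∘ₗ l +
          CliffordAlgebra.ι (cliffordForm l) ∘ₗ oddProj)) z v
            = CliffordAlgebra.ι (cliffordForm l) z * v := by
      intro z hz v
      simp [oddProj_of_odd hz, hl z hz]
    rcases zmod2_cases i with rfl | rfl
    · rw [hc x hx y, h0 x hx, h0 x hx, map_smul, zero_mul, sgn_zero, one_smul, sub_self, map_zero]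
      rfl
    · rcases zmod2_cases j with rfl | rfl
      · rw [br_skew 1 0 x y hx hy, hc y hy x, h0 y hy, h0 y hy, map_smul, smul_zero, neg_zero,
          map_zero, mul_zero, sgn_zero, one_smul, sub_self]
        rfl
      · have hxy := br_mem_homog hx hy
        rw [show (1 + 1 : ZMod 2) = 0 from rfl] at hxy
        rw [h0 _ hxy, h1 x hx, h1 y hy, h1 x hx, h1 y hy, mul_one, sgn_one, neg_smul, one_smul,
          sub_neg_eq_add, ← mul_assoc, ← mul_assoc, ← add_mul, CliffordAlgebra.ι_mul_ι_add_swap,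
          cliffordForm_polar l hx hy, Algebra.smul_def]

theorem cliffordModule_act_even (l : h →ₗ[ℂ] ℂ) (hl : ∀ x ∈ homog h 1, l x = 0)
    (hc : ∀ x ∈ homog h 0, ∀ y, br x y = 0) (x : h) (hx : x ∈ homog h 0)
    (v : cliffordModule l hl hc) : (cliffordModule l hl hc).act x v = l x • v := by
  let v' : CliffordAlgebra (cliffordForm l) := v
  change (LinearMap.mul ℂ (CliffordAlgebra (cliffordForm l)) ∘ₗ (Algebra.linearMap ℂ _ ∘ₗ l +
    CliffordAlgebra.ι (cliffordForm l) ∘ₗ oddProj)) x v' = l x • v'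
  simp [oddProj_of_even hx, Algebra.smul_def]

theorem exists_module_of_central [FiniteDimensional ℂ h]
    (hc : ∀ x ∈ homog h 0, ∀ y : h, br x y = 0) {A : Type u} [CommRing A] [Algebra ℂ A]
    (ψ : Module.Dual ℂ (homog h 0 ⊗[ℂ] A)) (I : Ideal A) [FiniteDimensional ℂ (A ⧸ I)]
    (hψ : ∀ (x : homog h 0), ∀ a ∈ I, ψ (x ⊗ₜ a) = 0) :
    ∃ H : SuperModule.{max u w, max u w} (h ⊗[ℂ] A), H.IsIrreducible ∧ FiniteDimensional ℂ H ∧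
      ∀ (x : homog h 0 ⊗[ℂ] A) (v : H),
        H.act ((homog h 0).subtype.rTensor A x) v = ψ x • v := by
  let π : A →ₐ[ℂ] A ⧸ I := Ideal.Quotient.mkₐ ℂ I
  obtain ⟨s, hs⟩ := π.toLinearMap.exists_rightInverse_of_surjective
    (LinearMap.range_eq_top.2 (Ideal.Quotient.mkₐ_surjective ℂ I))
  let p : h →ₗ[ℂ] homog h 0 := evenProj.codRestrict _ evenProj_mem
  let l : h ⊗[ℂ] (A ⧸ I) →ₗ[ℂ] ℂ := ψ ∘ₗ TensorProduct.map p s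
  have hl : ∀ x ∈ homog (h ⊗[ℂ] (A ⧸ I)) 1, l x = 0 := by
    intro x hx
    refine homog_tensor_induction (p := fun x => l x = 0) (map_zero l) ?_ ?_ x hx
    · intro x hx a
      have : p x = 0 := Subtype.ext (evenProj_of_odd hx)
      simp [l, this]
    · intro x y hx hy
      rw [map_add, hx, hy, add_zero]
  have hc' : ∀ x ∈ homog (h ⊗[ℂ] (A ⧸ I)) 0, ∀ y, br x y = 0 := by
    intro x hx y
    refine homog_tensor_induction (p := fun x => br x y = 0) ?_ ?_ ?_ x hx
    · simp
    · intro x hx a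
      induction y using TensorProduct.induction_on with
      | zero => simp
      | tmul y b => rw [br_tmul, hc x hx, TensorProduct.zero_tmul]
      | add y y' hy hy' => rw [map_add, hy, hy', add_zero]
    · intro x x' hx hx'
      rw [map_add, LinearMap.add_apply, hx, hx', add_zero]
  let C := (cliffordModule l hl hc').comap (LieSuperHom.mapCoeff (g := h) π)
  have : FiniteDimensional ℂ C := finite_cliffordAlgebra (cliffordForm l)
  have : Nontrivial C := inferInstanceAs (Nontrivial (CliffordAlgebra (cliffordForm l)))
  have hC : ∀ (x : homog h 0 ⊗[ℂ] A) (v : C),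
      C.act ((homog h 0).subtype.rTensor A x) v = ψ x • v := by
    intro x v
    induction x using TensorProduct.induction_on with
    | zero => simp
    | add x y hx hy => rw [map_add, map_add, map_add, LinearMap.add_apply, add_smul, hx, hy]
    | tmul x a =>
      have h1 : l ((x : h) ⊗ₜ π a) = ψ (x ⊗ₜ a) := by
        have hx : p x = x := Subtype.ext (evenProj_of_even x.2)
        have ha : s (π a) - a ∈ I := by
          rw [← Ideal.Quotient.eq_zero_iff_mem, map_sub, sub_eq_zero]
          exact LinearMap.congr_fun hs (π a)
        have := hψ x _ ha
        rw [TensorProduct.tmul_sub, map_sub, sub_eq_zero] at this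
        simp only [l, LinearMap.comp_apply, TensorProduct.map_tmul, hx, this]
      have h2 : (x : h) ⊗ₜ[ℂ] π a ∈ homog (h ⊗[ℂ] (A ⧸ I)) 0 := by
        rw [mem_homog, parity_tmul, mem_homog.1 x.2, sgn_zero, one_smul, one_smul]
      rw [← h1]
      exact cliffordModule_act_even l hl hc' _ h2 v
  obtain ⟨W, hW, hirr⟩ := C.exists_irreducible_sub
  exact ⟨C.sub W hW, hirr, inferInstanceAs (FiniteDimensional ℂ W),
    fun x v => Subtype.ext (hC x (v : W).1)⟩

end Existence

/-! ### The modules `H(ψ)` and `V(ψ)` -/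

section HighestWeight

variable (n : ℕ) (A : Type u) [CommRing A] [Algebra ℂ A]

/-- `L(h ⊗ A)`: the linear functionals on `h₀ ⊗ A` which vanish on `h₀ ⊗ I` for some ideal `I` of
finite codimension. -/
def weightFunctionals : Submodule ℂ (Module.Dual ℂ (cartanEven n ⊗[ℂ] A)) where
  carrier := {ψ | ∃ I : Ideal A, FiniteDimensional ℂ (A ⧸ I) ∧
    ∀ (x : cartanEven n), ∀ a ∈ I, ψ (x ⊗ₜ a) = 0}
  add_mem' := by
    rintro ψ φ ⟨I, hI, hψ⟩ ⟨J, hJ, hφ⟩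
    refine ⟨I ⊓ J, ?_, fun x a ha => by simp [hψ x a ha.1, hφ x a ha.2]⟩
    let f : (A ⧸ (I ⊓ J)) →ₗ[ℂ] (A ⧸ I) × (A ⧸ J) :=
      (Ideal.Quotient.factorₐ ℂ inf_le_left).toLinearMap.prod
        (Ideal.Quotient.factorₐ ℂ inf_le_right).toLinearMap
    refine FiniteDimensional.of_injective f ?_
    rw [injective_iff_map_eq_zero]
    intro a ha
    obtain ⟨a, rfl⟩ := Ideal.Quotient.mk_surjective a
    have h1 : Ideal.Quotient.mk I a = 0 := congrArg Prod.fst ha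
    have h2 : Ideal.Quotient.mk J a = 0 := congrArg Prod.snd ha
    rw [Ideal.Quotient.eq_zero_iff_mem] at *
    exact ⟨h1, h2⟩
  zero_mem' := ⟨⊤, inferInstance, fun _ _ _ => rfl⟩
  smul_mem' := by
    rintro c ψ ⟨I, hI, hψ⟩
    exact ⟨I, hI, fun x a ha => by simp [hψ x a ha]⟩

variable {n A}

/-- `H` is an irreducible finite-dimensional `h ⊗ A`-module on which every `x ∈ h₀ ⊗ A` acts as the
scalar `ψ(x)`. -/
structure IsCartanModule (ψ : Module.Dual ℂ (cartanEven n ⊗[ℂ] A))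
    (H : SuperModule.{u, v} (cartan n ⊗[ℂ] A)) : Prop where
  irreducible : H.IsIrreducible
  finite : FiniteDimensional ℂ H
  act_even : ∀ (x : cartanEven n ⊗[ℂ] A) (v : H),
    H.act ((cartanEven n).subtype.rTensor A x) v = ψ x • v

theorem cartan_even_central {x : cartan n} (hx : x ∈ homog (cartan n) 0) (y : cartan n) :
    br x y = 0 := by
  obtain ⟨_, x, hx1, hx2, rfl⟩ := x
  obtain ⟨_, y, hy1, hy2, rfl⟩ := y
  have h0 : x.1.2 = 0 := by
    have h1 : qMk n (parity x) = (1 : ℂ) • qMk n x := sgn_zero ▸ congrArg Subtype.val hx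
    rw [one_smul] at h1
    obtain ⟨c, hc⟩ := (Submodule.Quotient.eq _).1 h1
    have h2 : -x.1.2 - x.1.2 = 0 := congrArg Prod.snd hc
    rw [← neg_add', ← two_smul ℂ] at h2
    simpa using h2
  have hcomm : ∀ a b : Matrix (Fin (n + 1)) (Fin (n + 1)) ℂ, a.IsDiag → b.IsDiag →
      a * b = b * a := by
    intro a b ha hb
    rw [← ha.diagonal_diag, ← hb.diagonal_diag, Matrix.diagonal_mul_diagonal,
      Matrix.diagonal_mul_diagonal]
    simp only [mul_comm]
  have hb : br x y = 0 := by
    refine Subtype.ext ?_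
    change QMat.bracket x.1 y.1 = 0
    rw [QMat.bracket_apply, h0, hcomm _ _ hx1 hy1, hcomm _ _ hx1 hy2]
    simp
  refine Subtype.ext ?_
  change qMk n (br x y) = 0
  rw [hb, map_zero]

theorem exists_cartanModule (ψ : weightFunctionals n A) :
    ∃ H : SuperModule.{u, u} (cartan n ⊗[ℂ] A), IsCartanModule ψ.1 H := by
  have hfd : FiniteDimensional ℂ (cartan n) := by
    have : FiniteDimensional ℂ (qTilde n) := inferInstance
    have : FiniteDimensional ℂ (Queer n) := inferInstance
    infer_instance
  have hc : ∀ x ∈ homog (cartan n) 0, ∀ y : cartan n, br x y = 0 :=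
    fun x hx y => cartan_even_central hx y
  obtain ⟨I, hI, hψ⟩ := ψ.2
  exact (exists_module_of_central hc ψ.1 I hψ).imp fun H h => ⟨h.1, h.2.1, h.2.2⟩

/-- `H(ψ)`, the irreducible finite-dimensional `h ⊗ A`-module on which `h₀ ⊗ A` acts by `ψ`
(it is unique up to isomorphism). -/
def HModule (ψ : weightFunctionals n A) : SuperModule.{u, u} (cartan n ⊗[ℂ] A) :=
  (exists_cartanModule ψ).choose

theorem isCartanModule_HModule (ψ : weightFunctionals n A) : IsCartanModule ψ.1 (HModule ψ) :=
  (exists_cartanModule ψ).choose_spec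

variable (n A) in
/-- `n⁺ ⊗ A ⊆ q ⊗ A`. -/
def nPlusMap : Submodule ℂ (Queer n ⊗[ℂ] A) := LinearMap.range ((nPlus n).subtype.rTensor A)

theorem parity_mem_nPlusMap : ∀ y ∈ nPlusMap n A, parity y ∈ nPlusMap n A := by
  rintro _ ⟨x, rfl⟩
  induction x using TensorProduct.induction_on with
  | zero => simp
  | tmul x a => exact ⟨(⟨parity x.1, parity_mem_nPlus x.2⟩ : nPlus n) ⊗ₜ a, rfl⟩
  | add x y hx hy => rw [map_add, map_add]; exact Submodule.add_mem _ hx hy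

/-- `V̄(ψ) = U(q ⊗ A) ⊗_{U(b ⊗ A)} H(ψ)`, where `b = h ⊕ n⁺` and `n⁺ ⊗ A` acts on `H(ψ)` by
zero. -/
def VermaModule (ψ : weightFunctionals n A) : SuperModule.{u, u} (Queer n ⊗[ℂ] A) :=
  induced ((cartan n).mapIncl A) (nPlusMap n A) parity_mem_nPlusMap (HModule ψ)

/-- `V(ψ)`, the quotient of `V̄(ψ)` by its unique maximal proper submodule. -/
def VModule (ψ : weightFunctionals n A) : SuperModule.{u, u} (Queer n ⊗[ℂ] A) :=
  (VermaModule ψ).quot (VermaModule ψ).maxSub (VermaModule ψ).isSub_maxSub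

/-- `Ann_A(V)`: the sum of all ideals `I` of `A` with `(q ⊗ I) V = 0`. -/
def annihilator (V : SuperModule.{u, v} (Queer n ⊗[ℂ] A)) : Ideal A :=
  sSup {I | ∀ (x : Queer n), ∀ a ∈ I, ∀ v : V, V.act (x ⊗ₜ a) v = 0}

/-- The support of `V`: the maximal ideals of `A` containing `Ann_A(V)`. -/
def support (V : SuperModule.{u, v} (Queer n ⊗[ℂ] A)) : Set (MaximalSpectrum A) :=
  {m | annihilator V ≤ m.asIdeal}

end HighestWeight

end MapQueer

end

open MapQueer

open scoped TensorProduct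

noncomputable section

namespace MapQueer

universe u v w

open _root_.MapQueer.SuperSpace (parity parity_parity)
open _root_.MapQueer.LieSuperalgebra (br parity_br br_skew br_jacobi)

/-! ### Burnside's theorem and its graded version -/

/-! Write g = q ⊗ A. The element d = diag(0, -1, …, -n) ⊗ 1 acts on the matrix diagonal j - i by the
scalar j - i, so n⁻ ⊗ A, h ⊗ A and n⁺ ⊗ A carry negative, zero and positive integral ad
d-eigenvalues. Call a module topped by ψ (`HasTop`) if it is spanned by a nonzero space on which h₀
⊗ A acts through ψ, together with eigenvectors of d for ψ(d) - 1, ψ(d) - 2, …. The module V(ψ) is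
irreducible and topped by ψ (`isIrreducible_simple`, `hasTop_simple`). Conversely, every irreducible
finite-dimensional module topped by ψ is V(ψ), up to a change of parity that the notion of
isomorphism ignores (`iso_simple`). Its top space contains an irreducible h ⊗ A-module. There the
odd elements satisfy Clifford relations fixed by ψ, so H(ψ) maps onto that module
(`exists_intertwiner`), and the universal property of the induced module does the rest. Since top
weights add under ⊗ (`HasTop.tensor`), only the structure of the products has to be found.

Disjoint supports make the annihilators coprime, and the Chinese remainder theorem then gives, for
any prescribed actions on the factors, one element of g realising all of them (`exists_act_eq`). So
the factors behave like modules over separate summands of g ⊕ ⋯ ⊕ g (`Independent`).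

For two irreducible factors M, N acted on independently, Burnside's theorem with parity adjoined
decides. If one factor has no odd endomorphism of square -1, its action generates all operators and
M ⊗ N is irreducible (`tensor_of_no_oddSchur`). If both have one, θ = √-1 φ₁ ⊗ φ₂ is an involution
commuting with g. A second commuting involution exchanges its eigenspaces, so M ⊗ N is two copies of
the fixed space (`iso_directSum`). The fixed space is irreducible because every operator commuting
with θ preserves each graded submodule inside it (`mem_stabilizer_of_oddSchur`). Thus M ⊗ N is one
or two copies of the irreducible product, and iteration handles k factors.

That H(ψ) embeds in its induced module, which is what makes V(ψ) nonzero, is shown without a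
Poincaré–Birkhoff–Witt basis: an explicit action of g is built on U(n⁻ ⊗ A) ⊗ H(ψ)
(`Splitting.exists_injective`). -/

/-- A set of endomorphisms without invariant subspaces generates the full endomorphism algebra. -/
theorem subalgebra_eq_top_of_irreducible {V : Type*} [AddCommGroup V] [Module ℂ V]
    [FiniteDimensional ℂ V] (R : Subalgebra ℂ (Module.End ℂ V))
    (h : ∀ W : Submodule ℂ V, (∀ T ∈ R, ∀ v ∈ W, T v ∈ W) → W = ⊥ ∨ W = ⊤) : R = ⊤ := by
  classical
  rcases subsingleton_or_nontrivial V with hV | hV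
  · refine Algebra.eq_top_iff.2 fun T => ?_
    rw [show T = 0 from LinearMap.ext fun v => Subsingleton.elim _ _]
    exact R.zero_mem
  have hsc : ∀ W : Submodule R V, ∀ c : ℂ, ∀ v ∈ W, c • v ∈ W := fun W c v hv => by
    have := W.smul_mem (algebraMap ℂ R c) hv
    rwa [algebraMap_smul] at this
  have hs : IsSimpleModule R V := by
    refine IsSimpleModule.mk (toIsSimpleOrder := ?_)
    refine { exists_pair_ne := ⟨⊥, ⊤, bot_ne_top⟩, eq_bot_or_eq_top := fun W => ?_ }
    let W' : Submodule ℂ V := { W with smul_mem' := fun c v hv => hsc W c v hv }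
    rcases h W' (fun T hT v hv => W.smul_mem (⟨T, hT⟩ : R) hv) with hW | hW
    · exact Or.inl ((Submodule.eq_bot_iff W).2 fun v hv => (Submodule.eq_bot_iff W').1 hW v hv)
    · exact Or.inr ((Submodule.eq_top_iff').2 fun v => (Submodule.eq_top_iff').1 hW v)
  -- Schur's lemma: an eigenspace of an `R`-linear map is `R`-stable and nonzero, hence everything.
  have hscalar : ∀ g : Module.End R V, ∃ c : ℂ, ∀ v, g v = c • v := by
    intro g
    let g' : Module.End ℂ V := { g with
      map_smul' := fun c v => by
        have := g.map_smul (algebraMap ℂ R c) v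
        rwa [algebraMap_smul, algebraMap_smul] at this }
    obtain ⟨c, hc⟩ := Module.End.exists_eigenvalue g'
    refine ⟨c, fun v => ?_⟩
    have hst : ∀ T ∈ R, ∀ v ∈ g'.eigenspace c, T v ∈ g'.eigenspace c := fun T hT v hv => by
      rw [Module.End.mem_eigenspace_iff] at hv ⊢
      have h1 : g' (T v) = T (g' v) := g.map_smul (⟨T, hT⟩ : R) v
      rw [h1, hv, map_smul]
    rcases h _ hst with hW | hW
    · exact absurd hW hc
    · exact Module.End.mem_eigenspace_iff.1 ((Submodule.eq_top_iff').1 hW v)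
  refine Algebra.eq_top_iff.2 fun T => ?_
  -- The commutant consists of scalars, so any ℂ-linear `T` is linear over it. Density on a finite
  -- spanning set then produces an element of `R` equal to `T`.
  let f : Module.End (Module.End R V) V :=
    { toFun := T
      map_add' := map_add T
      map_smul' := fun g v => by
        obtain ⟨c, hc⟩ := hscalar g
        change T (g v) = g (T v)
        rw [hc, hc, map_smul] }
  obtain ⟨s, hs'⟩ := (Module.finite_def (R := ℂ) (M := V)).1 inferInstance
  obtain ⟨r, hr⟩ := jacobson_density (R := R) f s
  have : T = r.1 := LinearMap.ext_on (s := (s : Set V)) hs' fun m hm => hr m hm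
  rw [this]
  exact r.2

/-! ### The algebra generated by the action, parity, and odd Schur endomorphisms. -/

namespace SuperModule

variable {g : Type u} [AddCommGroup g] [Module ℂ g] [LieSuperalgebra g]

/-- The algebra of operators generated by the action of `g`. -/
def actAlg (M : SuperModule.{u, v} g) : Subalgebra ℂ (Module.End ℂ M) :=
  Algebra.adjoin ℂ (Set.range M.act)

theorem act_mem_actAlg (M : SuperModule.{u, v} g) (x : g) : M.act x ∈ M.actAlg :=
  Algebra.subset_adjoin ⟨x, rfl⟩

theorem parity_sq (M : SuperModule.{u, v} g) : (parity : Module.End ℂ M) * parity = 1 :=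
  LinearMap.ext fun v => parity_parity v

theorem parity_mul_act (M : SuperModule.{u, v} g) (x : g) :
    (parity : Module.End ℂ M) * M.act x = M.act (parity x) * parity :=
  LinearMap.ext fun v => M.parity_act x v

theorem parity_conj_mem_actAlg (M : SuperModule.{u, v} g) {T : Module.End ℂ M}
    (hT : T ∈ M.actAlg) : (parity : Module.End ℂ M) * T * parity ∈ M.actAlg := by
  induction hT using Algebra.adjoin_induction with
  | mem T hT =>
    obtain ⟨x, rfl⟩ := hT
    rw [M.parity_mul_act, mul_assoc, M.parity_sq, mul_one]
    exact M.act_mem_actAlg _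
  | algebraMap r =>
    rw [← Algebra.commutes, mul_assoc, M.parity_sq, mul_one]
    exact Subalgebra.algebraMap_mem _ r
  | add S T _ _ hS hT => rw [mul_add, add_mul]; exact add_mem hS hT
  | mul S T _ _ hS hT =>
    have : (parity : Module.End ℂ M) * (S * T) * parity
        = (parity * S * parity) * (parity * T * parity) := by
      rw [show (parity * S * parity) * (parity * T * parity)
        = parity * S * (parity * parity : Module.End ℂ M) * T * parity by noncomm_ring,
        M.parity_sq]
      noncomm_ring
    rw [this]; exact mul_mem hS hT

variable {M : SuperModule.{u, v} g}

/-- Every operator on an irreducible module has the form `r + s P` where `r`, `s` are in the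
algebra generated by the action and `P` is the parity. -/
theorem IsIrreducible.exists_actAlg (hM : M.IsIrreducible) [FiniteDimensional ℂ M]
    (T : Module.End ℂ M) : ∃ r ∈ M.actAlg, ∃ s ∈ M.actAlg, T = r + s * parity := by
  -- Conjugation by P maps the algebra generated by the action to itself, so adjoining P only adds
  -- its multiples by P. The subspaces stable under the result are exactly the graded submodules, so
  -- Burnside's theorem applies.
  let R : Subalgebra ℂ (Module.End ℂ M) :=
    { carrier := {T | ∃ r ∈ M.actAlg, ∃ s ∈ M.actAlg, T = r + s * parity}
      mul_mem' := by
        rintro _ _ ⟨r, hr, s, hs, rfl⟩ ⟨r', hr', s', hs', rfl⟩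
        refine ⟨r * r' + s * (parity * s' * parity), add_mem (mul_mem hr hr')
          (mul_mem hs (M.parity_conj_mem_actAlg hs')),
          r * s' + s * (parity * r' * parity), add_mem (mul_mem hr hs')
          (mul_mem hs (M.parity_conj_mem_actAlg hr')), ?_⟩
        have h1 : s * (parity * r' * parity) * parity = s * parity * r' := by
          rw [show s * (parity * r' * parity) * parity
            = s * parity * r' * (parity * parity : Module.End ℂ M) by noncomm_ring,
            M.parity_sq, mul_one]
        rw [add_mul (r * s'), h1]
        noncomm_ring
      add_mem' := by
        rintro _ _ ⟨r, hr, s, hs, rfl⟩ ⟨r', hr', s', hs', rfl⟩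
        exact ⟨r + r', add_mem hr hr', s + s', add_mem hs hs', by noncomm_ring⟩
      algebraMap_mem' := fun c => ⟨_, Subalgebra.algebraMap_mem _ c, 0, zero_mem _, by simp⟩ }
  have hR : R = ⊤ := by
    refine subalgebra_eq_top_of_irreducible R fun W hW => hM.2 W ⟨fun v hv => ?_, fun x v hv => ?_⟩
    · exact hW parity ⟨0, zero_mem _, 1, one_mem _, by simp⟩ v hv
    · exact hW (M.act x) ⟨_, M.act_mem_actAlg x, 0, zero_mem _, by simp⟩ v hv
  have : T ∈ R := hR ▸ Algebra.mem_top
  exact this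

/-- The involution `φ P` attached to an odd Schur endomorphism `φ`. -/
theorem IsOddSchur.sq_mul_parity {φ : Module.End ℂ M} (h : M.IsOddSchur φ) :
    (φ * parity) * (φ * parity) = 1 := by
  ext v
  change φ (parity (φ (parity v))) = v
  rw [h.odd, parity_parity, map_neg, h.sq, neg_neg]

theorem IsOddSchur.commute_act {φ : Module.End ℂ M} (h : M.IsOddSchur φ) (x : g) :
    (φ * parity) * M.act x = M.act x * (φ * parity) := by
  ext v
  change φ (parity (M.act x v)) = M.act x (φ (parity v))
  rw [M.parity_act, h.comm, parity_parity]

theorem commute_of_mem_actAlg {u : Module.End ℂ M} (hu : ∀ x, u * M.act x = M.act x * u)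
    {T : Module.End ℂ M} (hT : T ∈ M.actAlg) : u * T = T * u := by
  have : M.actAlg ≤ Subalgebra.centralizer ℂ {u} := by
    refine Algebra.adjoin_le ?_
    rintro _ ⟨x, rfl⟩
    rw [SetLike.mem_coe, Subalgebra.mem_centralizer_iff]
    rintro _ rfl
    exact hu x
  exact (Subalgebra.mem_centralizer_iff ℂ).1 (this hT) u rfl

/-- The involution u = φP commutes with the action but anticommutes with P. In T = r + sP the part
sP therefore anticommutes with u, so if T commutes with u this part vanishes, u being invertible.
Hence the generated algebra is the full commutant of u. -/
theorem IsIrreducible.mem_actAlg_of_commute (hM : M.IsIrreducible) [FiniteDimensional ℂ M]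
    {φ : Module.End ℂ M} (h : M.IsOddSchur φ) {T : Module.End ℂ M}
    (hT : (φ * parity) * T = T * (φ * parity)) : T ∈ M.actAlg := by
  obtain ⟨r, hr, s, hs, rfl⟩ := hM.exists_actAlg T
  have hr' := commute_of_mem_actAlg h.commute_act hr
  have hs' := commute_of_mem_actAlg h.commute_act hs
  have h2 := h.sq_mul_parity
  have hP : (parity : Module.End ℂ M) * (φ * parity) = -((φ * parity) * parity) := by
    ext v
    change parity (φ (parity v)) = -φ (parity (parity v))
    rw [h.odd]
  generalize φ * parity = u at *
  have h3 : s * parity * u = -(u * (s * parity)) := by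
    rw [mul_assoc, hP, ← mul_assoc, hs']; noncomm_ring
  have h4 : u * (s * parity) = 0 := by
    rw [mul_add, add_mul, hr', h3] at hT
    have := add_left_cancel hT
    rw [eq_neg_iff_add_eq_zero, ← two_smul ℂ] at this
    simpa using this
  have h5 : s * parity = 0 := by
    rw [← one_mul (s * parity), ← h2, mul_assoc, h4, mul_zero]
  rw [h5, add_zero]
  exact hr

/-- An irreducible module without odd Schur endomorphism has no ungraded submodules. -/
theorem IsIrreducible.eq_bot_or_top (hM : M.IsIrreducible)
    (hφ : ¬ ∃ φ, M.IsOddSchur φ) (W : Submodule ℂ M) (hW : ∀ x, ∀ v ∈ W, M.act x v ∈ W) :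
    W = ⊥ ∨ W = ⊤ := by
  by_contra! hcon
  have hp : Function.Involutive (parity : M → M) := parity_parity
  let W' : Submodule ℂ M := W.comap parity
  have hW' : ∀ x, ∀ v ∈ W', M.act x v ∈ W' := fun x v hv => by
    change parity (M.act x v) ∈ W
    rw [M.parity_act]
    exact hW _ _ hv
  -- Both W ∩ PW and W + PW are graded, so a nontrivial ungraded W forces M = W ⊕ PW.
  have hinf : W ⊓ W' = ⊥ := by
    have hst : M.IsSub (W ⊓ W') := by
      refine ⟨fun v hv => ⟨hv.2, ?_⟩, fun x v hv => ⟨hW x v hv.1, hW' x v hv.2⟩⟩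
      change parity (parity v) ∈ W
      rw [parity_parity]; exact hv.1
    rcases hM.2 _ hst with h | h
    · exact h
    · exact absurd (top_le_iff.1 (h ▸ inf_le_left)) hcon.2
  have hsup : W ⊔ W' = ⊤ := by
    have hst : M.IsSub (W ⊔ W') := by
      refine ⟨fun v hv => ?_, fun x v hv => ?_⟩
      · obtain ⟨a, ha, b, hb, rfl⟩ := Submodule.mem_sup.1 hv
        rw [map_add, add_comm]
        refine Submodule.add_mem_sup hb ?_
        change parity (parity a) ∈ W
        rwa [parity_parity]
      · obtain ⟨a, ha, b, hb, rfl⟩ := Submodule.mem_sup.1 hv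
        rw [map_add]
        exact Submodule.add_mem_sup (hW x a ha) (hW' x b hb)
    rcases hM.2 _ hst with h | h
    · exact absurd (le_bot_iff.1 (h ▸ le_sup_left)) hcon.1
    · exact h
  have hc : IsCompl W W' := ⟨disjoint_iff.2 hinf, codisjoint_iff.2 hsup⟩
  let p : Module.End ℂ M := W.projection W' hc
  have hpW : ∀ v ∈ W, p v = v := fun v hv => Submodule.projection_apply_left hc ⟨v, hv⟩
  have hpW' : ∀ v ∈ W', p v = 0 := fun v hv =>
    (Submodule.projection_apply_eq_zero_iff hc).2 hv
  have hind : ∀ {q : M → Prop}, (∀ v ∈ W, q v) → (∀ v ∈ W', q v) →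
      (∀ v w, q v → q w → q (v + w)) → ∀ v, q v := by
    intro q h1 h2 h3 v
    obtain ⟨a, ha, b, hb, rfl⟩ := Submodule.mem_sup.1 (hsup ▸ Submodule.mem_top : v ∈ W ⊔ W')
    exact h3 _ _ (h1 a ha) (h2 b hb)
  -- The involution equal to +1 on W and -1 on PW commutes with g and anticommutes with P. Then uP
  -- is odd with square -1, contrary to the hypothesis.
  let u : Module.End ℂ M := (2 : ℂ) • p - 1
  have huW : ∀ v ∈ W, u v = v := fun v hv => by
    simp only [u, LinearMap.sub_apply, LinearMap.smul_apply, hpW v hv, Module.End.one_apply]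
    module
  have huW' : ∀ v ∈ W', u v = -v := fun v hv => by
    simp only [u, LinearMap.sub_apply, LinearMap.smul_apply, hpW' v hv, Module.End.one_apply]
    module
  have hPW : ∀ v ∈ W, parity v ∈ W' := fun v hv => by
    change parity (parity v) ∈ W; rwa [parity_parity]
  have hu2 : ∀ v, u (u v) = v := hind (fun v hv => by rw [huW v hv, huW v hv])
    (fun v hv => by rw [huW' v hv, map_neg, huW' v hv, neg_neg])
    (fun v w hv hw => by rw [map_add, map_add, hv, hw])
  have huP : ∀ v, u (parity v) = -parity (u v) := hind
    (fun v hv => by rw [huW v hv, huW' _ (hPW v hv)])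
    (fun v hv => by rw [huW' v hv, huW _ hv, map_neg, neg_neg])
    (fun v w hv hw => by rw [map_add, map_add, hv, hw, map_add, map_add, neg_add])
  have hux : ∀ x v, u (M.act x v) = M.act x (u v) := fun x => hind
    (fun v hv => by rw [huW v hv, huW _ (hW x v hv)])
    (fun v hv => by rw [huW' v hv, huW' _ (hW' x v hv), map_neg])
    (fun v w hv hw => by rw [map_add, map_add, hv, hw, map_add, map_add])
  refine hφ ⟨u * parity, fun v => ?_, fun x v => ?_, fun v => ?_⟩
  · change parity (u (parity v)) = -u (parity (parity v))
    rw [huP (parity v), neg_neg]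
  · change u (parity (M.act x v)) = M.act (parity x) (u (parity v))
    rw [M.parity_act, hux]
  · change u (parity (u (parity v))) = -v
    rw [huP v, map_neg, parity_parity, map_neg, hu2]

theorem IsIrreducible.actAlg_eq_top (hM : M.IsIrreducible) [FiniteDimensional ℂ M]
    (hφ : ¬ ∃ φ, M.IsOddSchur φ) : M.actAlg = ⊤ :=
  subalgebra_eq_top_of_irreducible _ fun W hW =>
    hM.eq_bot_or_top hφ W fun x v hv => hW _ (M.act_mem_actAlg x) v hv

theorem IsIrreducible.adjoin_parity_eq_top (hM : M.IsIrreducible) [FiniteDimensional ℂ M]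
    (R : Subalgebra ℂ (Module.End ℂ M)) (hR : M.actAlg ≤ R)
    (hP : (parity : Module.End ℂ M) ∈ R) : R = ⊤ := by
  refine Algebra.eq_top_iff.2 fun T => ?_
  obtain ⟨r, hr, s, hs, rfl⟩ := hM.exists_actAlg T
  exact add_mem (hR hr) (mul_mem (hR hs) hP)

end SuperModule

/-! ### Submodules of tensor products -/

/-- The algebra of operators preserving a subspace. -/
def stabilizerAlg {V : Type*} [AddCommGroup V] [Module ℂ V] (U : Submodule ℂ V) :
    Subalgebra ℂ (Module.End ℂ V) where
  carrier := {T | ∀ v ∈ U, T v ∈ U}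
  mul_mem' := fun hS hT v hv => hS _ (hT v hv)
  add_mem' := fun hS hT v hv => U.add_mem (hS v hv) (hT v hv)
  algebraMap_mem' := fun c _ hv => U.smul_mem c hv

theorem exists_end_apply_eq {V : Type*} [AddCommGroup V] [Module ℂ V] {v : V} (hv : v ≠ 0)
    (w : V) : ∃ T : Module.End ℂ V, T v = w := by
  have : ∃ f : Module.Dual ℂ V, f v ≠ 0 := by
    by_contra! h
    exact hv ((Module.forall_dual_apply_eq_zero_iff ℂ v).1 h)
  obtain ⟨f, hf⟩ := this
  exact ⟨(f v)⁻¹ • f.smulRight w, by simp [smul_smul, inv_mul_cancel₀ hf]⟩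

/-- Every operator on `V ⊗ W` is a sum of operators `T ⊗ S`. -/
theorem end_tensor_induction {V W : Type*} [AddCommGroup V] [Module ℂ V] [AddCommGroup W]
    [Module ℂ W] [FiniteDimensional ℂ V] [FiniteDimensional ℂ W]
    {p : Module.End ℂ (V ⊗[ℂ] W) → Prop} (h0 : p 0)
    (ht : ∀ (T : Module.End ℂ V) (S : Module.End ℂ W), p (TensorProduct.map T S))
    (ha : ∀ S T, p S → p T → p (S + T)) (T : Module.End ℂ (V ⊗[ℂ] W)) : p T := by
  obtain ⟨t, rfl⟩ := (homTensorHomEquiv ℂ V W V W).surjective T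
  induction t using TensorProduct.induction_on with
  | zero => simpa using h0
  | tmul T S => simpa [homTensorHomEquiv_apply] using ht T S
  | add s t hs ht => rw [map_add]; exact ha _ _ hs ht

theorem tensor_ext_homog {V W X : Type*} [AddCommGroup V] [Module ℂ V]
    [AddCommGroup W] [Module ℂ W] [SuperSpace W] [AddCommGroup X] [Module ℂ X] {f h : V ⊗[ℂ] W →ₗ[ℂ] X}
    (h0 : ∀ v, ∀ w ∈ homog W 0, f (v ⊗ₜ w) = h (v ⊗ₜ w))
    (h1 : ∀ v, ∀ w ∈ homog W 1, f (v ⊗ₜ w) = h (v ⊗ₜ w)) : f = h := by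
  refine TensorProduct.ext' fun v w => ?_
  rw [← evenProj_add_oddProj w, TensorProduct.tmul_add, map_add, map_add,
    h0 _ _ (evenProj_mem w), h1 _ _ (oddProj_mem w)]

/-! ### Operators on a tensor product with the Koszul sign. -/

section SignedTensor

variable (V W : Type*) [AddCommGroup V] [Module ℂ V] [SuperSpace V] [AddCommGroup W]
  [Module ℂ W] [SuperSpace W]

/-- The involution `v ⊗ w ↦ (-1)^{|v||w|} v ⊗ w`. -/
def signSwap : Module.End ℂ (V ⊗[ℂ] W) :=
  TensorProduct.map 1 evenProj + TensorProduct.map parity oddProj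

variable {V W}

theorem signSwap_tmul (v : V) (w : W) :
    signSwap V W (v ⊗ₜ w) = v ⊗ₜ evenProj w + parity v ⊗ₜ oddProj w := rfl

theorem signSwap_tmul_even (v : V) {w : W} (hw : w ∈ homog W 0) :
    signSwap V W (v ⊗ₜ w) = v ⊗ₜ w := by
  rw [signSwap_tmul, evenProj_of_even hw, oddProj_of_even hw]; simp

theorem signSwap_tmul_odd (v : V) {w : W} (hw : w ∈ homog W 1) :
    signSwap V W (v ⊗ₜ w) = parity v ⊗ₜ w := by
  rw [signSwap_tmul, evenProj_of_odd hw, oddProj_of_odd hw]; simp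

theorem signSwap_sq : signSwap V W * signSwap V W = 1 := by
  refine tensor_ext_homog (fun v w hw => ?_) fun v w hw => ?_
  · change signSwap V W (signSwap V W _) = _
    rw [signSwap_tmul_even v hw, signSwap_tmul_even v hw]; rfl
  · change signSwap V W (signSwap V W _) = _
    rw [signSwap_tmul_odd v hw, signSwap_tmul_odd _ hw, parity_parity]; rfl

variable (V W) in
/-- The operator `1 ⊗ S` on `V ⊗ W` with the sign rule `(1 ⊗ S)(v ⊗ w) = (-1)^{|S||v|} v ⊗ S w`. -/
def signedRight : Module.End ℂ W →ₐ[ℂ] Module.End ℂ (V ⊗[ℂ] W) :=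
  AlgHom.ofLinearMap
    (LinearMap.mulLeftRight ℂ (signSwap V W, signSwap V W) ∘ₗ
      (TensorProduct.mapBilinear (RingHom.id ℂ) V W V W 1))
    (by
      change signSwap V W * TensorProduct.map 1 1 * signSwap V W = 1
      rw [TensorProduct.map_one, mul_one, signSwap_sq])
    (by
      intro S T
      change signSwap V W * TensorProduct.map 1 (S * T) * signSwap V W =
        (signSwap V W * TensorProduct.map 1 S * signSwap V W) *
          (signSwap V W * TensorProduct.map 1 T * signSwap V W)
      rw [show (signSwap V W * TensorProduct.map 1 S * signSwap V W) *
          (signSwap V W * TensorProduct.map 1 T * signSwap V W)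
        = signSwap V W * TensorProduct.map 1 S * (signSwap V W * signSwap V W) *
          TensorProduct.map 1 T * signSwap V W by noncomm_ring, signSwap_sq, mul_one,
        mul_assoc _ (TensorProduct.map 1 S), ← TensorProduct.map_mul, one_mul])

theorem signedRight_apply (S : Module.End ℂ W) :
    signedRight V W S = signSwap V W * TensorProduct.map 1 S * signSwap V W := rfl

theorem signedRight_even {S : Module.End ℂ W} (hS : ∀ w, parity (S w) = S (parity w)) :
    signedRight V W S = TensorProduct.map 1 S := by
  refine tensor_ext_homog (fun v w hw => ?_) fun v w hw => ?_
  · change signSwap V W (TensorProduct.map 1 S (signSwap V W _)) = v ⊗ₜ S w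
    rw [signSwap_tmul_even v hw]
    exact signSwap_tmul_even _ (by rw [mem_homog] at *; rw [hS, hw, map_smul])
  · change signSwap V W (TensorProduct.map 1 S (signSwap V W _)) = v ⊗ₜ S w
    rw [signSwap_tmul_odd v hw]
    have : signSwap V W (parity v ⊗ₜ S w) = parity (parity v) ⊗ₜ S w :=
      signSwap_tmul_odd _ (by rw [mem_homog] at *; rw [hS, hw, map_smul])
    rw [parity_parity] at this
    exact this

theorem signedRight_odd {S : Module.End ℂ W} (hS : ∀ w, parity (S w) = -S (parity w)) :
    signedRight V W S = TensorProduct.map parity S := by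
  refine tensor_ext_homog (fun v w hw => ?_) fun v w hw => ?_
  · change signSwap V W (TensorProduct.map 1 S (signSwap V W _)) = parity v ⊗ₜ S w
    rw [signSwap_tmul_even v hw]
    exact signSwap_tmul_odd _ (by rw [mem_homog] at *; rw [hS, hw]; simp)
  · change signSwap V W (TensorProduct.map 1 S (signSwap V W _)) = parity v ⊗ₜ S w
    rw [signSwap_tmul_odd v hw]
    exact signSwap_tmul_even _ (by rw [mem_homog] at *; rw [hS, hw]; simp)

theorem signedRight_parity : signedRight V W parity = TensorProduct.map 1 parity :=
  signedRight_even fun _ => rfl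

/-- A subalgebra of `End (V ⊗ W)` containing both parities separately contains `1 ⊗ S` as soon as
it contains its signed version. -/
theorem map_one_mem_of_signedRight_mem {R : Subalgebra ℂ (Module.End ℂ (V ⊗[ℂ] W))}
    (h1 : TensorProduct.map (parity : Module.End ℂ V) (1 : Module.End ℂ W) ∈ R)
    (h2 : TensorProduct.map (1 : Module.End ℂ V) (parity : Module.End ℂ W) ∈ R)
    {S : Module.End ℂ W} (hS : signedRight V W S ∈ R) : TensorProduct.map 1 S ∈ R := by
  -- The sign involution is a polynomial in P ⊗ 1 and 1 ⊗ P, so conjugation by it stays inside `R`.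
  have hκ : signSwap V W ∈ R := by
    have : signSwap V W = (1 / 2 : ℂ) • (1 + TensorProduct.map 1 parity
        + TensorProduct.map parity 1 * (1 - TensorProduct.map 1 parity)) := by
      refine TensorProduct.ext' fun v w => ?_
      rw [signSwap_tmul, evenProj_apply, oddProj_apply]
      change _ = (1 / 2 : ℂ) • (v ⊗ₜ w + v ⊗ₜ parity w
        + TensorProduct.map parity 1 (v ⊗ₜ w - v ⊗ₜ[ℂ] parity w))
      rw [map_sub]
      change _ = (1 / 2 : ℂ) • (v ⊗ₜ w + v ⊗ₜ parity w
        + (parity v ⊗ₜ w - parity v ⊗ₜ[ℂ] parity w))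
      simp only [TensorProduct.tmul_smul, TensorProduct.tmul_add, TensorProduct.tmul_sub]
      module
    rw [this]
    exact R.smul_mem (add_mem (add_mem (one_mem _) h2) (mul_mem h1 (sub_mem (one_mem _) h2))) _
  have : TensorProduct.map 1 S = signSwap V W * signedRight V W S * signSwap V W := by
    rw [signedRight_apply, show signSwap V W * (signSwap V W * TensorProduct.map 1 S
      * signSwap V W) * signSwap V W = (signSwap V W * signSwap V W) * TensorProduct.map 1 S
      * (signSwap V W * signSwap V W) by noncomm_ring, signSwap_sq, one_mul, mul_one]
  rw [this]
  exact mul_mem (mul_mem hκ hS) hκ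

variable (V W) in
/-- The algebra homomorphism `T ↦ T ⊗ 1`. -/
def tensorLeft : Module.End ℂ V →ₐ[ℂ] Module.End ℂ (V ⊗[ℂ] W) :=
  AlgHom.ofLinearMap ((TensorProduct.mapBilinear (RingHom.id ℂ) V W V W).flip 1)
    TensorProduct.map_one (fun S T => by
      change TensorProduct.map (S * T) 1 = TensorProduct.map S 1 * TensorProduct.map T 1
      rw [← TensorProduct.map_mul, one_mul])

variable (V W) in
/-- The algebra homomorphism `S ↦ 1 ⊗ S`. -/
def tensorRight : Module.End ℂ W →ₐ[ℂ] Module.End ℂ (V ⊗[ℂ] W) :=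
  AlgHom.ofLinearMap (TensorProduct.mapBilinear (RingHom.id ℂ) V W V W 1)
    TensorProduct.map_one (fun S T => by
      change TensorProduct.map 1 (S * T) = TensorProduct.map 1 S * TensorProduct.map 1 T
      rw [← TensorProduct.map_mul, one_mul])

end SignedTensor

namespace SuperModule

variable {g : Type u} [AddCommGroup g] [Module ℂ g] [LieSuperalgebra g]

/-- On the right factor even elements act by 1 ⊗ x and odd ones by P ⊗ x, which are the two cases of
`signedRight`. Both summands are then images under algebra homomorphisms, so statements about
generators extend to `actAlg`. -/
theorem tensorAct_eq (M N : SuperModule.{u, v} g) (x : g) :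
    tensorAct M N x = tensorLeft M N (M.act x) + signedRight M N (N.act x) := by
  have : N.act x = N.act (evenProj x) + N.act (oddProj x) := by
    rw [← map_add, evenProj_add_oddProj]
  rw [this, map_add, signedRight_even (N.parity_act_even (evenProj_mem x)),
    signedRight_odd (N.parity_act_odd (oddProj_mem x)), ← add_assoc]
  rfl

/-- `g` acts independently on `M` and `N`: as if it were a direct sum `g¹ ⊕ g²` with `g¹` acting on
`M` and `g²` acting on `N`. -/
def Independent (M N : SuperModule.{u, v} g) : Prop :=
  (∀ x, ∃ y, M.act y = M.act x ∧ N.act y = 0) ∧ ∀ x, ∃ y, M.act y = 0 ∧ N.act y = N.act x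

variable {M N : SuperModule.{u, v} g}

/-! ### Operators preserving a graded submodule of a tensor product. -/

section Stabilizer

variable {U : Submodule ℂ (M ⊗[ℂ] N)}

/-- Independence supplies an element acting like x on M and by zero on N, whose tensor action is
exactly x ⊗ 1. The preimage of the stabilizer is a subalgebra containing these generators. -/
theorem tensorLeft_mem_stabilizer (hMN : Independent M N) (hU : IsSub (M.tensor N) U)
    {T : Module.End ℂ M} (hT : T ∈ M.actAlg) : tensorLeft M N T ∈ stabilizerAlg U := by
  have : M.actAlg ≤ (stabilizerAlg U).comap (tensorLeft M N) := by
    refine Algebra.adjoin_le ?_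
    rintro _ ⟨x, rfl⟩
    obtain ⟨y, hy1, hy2⟩ := hMN.1 x
    intro v hv
    have h := hU.2 y v hv
    change tensorAct M N y v ∈ U at h
    rwa [tensorAct_eq, hy1, hy2, map_zero, add_zero] at h
  exact this hT

theorem signedRight_mem_stabilizer (hMN : Independent M N) (hU : IsSub (M.tensor N) U)
    {S : Module.End ℂ N} (hS : S ∈ N.actAlg) : signedRight M N S ∈ stabilizerAlg U := by
  have : N.actAlg ≤ (stabilizerAlg U).comap (signedRight M N) := by
    refine Algebra.adjoin_le ?_
    rintro _ ⟨x, rfl⟩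
    obtain ⟨y, hy1, hy2⟩ := hMN.2 x
    intro v hv
    have h := hU.2 y v hv
    change tensorAct M N y v ∈ U at h
    rwa [tensorAct_eq, hy1, hy2, map_zero, zero_add] at h
  exact this hS

theorem parity_mem_stabilizer (hU : IsSub (M.tensor N) U) :
    TensorProduct.map (parity : Module.End ℂ M) (parity : Module.End ℂ N) ∈ stabilizerAlg U :=
  hU.1

/-- The operators T ⊗ S span all endomorphisms of the finite-dimensional tensor product, and these
move any nonzero vector to any other. -/
theorem eq_bot_or_top_of_stabilizer [FiniteDimensional ℂ M] [FiniteDimensional ℂ N]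
    (h : ∀ T S, (TensorProduct.map T S : Module.End ℂ (M ⊗[ℂ] N)) ∈ stabilizerAlg U) :
    U = ⊥ ∨ U = ⊤ := by
  rw [or_iff_not_imp_left]
  intro hU
  obtain ⟨v, hv, hv0⟩ := U.ne_bot_iff.1 hU
  refine (Submodule.eq_top_iff').2 fun w => ?_
  obtain ⟨T, rfl⟩ := exists_end_apply_eq hv0 w
  have hT : T ∈ stabilizerAlg U := end_tensor_induction (p := fun T => T ∈ stabilizerAlg U)
    (zero_mem _) h (fun _ _ => add_mem) T
  exact hT v hv

/-- A graded submodule is only known to be stable under P ⊗ P. Once P ⊗ 1 is available so is 1 ⊗ P,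
and Burnside's theorem with parity adjoined yields all operators on each factor. -/
theorem eq_bot_or_top_of_parity_mem (hM : M.IsIrreducible) (hN : N.IsIrreducible)
    [FiniteDimensional ℂ M] [FiniteDimensional ℂ N] (hMN : Independent M N)
    (hU : IsSub (M.tensor N) U)
    (h1 : TensorProduct.map (parity : Module.End ℂ M) (1 : Module.End ℂ N) ∈ stabilizerAlg U) :
    U = ⊥ ∨ U = ⊤ := by
  have h2 : TensorProduct.map (1 : Module.End ℂ M) (parity : Module.End ℂ N)
      ∈ stabilizerAlg U := by
    have := mul_mem h1 (parity_mem_stabilizer hU)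
    rwa [← TensorProduct.map_mul, M.parity_sq, one_mul] at this
  have hl : (stabilizerAlg U).comap (tensorLeft M N) = ⊤ :=
    hM.adjoin_parity_eq_top _ (fun T hT => tensorLeft_mem_stabilizer hMN hU hT) h1
  have hr : (stabilizerAlg U).comap (tensorRight M N) = ⊤ :=
    hN.adjoin_parity_eq_top _ (fun S hS => map_one_mem_of_signedRight_mem h1 h2
      (signedRight_mem_stabilizer hMN hU hS)) h2
  refine eq_bot_or_top_of_stabilizer fun T S => ?_
  have h3 : T ∈ (stabilizerAlg U).comap (tensorLeft M N) := hl ▸ Algebra.mem_top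
  have h4 : S ∈ (stabilizerAlg U).comap (tensorRight M N) := hr ▸ Algebra.mem_top
  have : TensorProduct.map T 1 * TensorProduct.map 1 S ∈ stabilizerAlg U := mul_mem h3 h4
  rwa [← TensorProduct.map_mul, one_mul, mul_one] at this

end Stabilizer

theorem IsIrreducible.nontrivial_tensor (hM : M.IsIrreducible) (hN : N.IsIrreducible) :
    Nontrivial (M.tensor N) := by
  have := hM.1
  have := hN.1
  exact inferInstanceAs (Nontrivial (M ⊗[ℂ] N))

/-- A factor without odd Schur endomorphism has all operators, in particular its parity, in the
algebra generated by the action. This supplies P ⊗ 1 directly, or 1 ⊗ P and then P ⊗ 1 after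
multiplying by P ⊗ P. -/
theorem IsIrreducible.tensor_of_no_oddSchur (hM : M.IsIrreducible) (hN : N.IsIrreducible)
    [FiniteDimensional ℂ M] [FiniteDimensional ℂ N] (hMN : Independent M N)
    (h : (¬ ∃ φ, M.IsOddSchur φ) ∨ ¬ ∃ φ, N.IsOddSchur φ) : (M.tensor N).IsIrreducible := by
  refine ⟨hM.nontrivial_tensor hN, fun U hU => eq_bot_or_top_of_parity_mem hM hN hMN hU ?_⟩
  rcases h with h | h
  · exact tensorLeft_mem_stabilizer hMN hU (hM.actAlg_eq_top h ▸ Algebra.mem_top)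
  · have h2 := signedRight_mem_stabilizer hMN hU (S := parity)
      (hN.actAlg_eq_top h ▸ Algebra.mem_top)
    rw [signedRight_parity] at h2
    have := mul_mem (parity_mem_stabilizer hU) h2
    rwa [← TensorProduct.map_mul, N.parity_sq, mul_one] at this

/-! ### The case of two odd Schur endomorphisms. -/

section OddSchur

variable {φ₁ : Module.End ℂ M} {φ₂ : Module.End ℂ N}

theorem hatOp_eq (φ₁ : Module.End ℂ M) (φ₂ : Module.End ℂ N) :
    hatOp M N φ₁ φ₂ = TensorProduct.map (φ₁ * parity) (Complex.I • φ₂) := by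
  rw [TensorProduct.map_smul_right]; rfl

theorem IsOddSchur.I_smul_sq (h₂ : N.IsOddSchur φ₂) :
    (Complex.I • φ₂) * (Complex.I • φ₂) = 1 := by
  ext v
  change Complex.I • φ₂ (Complex.I • φ₂ v) = v
  rw [map_smul, h₂.sq, smul_smul, Complex.I_mul_I, neg_one_smul, neg_neg]

theorem IsOddSchur.parity_mul (h₂ : N.IsOddSchur φ₂) :
    (parity : Module.End ℂ N) * φ₂ = -(φ₂ * parity) :=
  LinearMap.ext fun v => h₂.odd v

theorem hatOp_sq (h₁ : M.IsOddSchur φ₁) (h₂ : N.IsOddSchur φ₂) :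
    hatOp M N φ₁ φ₂ * hatOp M N φ₁ φ₂ = 1 := by
  rw [hatOp_eq]
  have : TensorProduct.map (φ₁ * parity) (Complex.I • φ₂)
      * TensorProduct.map (φ₁ * parity) (Complex.I • φ₂) = 1 := by
    rw [← TensorProduct.map_mul, h₁.sq_mul_parity, h₂.I_smul_sq, TensorProduct.map_one]
  exact this

/-- With u = φ₁P, f = √-1 φ₂ and θ = u ⊗ f, the operators T + θTθ are those commuting with θ. They
are assembled from operators commuting with u on the left, operators commuting with f on the right,
and P ⊗ P, each of which preserves U. -/
theorem mem_stabilizer_of_oddSchur (hM : M.IsIrreducible) (hN : N.IsIrreducible)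
    [FiniteDimensional ℂ M] [FiniteDimensional ℂ N] (hMN : Independent M N)
    (h₁ : M.IsOddSchur φ₁) (h₂ : N.IsOddSchur φ₂) {U : Submodule ℂ (M ⊗[ℂ] N)}
    (hU : IsSub (M.tensor N) U) (hUθ : ∀ v ∈ U, TensorProduct.map (φ₁ * parity) (Complex.I • φ₂) v = v)
    (T : Module.End ℂ (M ⊗[ℂ] N)) :
    T + TensorProduct.map (φ₁ * parity) (Complex.I • φ₂) * T *
      TensorProduct.map (φ₁ * parity) (Complex.I • φ₂) ∈ stabilizerAlg U := by
  have hu2 := h₁.sq_mul_parity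
  have hf2 := h₂.I_smul_sq
  have huP : (φ₁ * parity) * parity = -((parity : Module.End ℂ M) * (φ₁ * parity)) := by
    rw [← mul_assoc, h₁.parity_mul, neg_mul, neg_neg]
  have hfP : (Complex.I • φ₂) * parity = -((parity : Module.End ℂ N) * (Complex.I • φ₂)) := by
    rw [mul_smul_comm, h₂.parity_mul, smul_neg, neg_neg, smul_mul_assoc]
  have hleft : ∀ T, (φ₁ * parity) * T = T * (φ₁ * parity) →
      TensorProduct.map T 1 ∈ stabilizerAlg U := fun T hT =>
    tensorLeft_mem_stabilizer hMN hU (hM.mem_actAlg_of_commute h₁ hT)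
  have hright : ∀ S, (Complex.I • φ₂) * S = S * (Complex.I • φ₂) → parity * S = S * parity →
      TensorProduct.map 1 S ∈ stabilizerAlg U := fun S hS hP => by
    rw [← signedRight_even (fun w => LinearMap.congr_fun hP w)]
    refine signedRight_mem_stabilizer hMN hU (hN.mem_actAlg_of_commute h₂ ?_)
    rw [smul_mul_assoc, mul_smul_comm] at hS
    have hS' := smul_right_injective _ Complex.I_ne_zero hS
    rw [mul_assoc, hP, ← mul_assoc, hS', mul_assoc]
  -- The odd operator f need not come from the action on N, but θ = 1 on U, so there 1 ⊗ f agrees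
  -- with (1 ⊗ f)θ = u ⊗ 1, and u commutes with itself.
  have hf : TensorProduct.map 1 (Complex.I • φ₂) ∈ stabilizerAlg U := by
    intro v hv
    have h4 : TensorProduct.map 1 (Complex.I • φ₂)
        (TensorProduct.map (φ₁ * parity) (Complex.I • φ₂) v)
        = TensorProduct.map (φ₁ * parity) 1 v := by
      have : TensorProduct.map 1 (Complex.I • φ₂) * TensorProduct.map (φ₁ * parity) (Complex.I • φ₂)
          = TensorProduct.map (φ₁ * parity) 1 := by
        rw [← TensorProduct.map_mul, one_mul, hf2]
      exact LinearMap.congr_fun this v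
    rw [hUθ v hv] at h4
    rw [h4]
    exact hleft _ rfl v hv
  generalize φ₁ * parity = u at *
  generalize Complex.I • φ₂ = f at *
  -- So far only even S are covered. The odd part S₁ equals f(fS₁), where fS₁ is even and commutes
  -- with f.
  have hright' : ∀ S, f * S = S * f → TensorProduct.map 1 S ∈ stabilizerAlg U := fun S hS => by
    let S₀ : Module.End ℂ N := (1 / 2 : ℂ) • (S + parity * S * parity)
    let S₁ : Module.End ℂ N := (1 / 2 : ℂ) • (S - parity * S * parity)
    have hS01 : S = S₀ + f * (f * S₁) := by
      rw [← mul_assoc, hf2, one_mul]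
      simp only [S₀, S₁]; module
    have hPP : (parity : Module.End ℂ N) * parity = 1 := N.parity_sq
    have hfPSP : f * (parity * S * parity) = parity * S * parity * f := by
      have hfP' : ∀ X, f * (parity * X) = -(parity * (f * X)) := fun X => by
        rw [← mul_assoc, hfP, neg_mul, mul_assoc]
      have hS' : ∀ X, f * (S * X) = S * (f * X) := fun X => by
        rw [← mul_assoc, hS, mul_assoc]
      simp only [mul_assoc, hfP', hS', hfP, mul_neg, neg_neg]
    have hPPS : parity * (parity * S * parity) = S * parity := by
      rw [← mul_assoc, ← mul_assoc, hPP, one_mul]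
    have hPSPP : parity * S * parity * parity = parity * S := by
      rw [mul_assoc, hPP, mul_one]
    have hS₀ : f * S₀ = S₀ * f := by
      simp only [S₀, mul_smul_comm, smul_mul_assoc, mul_add, add_mul, hS, hfPSP]
    have hS₁ : f * S₁ = S₁ * f := by
      simp only [S₁, mul_smul_comm, smul_mul_assoc, mul_sub, sub_mul, hS, hfPSP]
    have hPS₀ : parity * S₀ = S₀ * parity := by
      simp only [S₀, mul_smul_comm, smul_mul_assoc, mul_add, add_mul, hPPS, hPSPP, add_comm]
    have hPS₁ : parity * S₁ = -(S₁ * parity) := by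
      simp only [S₁, mul_smul_comm, smul_mul_assoc, mul_sub, sub_mul, hPPS, hPSPP]
      rw [← smul_neg, neg_sub]
    rw [hS01, TensorProduct.map_add_right]
    refine add_mem (hright _ hS₀ hPS₀) ?_
    have h5 : TensorProduct.map 1 (f * S₁) ∈ stabilizerAlg U := by
      refine hright _ (by rw [mul_assoc, hS₁]) ?_
      rw [← mul_assoc, ← neg_eq_iff_eq_neg.2 hfP, neg_mul, mul_assoc, hPS₁, mul_neg, neg_neg,
        mul_assoc]
    have := mul_mem hf h5
    rwa [← TensorProduct.map_mul, one_mul] at this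
  refine end_tensor_induction (p := fun T => T + TensorProduct.map u f * T *
    TensorProduct.map u f ∈ stabilizerAlg U) ?_ ?_ ?_ T
  · simp
  · intro T S
    rw [← TensorProduct.map_mul, ← TensorProduct.map_mul]
    let Tp : Module.End ℂ M := T + u * T * u
    let Tm : Module.End ℂ M := T - u * T * u
    let Sp : Module.End ℂ N := S + f * S * f
    let Sm : Module.End ℂ N := S - f * S * f
    -- Here `Tp`, `Sp` commute with u, f, while `Tm`, `Sm` anticommute with them. Multiplying by P,
    -- which also anticommutes with u and f, turns the latter into commuting operators, and P ⊗ P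
    -- compensates.
    have hsum : TensorProduct.map T S + TensorProduct.map (u * T * u) (f * S * f)
        = (1 / 2 : ℂ) • (TensorProduct.map Tp 1 * TensorProduct.map 1 Sp
          + TensorProduct.map parity parity *
            (TensorProduct.map (parity * Tm) 1 * TensorProduct.map 1 (parity * Sm))) := by
      simp only [← TensorProduct.map_mul, mul_one, one_mul]
      rw [← mul_assoc, ← mul_assoc, M.parity_sq, N.parity_sq, one_mul, one_mul]
      simp only [Tp, Tm, Sp, Sm, TensorProduct.map_add_left, TensorProduct.map_add_right,
        sub_eq_add_neg, ← neg_one_smul ℂ (u * T * u), ← neg_one_smul ℂ (f * S * f),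
        TensorProduct.map_smul_left, TensorProduct.map_smul_right]
      module
    have hu3 : ∀ T, u * (u * T * u) = T * u := fun T => by
      rw [← mul_assoc, ← mul_assoc, hu2, one_mul]
    have hu4 : ∀ T, u * T * u * u = u * T := fun T => by rw [mul_assoc, hu2, mul_one]
    have hf3 : ∀ T, f * (f * T * f) = T * f := fun T => by
      rw [← mul_assoc, ← mul_assoc, hf2, one_mul]
    have hf4 : ∀ T, f * T * f * f = f * T := fun T => by rw [mul_assoc, hf2, mul_one]
    rw [hsum]
    refine (stabilizerAlg U).smul_mem (add_mem (mul_mem (hleft _ ?_) (hright' _ ?_))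
      (mul_mem (parity_mem_stabilizer hU) (mul_mem (hleft _ ?_) (hright' _ ?_)))) _
    · rw [mul_add, add_mul, hu3, hu4, add_comm]
    · rw [mul_add, add_mul, hf3, hf4, add_comm]
    · rw [← mul_assoc, huP, neg_mul, mul_assoc, mul_assoc, mul_sub, sub_mul, hu3, hu4, ← mul_neg,
        neg_sub]
    · rw [← mul_assoc, hfP, neg_mul, mul_assoc, mul_assoc, mul_sub, sub_mul, hf3, hf4, ← mul_neg,
        neg_sub]
  · intro S T hS hT
    have := add_mem hS hT
    rwa [show S + TensorProduct.map u f * S * TensorProduct.map u f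
      + (T + TensorProduct.map u f * T * TensorProduct.map u f)
      = S + T + TensorProduct.map u f * (S + T) * TensorProduct.map u f by noncomm_ring] at this

/-- The operator exchanging the two eigenspaces of `hatOp`. -/
def hatExchange (M N : SuperModule.{u, v} g) (φ₁ : Module.End ℂ M) :
    Module.End ℂ (M.tensor N) :=
  TensorProduct.map (φ₁ * parity) parity

theorem hatExchange_sq (h₁ : M.IsOddSchur φ₁) (v : M.tensor N) :
    hatExchange M N φ₁ (hatExchange M N φ₁ v) = v := by
  have : TensorProduct.map (φ₁ * parity) (parity : Module.End ℂ N)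
      * TensorProduct.map (φ₁ * parity) (parity : Module.End ℂ N) = 1 := by
    rw [← TensorProduct.map_mul, h₁.sq_mul_parity, N.parity_sq, TensorProduct.map_one]
  exact LinearMap.congr_fun this v

theorem hatOp_hatExchange (h₂ : N.IsOddSchur φ₂) (v : M.tensor N) :
    hatOp M N φ₁ φ₂ (hatExchange M N φ₁ v) = -hatExchange M N φ₁ (hatOp M N φ₁ φ₂ v) := by
  have : TensorProduct.map (φ₁ * parity) (Complex.I • φ₂)
        * TensorProduct.map (φ₁ * parity) (parity : Module.End ℂ N)
      = -(TensorProduct.map (φ₁ * parity) (parity : Module.End ℂ N)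
        * TensorProduct.map (φ₁ * parity) (Complex.I • φ₂)) := by
    rw [← TensorProduct.map_mul, ← TensorProduct.map_mul, mul_smul_comm, h₂.parity_mul,
      ← neg_one_smul ℂ (φ₂ * parity), smul_mul_assoc, TensorProduct.map_smul_right,
      TensorProduct.map_smul_right, TensorProduct.map_smul_right]
    module
  rw [hatOp_eq]
  exact LinearMap.congr_fun this v

/-- Two signs cancel for odd elements of g: one from moving φ₁P past the P on the left factor, the
other from moving P past the action on the right factor. -/
theorem hatExchange_act (h₁ : M.IsOddSchur φ₁) (x : g) (v : M.tensor N) :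
    hatExchange M N φ₁ ((M.tensor N).act x v) = (M.tensor N).act x (hatExchange M N φ₁ v) := by
  have : TensorProduct.map (φ₁ * parity) (parity : Module.End ℂ N) * tensorAct M N x
      = tensorAct M N x * TensorProduct.map (φ₁ * parity) (parity : Module.End ℂ N) := by
    refine TensorProduct.ext' fun v w => ?_
    change TensorProduct.map (φ₁ * parity) parity (tensorAct M N x (v ⊗ₜ w))
      = tensorAct M N x ((φ₁ (parity v)) ⊗ₜ parity w)
    rw [tensorAct_tmul, tensorAct_tmul, map_add, map_add]
    change φ₁ (parity (M.act x v)) ⊗ₜ parity w + φ₁ (parity v) ⊗ₜ parity (N.act (evenProj x) w)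
      + φ₁ (parity (parity v)) ⊗ₜ parity (N.act (oddProj x) w) = _
    rw [M.parity_act, h₁.comm, parity_parity, N.parity_act_even (evenProj_mem x),
      N.parity_act_odd (oddProj_mem x), h₁.odd, TensorProduct.tmul_neg, TensorProduct.neg_tmul]
  exact LinearMap.congr_fun this v

theorem mem_hatSub {v : M.tensor N} : v ∈ hatSub M N φ₁ φ₂ ↔ hatOp M N φ₁ φ₂ v = v := Iff.rfl

/-- The involutions θ = `hatOp` and `hatExchange` both commute with g and anticommute with each
other, so the second carries the (-1)-eigenspace of θ isomorphically onto the fixed space. -/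
theorem IsOddSchur.iso_directSum (h₁ : M.IsOddSchur φ₁) (h₂ : N.IsOddSchur φ₂) :
    (M.tensor N).Iso (((M.tensor N).sub _ (isSub_hatSub M N h₁ h₂)).directSum
      ((M.tensor N).sub _ (isSub_hatSub M N h₁ h₂))) := by
  have hs : ∀ v, hatOp M N φ₁ φ₂ (hatOp M N φ₁ φ₂ v) = v :=
    fun v => LinearMap.congr_fun (hatOp_sq h₁ h₂) v
  have hw := hatExchange_sq (N := N) h₁
  have hx := hatOp_hatExchange (φ₁ := φ₁) h₂
  have hax := hatExchange_act (N := N) h₁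
  -- Commutation with θ is recovered from stability of the fixed space alone. Both v + θv and the
  -- exchange of v - θv lie in it, and the two resulting identities are subtracted.
  have haθ : ∀ x v, hatOp M N φ₁ φ₂ ((M.tensor N).act x v)
      = (M.tensor N).act x (hatOp M N φ₁ φ₂ v) := by
    intro x v
    have : ∀ v, v ∈ hatSub M N φ₁ φ₂ → hatOp M N φ₁ φ₂ ((M.tensor N).act x v)
      = (M.tensor N).act x v := fun v hv => (isSub_hatSub M N h₁ h₂).2 x v hv
    have hp := this (v + hatOp M N φ₁ φ₂ v) (by rw [mem_hatSub, map_add, hs, add_comm])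
    have hm := this (hatExchange M N φ₁ (v - hatOp M N φ₁ φ₂ v))
      (by rw [mem_hatSub, hx, map_sub, hs, ← map_neg, neg_sub])
    rw [← hax, hx] at hm
    have hm' := congrArg (hatExchange M N φ₁) hm
    rw [map_neg, hw, hw] at hm'
    simp only [map_add, map_sub] at hp hm'
    have h3 : (2 : ℂ) • hatOp M N φ₁ φ₂ ((M.tensor N).act x v)
        = (2 : ℂ) • (M.tensor N).act x (hatOp M N φ₁ φ₂ v) := by
      linear_combination (norm := module) hp - hm'
    exact smul_right_injective _ (two_ne_zero (α := ℂ)) h3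
  generalize hatExchange M N φ₁ = w at *
  -- `a` projects onto the fixed space; `b` projects onto the (-1)-eigenspace and then exchanges.
  let a : Module.End ℂ (M.tensor N) := (1 / 2 : ℂ) • (1 + hatOp M N φ₁ φ₂)
  let b : Module.End ℂ (M.tensor N) := (1 / 2 : ℂ) • (w * (1 - hatOp M N φ₁ φ₂))
  have ha : ∀ v, a v = (1 / 2 : ℂ) • (v + hatOp M N φ₁ φ₂ v) := fun v => rfl
  have hb : ∀ v, b v = (1 / 2 : ℂ) • (w v - w (hatOp M N φ₁ φ₂ v)) := fun v => by
    change (1 / 2 : ℂ) • w (v - hatOp M N φ₁ φ₂ v) = _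
    rw [map_sub]
  let e : M.tensor N ≃ₗ[ℂ] (hatSub M N φ₁ φ₂ × hatSub M N φ₁ φ₂) :=
    { toFun := fun v => (⟨a v, by rw [mem_hatSub, ha, map_smul, map_add, hs, add_comm]⟩,
        ⟨b v, by rw [mem_hatSub, hb, map_smul, map_sub, hx, hx, hs]; module⟩)
      map_add' := fun v v' => Prod.ext (Subtype.ext (map_add a v v')) (Subtype.ext (map_add b v v'))
      map_smul' := fun c v => Prod.ext (Subtype.ext (map_smul a c v))
        (Subtype.ext (map_smul b c v))
      invFun := fun p => p.1.1 + w p.2.1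
      left_inv := fun v => by
        change a v + w (b v) = v
        rw [ha, hb, map_smul, map_sub, hw, hw]; module
      right_inv := fun p => by
        have h3 := mem_hatSub.1 p.1.2
        have h4 := mem_hatSub.1 p.2.2
        refine Prod.ext (Subtype.ext ?_) (Subtype.ext ?_)
        · change a (p.1.1 + w p.2.1) = p.1.1
          rw [ha, map_add, hx, h3, h4]; module
        · change b (p.1.1 + w p.2.1) = p.2.1
          rw [hb, map_add (hatOp M N φ₁ φ₂), hx, h3, h4, map_add, map_add, map_neg, hw]; module }
  refine ⟨e, fun x v => Prod.ext (Subtype.ext ?_) (Subtype.ext ?_)⟩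
  · change a ((M.tensor N).act x v) = (M.tensor N).act x (a v)
    rw [ha, ha, haθ, map_smul, map_add]
  · change b ((M.tensor N).act x v) = (M.tensor N).act x (b v)
    rw [hb, hb, haθ, hax, hax, map_smul, map_sub]

/-- Given nonzero v in a submodule and a target z, both fixed by θ, choose T with Tv = z. Then (T +
θTθ)v = 2z, and this operator preserves the submodule. Nonvanishing follows since M ⊗ N is two
copies of the fixed space. -/
theorem IsIrreducible.sub_hatSub (hM : M.IsIrreducible) (hN : N.IsIrreducible)
    [FiniteDimensional ℂ M] [FiniteDimensional ℂ N] (hMN : Independent M N)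
    (h₁ : M.IsOddSchur φ₁) (h₂ : N.IsOddSchur φ₂) :
    ((M.tensor N).sub _ (isSub_hatSub M N h₁ h₂)).IsIrreducible := by
  constructor
  · have := hM.nontrivial_tensor hN
    obtain ⟨e, -⟩ := h₁.iso_directSum h₂
    by_contra hcon
    have hss : Subsingleton (hatSub M N φ₁ φ₂) := not_nontrivial_iff_subsingleton.1 hcon
    have : Subsingleton (M.tensor N) :=
      e.toEquiv.subsingleton_congr.2 (inferInstanceAs
        (Subsingleton (hatSub M N φ₁ φ₂ × hatSub M N φ₁ φ₂)))
    exact not_subsingleton (M.tensor N) this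
  · intro W hW
    rw [or_iff_not_imp_left]
    intro hW0
    let U : Submodule ℂ (M.tensor N) := Submodule.map (hatSub M N φ₁ φ₂).subtype W
    have hU : (M.tensor N).IsSub U := by
      constructor
      · rintro _ ⟨y, hy, rfl⟩
        exact ⟨_, hW.1 y hy, rfl⟩
      · rintro x _ ⟨y, hy, rfl⟩
        exact ⟨_, hW.2 x y hy, rfl⟩
    obtain ⟨v, hv, hv0⟩ := W.ne_bot_iff.1 hW0
    refine (Submodule.eq_top_iff').2 fun z => ?_
    have hv0' : (v : hatSub M N φ₁ φ₂).1 ≠ 0 := fun h => hv0 (Subtype.ext h)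
    obtain ⟨T, hT⟩ := exists_end_apply_eq hv0' (z : hatSub M N φ₁ φ₂).1
    have h3 : (T + hatOp M N φ₁ φ₂ * T * hatOp M N φ₁ φ₂) (v : hatSub M N φ₁ φ₂).1 ∈ U := by
      rw [hatOp_eq]
      refine mem_stabilizer_of_oddSchur hM hN hMN h₁ h₂ hU (fun u hu => ?_) T
        (v : hatSub M N φ₁ φ₂).1 ⟨v, hv, rfl⟩
      have := mem_hatSub.1 (Submodule.map_subtype_le _ W hu)
      rwa [hatOp_eq] at this
    have h4 : hatOp M N φ₁ φ₂ (v : hatSub M N φ₁ φ₂).1 = (v : hatSub M N φ₁ φ₂).1 :=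
      (v : hatSub M N φ₁ φ₂).2
    have h5 : hatOp M N φ₁ φ₂ (z : hatSub M N φ₁ φ₂).1 = (z : hatSub M N φ₁ φ₂).1 :=
      (z : hatSub M N φ₁ φ₂).2
    have h6 : (z : hatSub M N φ₁ φ₂).1 ∈ U := by
      have h7 : (T + hatOp M N φ₁ φ₂ * T * hatOp M N φ₁ φ₂) (v : hatSub M N φ₁ φ₂).1
          = (2 : ℂ) • (z : hatSub M N φ₁ φ₂).1 := by
        change T _ + hatOp M N φ₁ φ₂ (T (hatOp M N φ₁ φ₂ _)) = _
        rw [h4, hT, h5, two_smul]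
      rw [h7] at h3
      exact (U.smul_mem_iff two_ne_zero).1 h3
    obtain ⟨z', hz', hzz⟩ := h6
    rwa [← show z' = z from Subtype.ext hzz]

end OddSchur

theorem Iso.refl (M : SuperModule.{u, v} g) : M.Iso M := ⟨LinearEquiv.refl ℂ M, fun _ _ => rfl⟩

/-- The irreducible product of irreducible finite-dimensional modules on which `g` acts
independently. -/
theorem IsIrreducible.irrProd (hM : M.IsIrreducible) (hN : N.IsIrreducible)
    [FiniteDimensional ℂ M] [FiniteDimensional ℂ N] (hMN : Independent M N) :
    (irrProd M N).IsIrreducible ∧ FiniteDimensional ℂ (irrProd M N) ∧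
      ((M.tensor N).Iso (irrProd M N) ∨
        (M.tensor N).Iso ((irrProd M N).directSum (irrProd M N))) := by
  by_cases h : (M.tensor N).IsIrreducible
  · have : SuperModule.irrProd M N = M.tensor N := by rw [SuperModule.irrProd, if_pos h]
    rw [this]
    exact ⟨h, inferInstanceAs (FiniteDimensional ℂ (M ⊗[ℂ] N)), Or.inl (Iso.refl _)⟩
  · have H : ∃ φ : Module.End ℂ M × Module.End ℂ N, M.IsOddSchur φ.1 ∧ N.IsOddSchur φ.2 := by
      by_contra hcon
      refine h (hM.tensor_of_no_oddSchur hN hMN ?_)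
      by_contra! h2
      obtain ⟨⟨φ₁, h₁⟩, ⟨φ₂, h₂⟩⟩ := h2
      exact hcon ⟨(φ₁, φ₂), h₁, h₂⟩
    have : SuperModule.irrProd M N = (M.tensor N).sub (hatSub M N H.choose.1 H.choose.2)
        (isSub_hatSub M N H.choose_spec.1 H.choose_spec.2) := by
      rw [SuperModule.irrProd, if_neg h, dif_pos H]
    rw [this]
    have : FiniteDimensional ℂ (M.tensor N) := inferInstanceAs (FiniteDimensional ℂ (M ⊗[ℂ] N))
    exact ⟨hM.sub_hatSub hN hMN H.choose_spec.1 H.choose_spec.2, inferInstanceAs (FiniteDimensional ℂ (hatSub M N _ _)),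
      Or.inr (H.choose_spec.1.iso_directSum H.choose_spec.2)⟩

end SuperModule

/-! ### Modules with a top weight space -/

theorem tmul_ne_zero_of_ne_zero {V W : Type*} [AddCommGroup V] [Module ℂ V] [AddCommGroup W]
    [Module ℂ W] {v : V} {w : W} (hv : v ≠ 0) (hw : w ≠ 0) : v ⊗ₜ[ℂ] w ≠ 0 := by
  have hdual : ∃ f : Module.Dual ℂ V, f v ≠ 0 := by
    by_contra! h
    exact hv ((Module.forall_dual_apply_eq_zero_iff ℂ v).1 h)
  have hdual' : ∃ f : Module.Dual ℂ W, f w ≠ 0 := by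
    by_contra! h
    exact hw ((Module.forall_dual_apply_eq_zero_iff ℂ w).1 h)
  obtain ⟨f, hf⟩ := hdual
  obtain ⟨f', hf'⟩ := hdual'
  intro h
  have := congrArg (LinearMap.mul' ℂ ℂ ∘ₗ TensorProduct.map f f') h
  simp [hf, hf'] at this

namespace SuperModule

variable {g : Type u} [AddCommGroup g] [Module ℂ g] [LieSuperalgebra g]
variable {C : Type*} [AddCommMonoid C] [Module ℂ C]

/-- The sum of the eigenspaces of `D` for the eigenvalues `c - 1, c - 2, …`. -/
def lowerPart {V : Type*} [AddCommGroup V] [Module ℂ V] (D : Module.End ℂ V) (c : ℂ) :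
    Submodule ℂ V :=
  ⨆ k : ℕ, D.eigenspace (c - (k + 1))

theorem eigenspace_le_lowerPart {V : Type*} [AddCommGroup V] [Module ℂ V] (D : Module.End ℂ V)
    (c : ℂ) (k : ℕ) : D.eigenspace (c - (k + 1)) ≤ lowerPart D c :=
  le_iSup (fun k : ℕ => D.eigenspace (c - (k + 1))) k

/-- Eigenspaces for different eigenvalues are independent, and c never equals c - (k + 1) in
characteristic zero. -/
theorem disjoint_eigenspace_lowerPart {V : Type*} [AddCommGroup V] [Module ℂ V]
    (D : Module.End ℂ V) (c : ℂ) : Disjoint (D.eigenspace c) (lowerPart D c) := by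
  refine (D.eigenspaces_iSupIndep c).mono_right (iSup_le fun k => ?_)
  refine le_iSup₂_of_le (c - (k + 1)) (fun h => ?_) le_rfl
  have : ((k + 1 : ℕ) : ℂ) = 0 := by push_cast; linear_combination -h
  exact Nat.cast_ne_zero.2 k.succ_ne_zero this

/-- On the lower part some polynomial in `D` which is nonzero at `c` vanishes. -/
theorem exists_polynomial_of_mem_lowerPart {V : Type*} [AddCommGroup V] [Module ℂ V]
    {D : Module.End ℂ V} {c : ℂ} {s : V} (hs : s ∈ lowerPart D c) :
    ∃ q : Polynomial ℂ, Polynomial.aeval D q s = 0 ∧ q.eval c ≠ 0 := by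
  induction hs using Submodule.iSup_induction' with
  | mem k x hx =>
    refine ⟨Polynomial.X - Polynomial.C (c - (k + 1)), ?_, ?_⟩
    · rw [Module.End.mem_eigenspace_iff] at hx
      simp only [map_sub, Polynomial.aeval_X, Polynomial.aeval_C, LinearMap.sub_apply,
        Module.algebraMap_end_apply, hx]
      module
    · simpa using Nat.cast_add_one_ne_zero (R := ℂ) k
  | zero => exact ⟨1, by simp, by simp⟩
  | add x y _ _ hx hy =>
    obtain ⟨p, hp, hp'⟩ := hx
    obtain ⟨q, hq, hq'⟩ := hy
    refine ⟨p * q, ?_, by rw [Polynomial.eval_mul]; exact mul_ne_zero hp' hq'⟩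
    rw [map_add]
    nth_rewrite 1 [mul_comm]
    rw [map_mul, map_mul, Module.End.mul_apply, Module.End.mul_apply, hp, hq, map_zero, map_zero,
      add_zero]

/-- A polynomial in D that kills s and is nonzero at c extracts a nonzero multiple of t from t + s,
without leaving P. -/
theorem top_component_mem {V : Type*} [AddCommGroup V] [Module ℂ V] {D : Module.End ℂ V} {c : ℂ}
    {P : Submodule ℂ V} (hP : ∀ v ∈ P, D v ∈ P) {t s : V} (ht : D t = c • t)
    (hs : s ∈ lowerPart D c) (h : t + s ∈ P) : t ∈ P := by
  obtain ⟨q, hq, hqc⟩ := exists_polynomial_of_mem_lowerPart hs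
  have hst : Polynomial.aeval D q ∈ stabilizerAlg P :=
    (Algebra.adjoin_le (by rintro _ rfl; exact hP) : Algebra.adjoin ℂ {D} ≤ stabilizerAlg P)
      (Polynomial.aeval_mem_adjoin_singleton ℂ D)
  have h1 := hst _ h
  have hqt : ∀ q : Polynomial ℂ, Polynomial.aeval D q t = q.eval c • t := fun q => by
    induction q using Polynomial.induction_on' with
    | add p q hp hq => rw [map_add, LinearMap.add_apply, hp, hq, Polynomial.eval_add, add_smul]
    | monomial n a =>
      have : ∀ n : ℕ, (D ^ n) t = c ^ n • t := fun n => by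
        induction n with
        | zero => simp
        | succ n ih => rw [pow_succ', Module.End.mul_apply, ih, map_smul, ht, smul_smul, pow_succ]
      rw [Polynomial.aeval_monomial, Polynomial.eval_monomial, Module.End.mul_apply, this,
        Module.algebraMap_end_apply, smul_smul]
  rw [map_add, hq, add_zero, hqt] at h1
  exact (P.smul_mem_iff hqc).1 h1

/-- `X` is spanned by a nonzero space on which `j z` acts by `ψ z` for all `z`, together with
eigenvectors of `j d` for the eigenvalues `ψ d - 1, ψ d - 2, …`. -/
def IsTop (X : SuperModule.{u, v} g) (j : C →ₗ[ℂ] g) (d : C) (ψ : Module.Dual ℂ C)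
    (T : Submodule ℂ X) : Prop :=
  T ≠ ⊥ ∧ (∀ z, ∀ v ∈ T, X.act (j z) v = ψ z • v) ∧ T ⊔ lowerPart (X.act (j d)) (ψ d) = ⊤

/-- `X` has a top weight space of weight `ψ`. -/
def HasTop (X : SuperModule.{u, v} g) (j : C →ₗ[ℂ] g) (d : C) (ψ : Module.Dual ℂ C) : Prop :=
  ∃ T, X.IsTop j d ψ T

variable {X Y M N : SuperModule.{u, v} g} {j : C →ₗ[ℂ] g} {d : C} {ψ ψ₁ ψ₂ : Module.Dual ℂ C}

/-- The top space is therefore determined by the module, and any operator commuting with d preserves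
it. -/
theorem IsTop.eq_eigenspace {T : Submodule ℂ X} (h : X.IsTop j d ψ T) :
    T = (X.act (j d)).eigenspace (ψ d) := by
  refine le_antisymm (fun v hv => Module.End.mem_eigenspace_iff.2 (h.2.1 d v hv)) fun v hv => ?_
  obtain ⟨t, ht, s, hs, rfl⟩ := Submodule.mem_sup.1 (h.2.2 ▸ Submodule.mem_top :
    v ∈ T ⊔ lowerPart (X.act (j d)) (ψ d))
  have hs' : s ∈ (X.act (j d)).eigenspace (ψ d) := by
    have := Submodule.sub_mem _ hv (Module.End.mem_eigenspace_iff.2 (h.2.1 d t ht))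
    rwa [add_sub_cancel_left] at this
  rw [(Submodule.disjoint_def.1 (disjoint_eigenspace_lowerPart _ _)) s hs' hs, add_zero]
  exact ht

/-- The eigenvectors for ψ(d), ψ(d) - 1, … already span, so independence of eigenspaces excludes
further eigenvalues. This is what makes n⁺ kill the top space. -/
theorem IsTop.eigenspace_eq_bot {T : Submodule ℂ X} (h : X.IsTop j d ψ T) (k : ℕ) :
    (X.act (j d)).eigenspace (ψ d + (k + 1)) = ⊥ := by
  have hk : ∀ m : ℕ, ψ d - m ≠ ψ d + (k + 1) := fun m hm => by
    have : ((m + k + 1 : ℕ) : ℂ) = 0 := by push_cast; linear_combination -hm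
    exact Nat.cast_ne_zero.2 (Nat.succ_ne_zero _) this
  rw [← disjoint_self]
  refine ((X.act (j d)).eigenspaces_iSupIndep _).mono_right (le_trans le_top ?_)
  rw [← h.2.2, h.eq_eigenspace]
  refine sup_le ?_ (iSup_le fun m => ?_)
  · exact le_iSup₂_of_le (ψ d) (by simpa using hk 0) le_rfl
  · exact le_iSup₂_of_le (ψ d - (m + 1)) (by exact_mod_cast hk (m + 1)) le_rfl

theorem map_lowerPart_le {V W : Type*} [AddCommGroup V] [Module ℂ V] [AddCommGroup W]
    [Module ℂ W] {D : Module.End ℂ V} {D' : Module.End ℂ W} {f : V →ₗ[ℂ] W}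
    (hf : ∀ v, f (D v) = D' (f v)) (c : ℂ) :
    (lowerPart D c).map f ≤ lowerPart D' c := by
  rw [lowerPart, Submodule.map_iSup]
  refine iSup_mono fun k => ?_
  rintro _ ⟨v, hv, rfl⟩
  rw [SetLike.mem_coe, Module.End.mem_eigenspace_iff] at hv
  rw [Module.End.mem_eigenspace_iff, ← hf, hv, map_smul]

theorem IsTop.map {T : Submodule ℂ X} (h : X.IsTop j d ψ T) {f : X →ₗ[ℂ] Y}
    (hf : ∀ x v, f (X.act x v) = Y.act x (f v)) (hs : Function.Surjective f)
    (h0 : T.map f ≠ ⊥) : Y.IsTop j d ψ (T.map f) := by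
  refine ⟨h0, ?_, ?_⟩
  · rintro z _ ⟨v, hv, rfl⟩
    rw [← hf, h.2.1 z v hv, map_smul]
  · rw [eq_top_iff, ← LinearMap.range_eq_top.2 hs, LinearMap.range_eq_map, ← h.2.2,
      Submodule.map_sup]
    exact sup_le_sup_left (map_lowerPart_le (hf _) _) _

/-- `X ≅ Y` or `X ≅ Y ⊕ Y`. -/
def IsoOneOrTwo (X Y : SuperModule.{u, v} g) : Prop := X.Iso Y ∨ X.Iso (Y.directSum Y)

/-- Treats one copy and two copies uniformly: two surjective homomorphisms with no common kernel,
equal to each other in the case of one copy. -/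
theorem IsoOneOrTwo.exists_maps (h : IsoOneOrTwo X Y) : ∃ f₁ f₂ : X →ₗ[ℂ] Y,
    (Function.Surjective f₁ ∧ ∀ x v, f₁ (X.act x v) = Y.act x (f₁ v)) ∧
    (Function.Surjective f₂ ∧ ∀ x v, f₂ (X.act x v) = Y.act x (f₂ v)) ∧
    ∀ v, f₁ v = 0 → f₂ v = 0 → v = 0 := by
  rcases h with ⟨e, he⟩ | ⟨e, he⟩
  · exact ⟨e.toLinearMap, e.toLinearMap, ⟨e.surjective, he⟩, ⟨e.surjective, he⟩,
      fun v hv _ => e.map_eq_zero_iff.1 hv⟩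
  · refine ⟨LinearMap.fst ℂ Y Y ∘ₗ e.toLinearMap, LinearMap.snd ℂ Y Y ∘ₗ e.toLinearMap,
      ⟨fun y => ?_, fun x v => congrArg Prod.fst (he x v)⟩,
      ⟨fun y => ?_, fun x v => congrArg Prod.snd (he x v)⟩,
      fun v h1 h2 => e.map_eq_zero_iff.1 (Prod.ext h1 h2)⟩
    · obtain ⟨x, hx⟩ := e.surjective ((y, 0) : Y × Y)
      exact ⟨x, congrArg Prod.fst hx⟩
    · obtain ⟨x, hx⟩ := e.surjective ((0, y) : Y × Y)
      exact ⟨x, congrArg Prod.snd hx⟩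

/-- A nonzero top vector survives under at least one of the two projections, and a surjective
homomorphism carries the whole decomposition along. -/
theorem IsoOneOrTwo.hasTop (h : IsoOneOrTwo X Y) (hX : X.HasTop j d ψ) : Y.HasTop j d ψ := by
  obtain ⟨f₁, f₂, h₁, h₂, h0⟩ := h.exists_maps
  obtain ⟨T, hT⟩ := hX
  obtain ⟨v, hv, hv0⟩ := T.ne_bot_iff.1 hT.1
  by_cases hf : f₁ v = 0
  · exact ⟨_, hT.map h₂.2 h₂.1
      ((Submodule.ne_bot_iff _).2 ⟨f₂ v, ⟨v, hv, rfl⟩, fun hf' => hv0 (h0 v hf hf')⟩)⟩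
  · exact ⟨_, hT.map h₁.2 h₁.1 ((Submodule.ne_bot_iff _).2 ⟨f₁ v, ⟨v, hv, rfl⟩, hf⟩)⟩

theorem tensorAct_eigen {x : g} (hx : x ∈ homog g 0) {a b : ℂ} {v : M} {w : N}
    (hv : M.act x v = a • v) (hw : N.act x w = b • w) :
    tensorAct M N x (v ⊗ₜ w) = (a + b) • (v ⊗ₜ[ℂ] w) := by
  rw [tensorAct_even M N hx, hv, hw, add_smul, TensorProduct.smul_tmul', TensorProduct.tmul_smul]

theorem map₂_le_eigenspace {x : g} (hx : x ∈ homog g 0) {a b : ℂ} {S : Submodule ℂ M}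
    {T : Submodule ℂ N} (hS : ∀ v ∈ S, M.act x v = a • v) (hT : ∀ w ∈ T, N.act x w = b • w) :
    Submodule.map₂ (TensorProduct.mk ℂ M N) S T ≤
      Module.End.eigenspace (tensorAct M N x) (a + b) :=
  Submodule.map₂_le.2 fun v hv w hw => Module.End.mem_eigenspace_iff.2
    (tensorAct_eigen hx (hS v hv) (hT w hw))

/-- The elements `j z` are even, so they act on ⊗ as derivations without sign and eigenvalues add.
Of the four blocks of (top + lower) ⊗ (top + lower), all but the first have eigenvalue strictly
below the sum. -/
theorem HasTop.tensor (hj : ∀ z, j z ∈ homog g 0) (hM : M.HasTop j d ψ₁) (hN : N.HasTop j d ψ₂) :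
    (M.tensor N).HasTop j d (ψ₁ + ψ₂) := by
  obtain ⟨S, hS⟩ := hM
  obtain ⟨T, hT⟩ := hN
  obtain ⟨s, hs, hs0⟩ := S.ne_bot_iff.1 hS.1
  obtain ⟨t, ht, ht0⟩ := T.ne_bot_iff.1 hT.1
  refine ⟨Submodule.map₂ (TensorProduct.mk ℂ M N) S T, ?_, fun z v hv => ?_, ?_⟩
  · exact (Submodule.ne_bot_iff _).2 ⟨_, Submodule.apply_mem_map₂ _ hs ht,
      tmul_ne_zero_of_ne_zero hs0 ht0⟩
  · exact Module.End.mem_eigenspace_iff.1 (map₂_le_eigenspace (hj z) (hS.2.1 z) (hT.2.1 z) hv)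
  · have hE : ∀ a b : ℂ, Submodule.map₂ (TensorProduct.mk ℂ M N) ((M.act (j d)).eigenspace a)
        ((N.act (j d)).eigenspace b) ≤ ((M.tensor N).act (j d)).eigenspace (a + b) := fun a b =>
      map₂_le_eigenspace (hj d) (fun v hv => Module.End.mem_eigenspace_iff.1 hv)
        (fun v hv => Module.End.mem_eigenspace_iff.1 hv)
    have hlow : ∀ (a b : ℂ) (k : ℕ), a + b = ψ₁ d + ψ₂ d - (k + 1) →
        Submodule.map₂ (TensorProduct.mk ℂ M N) ((M.act (j d)).eigenspace a)
        ((N.act (j d)).eigenspace b) ≤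
          lowerPart ((M.tensor N).act (j d)) ((ψ₁ + ψ₂) d) := by
      intro a b k hab
      refine (hE a b).trans ?_
      rw [hab]
      exact eigenspace_le_lowerPart _ _ k
    rw [eq_top_iff]
    refine (TensorProduct.map₂_mk_top_top_eq_top (R := ℂ) (M := M) (N := N)).ge.trans ?_
    rw [← hS.2.2, ← hT.2.2, Submodule.map₂_sup_left, Submodule.map₂_sup_right,
      Submodule.map₂_sup_right]
    have hS' := hS.eq_eigenspace
    have hT' := hT.eq_eigenspace
    refine sup_le (sup_le le_sup_left (le_sup_of_le_right ?_)) (sup_le (le_sup_of_le_right ?_)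
      (le_sup_of_le_right ?_))
    · rw [lowerPart, Submodule.map₂_iSup_right]
      refine iSup_le fun k => ?_
      rw [hS']
      exact hlow _ _ k (by ring)
    · rw [lowerPart, Submodule.map₂_iSup_left]
      refine iSup_le fun k => ?_
      rw [hT']
      exact hlow _ _ k (by ring)
    · rw [lowerPart, lowerPart, Submodule.map₂_iSup_left]
      refine iSup_le fun k => ?_
      rw [Submodule.map₂_iSup_right]
      -- Drops of k + 1 and l + 1 add up to (k + l + 1) + 1.
      refine iSup_le fun l => hlow _ _ (k + l + 1) ?_
      push_cast
      ring

/-! ### Iterated irreducible products -/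

theorem irrProd_act_eq_zero (h : IsoOneOrTwo (M.tensor N) Y) {x : g} (hM : M.act x = 0)
    (hN : N.act x = 0) : Y.act x = 0 := by
  obtain ⟨f, -, ⟨hs, hf⟩, -⟩ := h.exists_maps
  ext y
  obtain ⟨v, rfl⟩ := hs y
  rw [← hf]
  have : (M.tensor N).act x = 0 := by
    change tensorAct M N x = 0
    rw [tensorAct_eq, hM, hN, map_zero, map_zero, add_zero]
  rw [this]
  simp

/-- The iterated irreducible product of irreducible finite-dimensional modules on which `g` acts
independently. -/
theorem iterIrrProd_properties (hj : ∀ z, j z ∈ homog g 0) (k : ℕ)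
    (V : Fin (k + 1) → SuperModule.{u, v} g) (ψ : Fin (k + 1) → Module.Dual ℂ C)
    (hV : ∀ i, (V i).IsIrreducible) (hfd : ∀ i, FiniteDimensional ℂ (V i))
    (hind : ∀ x : Fin (k + 1) → g, ∃ y, ∀ i, (V i).act y = (V i).act (x i))
    (htop : ∀ i, (V i).HasTop j d (ψ i)) :
    (iterIrrProd k V).IsIrreducible ∧ FiniteDimensional ℂ (iterIrrProd k V) ∧
      (iterIrrProd k V).HasTop j d (∑ i, ψ i) ∧
      ∀ y, (∀ i, (V i).act y = 0) → (iterIrrProd k V).act y = 0 := by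
  induction k with
  | zero =>
    refine ⟨hV 0, hfd 0, ?_, fun y hy => hy 0⟩
    rw [Fin.sum_univ_one]
    exact htop 0
  | succ k ih =>
    obtain ⟨h1, h2, h3, h4⟩ := ih (fun i => V i.castSucc) (fun i => ψ i.castSucc)
      (fun i => hV _) (fun i => hfd _)
      (fun x => by
        obtain ⟨y, hy⟩ := hind (Fin.lastCases 0 x)
        exact ⟨y, fun i => by rw [hy]; simp⟩)
      (fun i => htop _)
    have := hfd (Fin.last (k + 1))
    -- An element is prescribed on each factor separately. That it acts correctly on the product of
    -- the first factors follows from the last inductive claim, applied to a difference acting by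
    -- zero on all of them.
    have hMN : Independent (iterIrrProd k fun i => V i.castSucc) (V (Fin.last (k + 1))) := by
      constructor
      · intro x
        obtain ⟨y, hy⟩ := hind (Fin.lastCases 0 fun _ => x)
        refine ⟨y, ?_, by simpa using hy (Fin.last (k + 1))⟩
        rw [← sub_eq_zero, ← map_sub]
        refine h4 _ fun i => ?_
        rw [map_sub, hy]
        simp
      · intro x
        obtain ⟨y, hy⟩ := hind (Fin.lastCases x fun _ => 0)
        refine ⟨y, h4 _ fun i => ?_, by simpa using hy (Fin.last (k + 1))⟩
        rw [hy]
        simp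
    obtain ⟨h5, h6, h7⟩ := h1.irrProd (hV (Fin.last (k + 1))) hMN
    refine ⟨h5, h6, ?_, fun y hy => irrProd_act_eq_zero h7 (h4 y fun i => hy _) (hy _)⟩
    rw [Fin.sum_univ_castSucc]
    exact IsoOneOrTwo.hasTop h7 (h3.tensor hj (htop _))

end SuperModule

/-! ### Universal properties -/

namespace Env

variable {g : Type u} [AddCommGroup g] [Module ℂ g] [LieSuperalgebra g]
variable {B : Type*} [Semiring B] [Algebra ℂ B]

/-- The universal property of the enveloping superalgebra. -/
def lift (f : g →ₗ[ℂ] B) (hf : ∀ (i j : ZMod 2) (x y : g), x ∈ homog g i → y ∈ homog g j →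
    f x * f y = sgn (i * j) • (f y * f x) + f (br x y)) : Env g →ₐ[ℂ] B :=
  RingQuot.liftAlgHom ℂ ⟨TensorAlgebra.lift ℂ f, by
    rintro _ _ ⟨i, j, x, y, hx, hy⟩
    simp only [map_mul, map_add, map_smul, TensorAlgebra.lift_ι_apply]
    exact hf i j x y hx hy⟩

theorem lift_ι (f : g →ₗ[ℂ] B) (hf) (x : g) : lift f hf (ι g x) = f x := by
  have : lift f hf (RingQuot.mkAlgHom ℂ (EnvRel g) (TensorAlgebra.ι ℂ x))
    = TensorAlgebra.lift ℂ f (TensorAlgebra.ι ℂ x) :=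
    RingQuot.liftAlgHom_mkAlgHom_apply ℂ _ _ _
  rw [TensorAlgebra.lift_ι_apply] at this
  exact this

theorem adjoin_range_ι : Algebra.adjoin ℂ (Set.range (ι g)) = ⊤ := by
  refine Algebra.eq_top_iff.2 fun u => ?_
  obtain ⟨t, rfl⟩ := RingQuot.mkAlgHom_surjective ℂ (EnvRel g) u
  induction t using TensorAlgebra.induction with
  | algebraMap r => rw [AlgHom.commutes]; exact Subalgebra.algebraMap_mem _ r
  | ι x => exact Algebra.subset_adjoin ⟨x, rfl⟩
  | mul a b ha hb => rw [map_mul]; exact mul_mem ha hb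
  | add a b ha hb => rw [map_add]; exact add_mem ha hb

theorem induction_left {p : Env g → Prop} (h1 : p 1) (hι : ∀ x u, p u → p (ι g x * u))
    (ha : ∀ u v, p u → p v → p (u + v)) (hs : ∀ (c : ℂ) u, p u → p (c • u)) (u : Env g) :
    p u := by
  have : ∀ a : Env g, ∀ u, p u → p (a * u) := by
    intro a
    have hmem : a ∈ Algebra.adjoin ℂ (Set.range (ι g)) := adjoin_range_ι (g := g) ▸ Algebra.mem_top
    induction hmem using Algebra.adjoin_induction with
    | mem a hx => obtain ⟨x, rfl⟩ := hx; exact hι x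
    | algebraMap r => intro u hu; rw [← Algebra.smul_def]; exact hs r u hu
    | add a b _ _ hx hy => intro u hu; rw [add_mul]; exact ha _ _ (hx u hu) (hy u hu)
    | mul a b _ _ hx hy => intro u hu; rw [mul_assoc]; exact hx _ (hy u hu)
  simpa using this u 1 h1

end Env

namespace SuperModule

variable {g : Type u} [AddCommGroup g] [Module ℂ g] [LieSuperalgebra g]

/-- The action of the enveloping superalgebra on a module. -/
def envAct (X : SuperModule.{u, v} g) : Env g →ₐ[ℂ] Module.End ℂ X :=
  Env.lift X.act fun i j x y hx hy => LinearMap.ext fun v => by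
    simp only [Module.End.mul_apply, LinearMap.add_apply, LinearMap.smul_apply,
      X.act_br i j x y hx hy v]
    abel

theorem envAct_ι (X : SuperModule.{u, v} g) (x : g) : X.envAct (Env.ι g x) = X.act x :=
  Env.lift_ι _ _ _

theorem parity_envAct (X : SuperModule.{u, v} g) (u : Env g) (v : X) :
    parity (X.envAct u v) = X.envAct (Env.parityHom g u) (parity v) := by
  induction u using Env.induction_left with
  | h1 => simp
  | hι x u hu =>
    rw [map_mul, map_mul, map_mul, Env.parityHom_ι, envAct_ι, envAct_ι, Module.End.mul_apply,
      Module.End.mul_apply, X.parity_act, hu]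
  | ha u v hu hv => simp only [map_add, LinearMap.add_apply, hu, hv]
  | hs c u hu => simp only [map_smul, LinearMap.smul_apply, hu]

end SuperModule

section Induced

variable {g : Type u} [AddCommGroup g] [Module ℂ g] [LieSuperalgebra g]
variable {h : Type w} [AddCommGroup h] [Module ℂ h] [LieSuperalgebra h]
variable (f : LieSuperHom h g) (n : Submodule ℂ g) (hn : ∀ y ∈ n, parity y ∈ n)
  (M : SuperModule.{w, v} h)

/-- The canonical map `M → U(g) ⊗_{U(b)} M`. -/
def inducedTop : M →ₗ[ℂ] induced f n hn M :=
  (inducedRel f n M).mkQ ∘ₗ (TensorProduct.mk ℂ (Env g) M 1)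

theorem inducedTop_act (x : h) (m : M) : (induced f n hn M).act (f.toLin x) (inducedTop f n hn M m)
    = inducedTop f n hn M (M.act x m) := by
  refine (Submodule.Quotient.eq _).2 (Submodule.subset_span (Or.inl ⟨1, x, m, ?_⟩))
  rw [one_mul]
  change (Env.ι g (f.toLin x) * 1) ⊗ₜ[ℂ] m - _ = _
  rw [mul_one]
  rfl

theorem inducedTop_act_zero {y : g} (hy : y ∈ n) (m : M) :
    (induced f n hn M).act y (inducedTop f n hn M m) = 0 := by
  refine (Submodule.Quotient.mk_eq_zero _).2
    (Submodule.subset_span (Or.inr ⟨1, y, hy, m, ?_⟩))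
  rw [one_mul]
  change (Env.ι g y * 1) ⊗ₜ[ℂ] m = _
  rw [mul_one]

theorem inducedTop_parity (m : M) :
    inducedTop f n hn M (parity m) = parity (inducedTop f n hn M m) := by
  change (inducedRel f n M).mkQ (1 ⊗ₜ parity m)
    = (inducedRel f n M).mkQ (Env.parityHom g 1 ⊗ₜ parity m)
  rw [map_one]

/-- U(g) is generated by g, so `induction_left` reaches every u ⊗ m from 1 ⊗ m by the action. -/
theorem induced_eq_top {W : Submodule ℂ (induced f n hn M)}
    (hW : ∀ x, ∀ v ∈ W, (induced f n hn M).act x v ∈ W)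
    (hM : ∀ m, inducedTop f n hn M m ∈ W) : W = ⊤ := by
  have key : ∀ u m, (inducedRel f n M).mkQ (u ⊗ₜ[ℂ] m) ∈ W := by
    intro u m
    induction u using Env.induction_left with
    | h1 => exact hM m
    | hι x u hu => exact hW x _ hu
    | ha u v hu hv =>
      rw [TensorProduct.add_tmul]
      exact W.add_mem hu hv
    | hs c u hu =>
      rw [← TensorProduct.smul_tmul']
      exact W.smul_mem c hu
  refine (Submodule.eq_top_iff').2 fun v => ?_
  obtain ⟨t, rfl⟩ := (inducedRel f n M).mkQ_surjective v
  change Env g ⊗[ℂ] M at t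
  induction t using TensorProduct.induction_on with
  | zero => exact W.zero_mem
  | tmul u m => exact key u m
  | add s t hs ht => exact W.add_mem hs ht

/-- Frobenius reciprocity: u ⊗ m ↦ u·φ(m) kills both families of relations. -/
theorem exists_induced_lift (X : SuperModule g) (φ : M →ₗ[ℂ] X)
    (hφ : ∀ x m, φ (M.act x m) = X.act (f.toLin x) (φ m))
    (hφn : ∀ y ∈ n, ∀ m, X.act y (φ m) = 0) (hφp : ∀ m, φ (parity m) = parity (φ m)) :
    ∃ Φ : induced f n hn M →ₗ[ℂ] X,
      (∀ x v, Φ ((induced f n hn M).act x v) = X.act x (Φ v)) ∧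
      (∀ v, Φ (parity v) = parity (Φ v)) ∧ ∀ m, Φ (inducedTop f n hn M m) = φ m := by
  let Φ₀ : Env g ⊗[ℂ] M →ₗ[ℂ] X := TensorProduct.lift (LinearMap.compl₂ X.envAct.toLinearMap φ)
  have h0 : ∀ u m, Φ₀ (u ⊗ₜ m) = X.envAct u (φ m) := fun u m => rfl
  have hrel : inducedRel f n M ≤ LinearMap.ker Φ₀ := by
    refine Submodule.span_le.2 ?_
    rintro _ (⟨u, x, m, rfl⟩ | ⟨u, y, hy, m, rfl⟩)
    · have : Φ₀ ((u * Env.ι g (f.toLin x)) ⊗ₜ[ℂ] m - u ⊗ₜ[ℂ] M.act x m) = 0 := by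
        rw [map_sub, sub_eq_zero, h0, h0, map_mul, Module.End.mul_apply, X.envAct_ι, hφ]
      exact this
    · have : Φ₀ ((u * Env.ι g y) ⊗ₜ[ℂ] m) = 0 := by
        rw [h0, map_mul, Module.End.mul_apply, X.envAct_ι, hφn y hy, map_zero]
      exact this
  let Φ : induced f n hn M →ₗ[ℂ] X := (inducedRel f n M).liftQ Φ₀ hrel
  have hΦ : ∀ t : Env g ⊗[ℂ] M, Φ ((inducedRel f n M).mkQ t) = Φ₀ t := fun t => rfl
  refine ⟨Φ, fun x v => ?_, fun v => ?_, fun m => ?_⟩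
  · obtain ⟨t, rfl⟩ := (inducedRel f n M).mkQ_surjective v
    have : Φ₀ ∘ₗ (LinearMap.mulLeft ℂ (Env.ι g x)).rTensor M = X.act x ∘ₗ Φ₀ :=
      TensorProduct.ext' fun u m => by
        change X.envAct (Env.ι g x * u) (φ m) = X.act x (X.envAct u (φ m))
        rw [map_mul, Module.End.mul_apply, X.envAct_ι]
    exact LinearMap.congr_fun this t
  · obtain ⟨t, rfl⟩ := (inducedRel f n M).mkQ_surjective v
    have : Φ₀ ∘ₗ TensorProduct.map (Env.parityHom g).toLinearMap parity = parity ∘ₗ Φ₀ :=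
      TensorProduct.ext' fun u m => by
        change X.envAct (Env.parityHom g u) (φ (parity m)) = parity (X.envAct u (φ m))
        rw [hφp, X.parity_envAct]
    exact LinearMap.congr_fun this t
  · exact (h0 1 m).trans (by rw [map_one]; rfl)

end Induced

/-! ### Nonvanishing of induced modules -/

theorem sgn_mul_self (i : ZMod 2) : sgn i * sgn i = 1 := by
  rcases zmod2_cases i with rfl | rfl <;> simp

theorem linearMap_ext_homog {V X : Type*} [AddCommGroup V] [Module ℂ V] [SuperSpace V]
    [AddCommMonoid X] [Module ℂ X] {f f' : V →ₗ[ℂ] X}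
    (hf : ∀ i, ∀ v ∈ homog V i, f v = f' v) : f = f' := by
  ext v
  rw [← evenProj_add_oddProj v, map_add, map_add, hf 0 _ (evenProj_mem v),
    hf 1 _ (oddProj_mem v)]

/-- The Jacobi identity with x acted on from the right, the form needed when x is moved past a
product of two elements standing to its right. -/
theorem br_br_eq {g : Type*} [AddCommGroup g] [Module ℂ g] [LieSuperalgebra g] {i j k : ZMod 2}
    {x y z : g} (hx : x ∈ homog g i) (hy : y ∈ homog g j) (hz : z ∈ homog g k) :
    br x (br y z) = br (br x y) z - sgn (j * k) • br (br x z) y := by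
  rw [br_jacobi i j k x y z hx hy hz, br_skew _ _ y _ hy (br_mem_homog hx hz)]
  rcases zmod2_cases i with rfl | rfl <;> rcases zmod2_cases j with rfl | rfl <;>
    rcases zmod2_cases k with rfl | rfl <;> simp [sub_eq_add_neg, show (1 + 1 : ZMod 2) = 0 from rfl]

/-- A decomposition `g = a ⊕ b` into graded subalgebras, given by the projection onto `a`. -/
structure Splitting (g : Type u) [AddCommGroup g] [Module ℂ g] [LieSuperalgebra g] where
  p : g →ₗ[ℂ] g
  idem : ∀ x, p (p x) = p x
  p_parity : ∀ x, p (parity x) = parity (p x)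
  br_left : ∀ x y, p (br (p x) (p y)) = br (p x) (p y)
  br_right : ∀ x y, p (br (x - p x) (y - p y)) = 0

/-! ### For g = a ⊕ b, an action of g on U(a) ⊗ M extending a given action of b on M. -/

namespace Splitting

variable {g : Type u} [AddCommGroup g] [Module ℂ g] [LieSuperalgebra g]
variable {h : Type w} [AddCommGroup h] [Module ℂ h] [LieSuperalgebra h]
variable (S : Splitting g)

/-- The projection onto `b`. -/
def q : g →ₗ[ℂ] g := LinearMap.id - S.p

theorem q_apply (x : g) : S.q x = x - S.p x := rfl

theorem p_add_q (x : g) : S.p x + S.q x = x := add_sub_cancel _ _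

theorem p_q (x : g) : S.p (S.q x) = 0 := by rw [q_apply, map_sub, S.idem, sub_self]

theorem q_eq_self {x : g} (hx : S.p x = 0) : S.q x = x := by rw [q_apply, hx, sub_zero]

theorem q_q (x : g) : S.q (S.q x) = S.q x := S.q_eq_self (S.p_q x)

theorem p_mem_homog {i : ZMod 2} {x : g} (hx : x ∈ homog g i) : S.p x ∈ homog g i := by
  rw [mem_homog] at *
  rw [← S.p_parity, hx, map_smul]

theorem q_mem_homog {i : ZMod 2} {x : g} (hx : x ∈ homog g i) : S.q x ∈ homog g i :=
  Submodule.sub_mem _ hx (S.p_mem_homog hx)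

theorem q_parity (x : g) : S.q (parity x) = parity (S.q x) := by
  rw [q_apply, q_apply, S.p_parity, map_sub]

theorem p_br_eq_zero {x y : g} (hx : S.p x = 0) (hy : S.p y = 0) : S.p (br x y) = 0 := by
  have := S.br_right x y
  rwa [hx, hy, sub_zero, sub_zero] at this

/-- The subalgebra `a`. -/
def sub : LieSubsuperalgebra g where
  toSubmodule := LinearMap.range S.p
  parity_mem := by
    rintro _ ⟨x, rfl⟩
    exact ⟨parity x, S.p_parity x⟩
  br_mem := by
    rintro _ ⟨x, rfl⟩ _ ⟨y, rfl⟩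
    exact ⟨_, S.br_left x y⟩

/-- The projection onto `a`, as a map to the subalgebra. -/
def toSub : g →ₗ[ℂ] S.sub := S.p.rangeRestrict

theorem coe_toSub (x : g) : (S.toSub x : g) = S.p x := rfl

theorem p_coe (a : S.sub) : S.p (a : g) = a := by
  obtain ⟨_, x, rfl⟩ := a
  exact S.idem x

theorem q_coe (a : S.sub) : S.q (a : g) = 0 := by rw [q_apply, S.p_coe, sub_self]

theorem toSub_coe (a : S.sub) : S.toSub (a : g) = a := Subtype.ext (S.p_coe a)

theorem toSub_eq_zero {x : g} (hx : S.p x = 0) : S.toSub x = 0 := Subtype.ext hx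

theorem toSub_mem_homog {i : ZMod 2} {x : g} (hx : x ∈ homog g i) :
    S.toSub x ∈ homog S.sub i := Subtype.ext (S.p_mem_homog hx)

theorem toSub_parity (x : g) : S.toSub (parity x) = parity (S.toSub x) :=
  Subtype.ext (S.p_parity x)

theorem coe_mem_homog {i : ZMod 2} {a : S.sub} (ha : a ∈ homog S.sub i) : (a : g) ∈ homog g i :=
  congrArg Subtype.val ha

/-- Each inner bracket is split into its a-part and b-part. The a-part stays in a after the outer
bracket, so only the b-part still needs projecting. -/
theorem toSub_br_br {i j k : ZMod 2} {x : g} {a a' : S.sub} (hx : x ∈ homog g i)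
    (ha : a ∈ homog S.sub j) (ha' : a' ∈ homog S.sub k) :
    S.toSub (br x (br a a' : S.sub)) = br (S.toSub (br x (a : g))) a'
      + S.toSub (br (S.q (br x (a : g))) (a' : g))
      - sgn (j * k) • (br (S.toSub (br x (a' : g))) a
        + S.toSub (br (S.q (br x (a' : g))) (a : g))) := by
  have key : ∀ (z : g) (a : S.sub), S.toSub (br z (a : g))
      = br (S.toSub z) a + S.toSub (br (S.q z) (a : g)) := by
    intro z a
    conv_lhs => rw [← S.p_add_q z, map_add, LinearMap.add_apply, map_add]
    congr 1
    have : br (S.p z) (a : g) = ((br (S.toSub z) a : S.sub) : g) := rfl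
    rw [this, S.toSub_coe]
  rw [LieSubsuperalgebra.coe_br, br_br_eq hx (S.coe_mem_homog ha) (S.coe_mem_homog ha'), map_sub,
    map_smul, key (br x (a : g)), key (br x (a' : g))]

/-- The a-part of an inner bracket contributes nothing to the b-component, as a is a subalgebra. -/
theorem q_br_br {i j k : ZMod 2} {x : g} {a a' : S.sub} (hx : x ∈ homog g i)
    (ha : a ∈ homog S.sub j) (ha' : a' ∈ homog S.sub k) :
    S.q (br x (br a a' : S.sub)) = S.q (br (S.q (br x (a : g))) (a' : g))
      - sgn (j * k) • S.q (br (S.q (br x (a' : g))) (a : g)) := by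
  have key : ∀ (z : g) (a : S.sub), S.q (br z (a : g)) = S.q (br (S.q z) (a : g)) := by
    intro z a
    conv_lhs => rw [← S.p_add_q z, map_add, LinearMap.add_apply, map_add]
    have : br (S.p z) (a : g) = ((br (S.toSub z) a : S.sub) : g) := rfl
    rw [this, S.q_coe, zero_add]
  rw [LieSubsuperalgebra.coe_br, br_br_eq hx (S.coe_mem_homog ha) (S.coe_mem_homog ha'), map_sub,
    map_smul, key (br x (a : g)), key (br x (a' : g))]

variable (M : SuperModule.{w, v} h) (η : g →ₗ[ℂ] h)

/-- Left multiplication by elements of `a` on `U(a) ⊗ M`. -/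
def leftMul : S.sub →ₗ[ℂ] Module.End ℂ (Env S.sub ⊗[ℂ] M) := (envTensor S.sub M).act

theorem leftMul_tmul (a : S.sub) (u : Env S.sub) (m : M) :
    S.leftMul M a (u ⊗ₜ m) = (Env.ι _ a * u) ⊗ₜ m := rfl

theorem leftMul_leftMul {i j : ZMod 2} {a a' : S.sub} (ha : a ∈ homog S.sub i)
    (ha' : a' ∈ homog S.sub j) (t : Env S.sub ⊗[ℂ] M) :
    S.leftMul M a (S.leftMul M a' t)
      = sgn (i * j) • S.leftMul M a' (S.leftMul M a t) + S.leftMul M (br a a') t := by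
  have : S.leftMul M (br a a') t = S.leftMul M a (S.leftMul M a' t)
      - sgn (i * j) • S.leftMul M a' (S.leftMul M a t) :=
    (envTensor S.sub M).act_br i j a a' ha ha' t
  rw [this]; abel

/-- The parity of `U(a) ⊗ M`. -/
def par : Module.End ℂ (Env S.sub ⊗[ℂ] M) :=
  TensorProduct.map (Env.parityHom S.sub).toLinearMap parity

theorem par_leftMul (a : S.sub) (t : Env S.sub ⊗[ℂ] M) :
    S.par M (S.leftMul M a t) = S.leftMul M (parity a) (S.par M t) :=
  (envTensor S.sub M).parity_act a t

theorem par_par (t : Env S.sub ⊗[ℂ] M) : S.par M (S.par M t) = t :=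
  (envTensor S.sub M).superSpace.parity_parity t

/-- Pairs of a map `M → U(a) ⊗ M` and a map `b ⊗ M → U(a) ⊗ M`; the pair of `u ∈ U(a)` consists of
`m ↦ u ⊗ m` and of `(x, m) ↦ x (u ⊗ m)`. -/
abbrev Pairs : Type _ :=
  (M →ₗ[ℂ] Env S.sub ⊗[ℂ] M) × (g →ₗ[ℂ] M →ₗ[ℂ] Env S.sub ⊗[ℂ] M)

/-- The second component of the action of `a` on pairs. -/
def pairSnd (a : S.sub) (eb : S.Pairs M) : g →ₗ[ℂ] M →ₗ[ℂ] Env S.sub ⊗[ℂ] M where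
  -- This is the rule x(at) = ±a(xt) + [x, a]t that any action must obey, with [x, a] split into its
  -- a-part, acting by left multiplication, and its b-part. The parity of `a` in the odd term
  -- encodes the sign.
  toFun x := S.leftMul M a ∘ₗ eb.2 (evenProj x) + S.leftMul M (parity a) ∘ₗ eb.2 (oddProj x)
    + S.leftMul M (S.toSub (br x (a : g))) ∘ₗ eb.1 + eb.2 (S.q (br x (a : g)))
  map_add' x y := by
    ext m
    simp only [map_add, LinearMap.add_apply, LinearMap.comp_apply]
    abel
  map_smul' c x := by
    ext m
    simp only [map_smul, LinearMap.add_apply, LinearMap.comp_apply, LinearMap.smul_apply, smul_add,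
      RingHom.id_apply]

/-- The action of `a` on pairs. -/
def pairAct : S.sub →ₗ[ℂ] Module.End ℂ (S.Pairs M) where
  toFun a :=
    { toFun := fun eb => (S.leftMul M a ∘ₗ eb.1, S.pairSnd M a eb)
      map_add' := fun eb eb' => by
        refine Prod.ext (LinearMap.comp_add _ _ _) ?_
        ext x m
        simp only [pairSnd, Prod.fst_add, Prod.snd_add, LinearMap.coe_mk, AddHom.coe_mk,
          LinearMap.add_apply, LinearMap.comp_apply, map_add]
        abel
      map_smul' := fun c eb => by
        refine Prod.ext (LinearMap.comp_smul _ _ _) ?_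
        ext x m
        simp only [pairSnd, Prod.smul_fst, Prod.smul_snd, LinearMap.coe_mk, AddHom.coe_mk,
          LinearMap.add_apply, LinearMap.comp_apply, map_smul, LinearMap.smul_apply, smul_add,
          RingHom.id_apply] }
  map_add' a a' := by
    refine LinearMap.ext fun eb => Prod.ext ?_ ?_
    · ext m
      simp only [LinearMap.coe_mk, AddHom.coe_mk, LinearMap.add_apply, LinearMap.comp_apply,
        map_add, Prod.fst_add]
    · ext x m
      simp only [pairSnd, LinearMap.coe_mk, AddHom.coe_mk, LinearMap.add_apply,
        LinearMap.comp_apply, map_add, Prod.snd_add, Submodule.coe_add]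
      abel
  map_smul' c a := by
    refine LinearMap.ext fun eb => Prod.ext ?_ ?_
    · ext m
      simp only [LinearMap.coe_mk, AddHom.coe_mk, LinearMap.smul_apply, LinearMap.comp_apply,
        map_smul, Prod.smul_fst, RingHom.id_apply]
    · ext x m
      simp only [pairSnd, LinearMap.coe_mk, AddHom.coe_mk, LinearMap.add_apply,
        LinearMap.comp_apply, map_smul, Prod.smul_snd, Submodule.coe_smul, LinearMap.smul_apply,
        smul_add, RingHom.id_apply]

theorem pairAct_fst (a : S.sub) (eb : S.Pairs M) (m : M) :
    (S.pairAct M a eb).1 m = S.leftMul M a (eb.1 m) := rfl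

theorem pairAct_snd {i j : ZMod 2} {a : S.sub} {x : g} (ha : a ∈ homog S.sub i)
    (hx : x ∈ homog g j) (eb : S.Pairs M) (m : M) :
    (S.pairAct M a eb).2 x m = sgn (j * i) • S.leftMul M a (eb.2 x m)
      + S.leftMul M (S.toSub (br x (a : g))) (eb.1 m) + eb.2 (S.q (br x (a : g))) m := by
  change S.leftMul M a (eb.2 (evenProj x) m) + S.leftMul M (parity a) (eb.2 (oddProj x) m)
    + S.leftMul M (S.toSub (br x (a : g))) (eb.1 m) + eb.2 (S.q (br x (a : g))) m = _
  rw [mem_homog.1 ha]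
  rcases zmod2_cases j with rfl | rfl
  · rw [evenProj_of_even hx, oddProj_of_even hx]; simp
  · rw [evenProj_of_odd hx, oddProj_of_odd hx]; simp

/-- The second components of the pairs a'·eb and a·eb enter only through their expanded formulas,
here taken as hypotheses. What is left is a comparison using the relations of left multiplication
and the two projected Jacobi identities, with signs checked for all parities. -/
theorem pair_identity {i j l : ZMod 2} {a a' c : S.sub} {x : g} (ha : a ∈ homog S.sub i)
    (ha' : a' ∈ homog S.sub j) (hx : x ∈ homog g l) (hc : br a a' = c) {eb P Q : S.Pairs M} {m : M}
    (p1 : P.1 m = S.leftMul M a' (eb.1 m))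
    (p2 : P.2 x m = sgn (l * j) • S.leftMul M a' (eb.2 x m)
      + S.leftMul M (S.toSub (br x (a' : g))) (eb.1 m) + eb.2 (S.q (br x (a' : g))) m)
    (p3 : P.2 (S.q (br x (a : g))) m
      = sgn ((l + i) * j) • S.leftMul M a' (eb.2 (S.q (br x (a : g))) m)
        + S.leftMul M (S.toSub (br (S.q (br x (a : g))) (a' : g))) (eb.1 m)
        + eb.2 (S.q (br (S.q (br x (a : g))) (a' : g))) m)
    (q1 : Q.1 m = S.leftMul M a (eb.1 m))
    (q2 : Q.2 x m = sgn (l * i) • S.leftMul M a (eb.2 x m)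
      + S.leftMul M (S.toSub (br x (a : g))) (eb.1 m) + eb.2 (S.q (br x (a : g))) m)
    (q3 : Q.2 (S.q (br x (a' : g))) m
      = sgn ((l + j) * i) • S.leftMul M a (eb.2 (S.q (br x (a' : g))) m)
        + S.leftMul M (S.toSub (br (S.q (br x (a' : g))) (a : g))) (eb.1 m)
        + eb.2 (S.q (br (S.q (br x (a' : g))) (a : g))) m) :
    sgn (l * i) • S.leftMul M a (P.2 x m) + S.leftMul M (S.toSub (br x (a : g))) (P.1 m)
        + P.2 (S.q (br x (a : g))) m
      = sgn (i * j) • (sgn (l * j) • S.leftMul M a' (Q.2 x m)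
          + S.leftMul M (S.toSub (br x (a' : g))) (Q.1 m) + Q.2 (S.q (br x (a' : g))) m)
        + (sgn (l * (i + j)) • S.leftMul M c (eb.2 x m) + S.leftMul M (S.toSub (br x (c : g))) (eb.1 m)
          + eb.2 (S.q (br x (c : g))) m) := by
  have hxa := br_mem_homog hx (S.coe_mem_homog ha)
  have hxa' := br_mem_homog hx (S.coe_mem_homog ha')
  have f0 := S.leftMul_leftMul M ha ha' (eb.2 x m)
  have f2 := S.leftMul_leftMul M (S.toSub_mem_homog hxa) ha' (eb.1 m)
  have f3 := S.leftMul_leftMul M (S.toSub_mem_homog hxa') ha (eb.1 m)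
  have t1 := congrArg (fun z => S.leftMul M z (eb.1 m)) (S.toSub_br_br hx ha ha')
  have t2 := congrArg (fun z => eb.2 z m) (S.q_br_br hx ha ha')
  rw [hc] at f0 t1 t2
  rw [p1, p2, p3, q1, q2, q3, t1, t2]
  clear t1 t2 p1 p2 p3 q1 q2 q3 hc
  simp only [map_add, map_sub, map_smul, LinearMap.add_apply, LinearMap.sub_apply,
    LinearMap.smul_apply, f0, f2, f3]
  rcases zmod2_cases i with rfl | rfl <;> rcases zmod2_cases j with rfl | rfl <;>
    rcases zmod2_cases l with rfl | rfl <;>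
    simp only [mul_zero, mul_one, add_zero, zero_add, sgn_zero, sgn_one,
      show (1 + 1 : ZMod 2) = 0 from rfl] <;> module

/-- With the defining relations of U(a) verified on pairs, the recursive rule for x(u ⊗ m) is
consistent, since it depends on u and not on the word chosen to represent u. -/
theorem pairAct_rel {i j : ZMod 2} {a a' : S.sub} (ha : a ∈ homog S.sub i)
    (ha' : a' ∈ homog S.sub j) : S.pairAct M a * S.pairAct M a'
      = sgn (i * j) • (S.pairAct M a' * S.pairAct M a) + S.pairAct M (br a a') := by
  refine LinearMap.ext fun eb => Prod.ext (LinearMap.ext fun m => ?_) ?_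
  · exact S.leftMul_leftMul M ha ha' (eb.1 m)
  · refine linearMap_ext_homog fun l x hx => LinearMap.ext fun m => ?_
    have hxa := S.q_mem_homog (br_mem_homog hx (S.coe_mem_homog ha))
    have hxa' := S.q_mem_homog (br_mem_homog hx (S.coe_mem_homog ha'))
    have a1 := S.pairAct_snd M ha hx (S.pairAct M a' eb) m
    have a2 := S.pairAct_snd M ha' hx (S.pairAct M a eb) m
    have a3 := S.pairAct_snd M (br_mem_homog ha ha') hx eb m
    refine a1.trans ((S.pair_identity M ha ha' hx rfl (S.pairAct_fst M a' eb m)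
      (S.pairAct_snd M ha' hx eb m) (S.pairAct_snd M ha' hxa eb m) (S.pairAct_fst M a eb m)
      (S.pairAct_snd M ha hx eb m) (S.pairAct_snd M ha hxa' eb m)).trans ?_)
    exact (congrArg₂ (fun s t : Env S.sub ⊗[ℂ] M => sgn (i * j) • s + t) a2 a3).symm

/-- The action of `U(a)` on pairs. -/
def pairLift : Env S.sub →ₐ[ℂ] Module.End ℂ (S.Pairs M) :=
  Env.lift (B := Module.End ℂ (S.Pairs M)) (S.pairAct M) fun _ _ _ _ ha ha' => S.pairAct_rel M ha ha'

theorem pairLift_ι (a : S.sub) : S.pairLift M (Env.ι _ a) = S.pairAct M a :=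
  Env.lift_ι (B := Module.End ℂ (S.Pairs M)) _ _ _

/-- The pair of `1 ∈ U(a)`. -/
def pairOne : S.Pairs M :=
  (TensorProduct.mk ℂ (Env S.sub) M 1,
    ((TensorProduct.mk ℂ (Env S.sub) M 1).compRight ℂ) ∘ₗ M.act ∘ₗ η ∘ₗ S.q)

/-- The action of `b` on `U(a) ⊗ M`. -/
def rightAct : g →ₗ[ℂ] Module.End ℂ (Env S.sub ⊗[ℂ] M) :=
  (TensorProduct.lift.equiv (RingHom.id ℂ) (Env S.sub) M (Env S.sub ⊗[ℂ] M)).toLinearMap ∘ₗ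
    LinearMap.flip (LinearMap.snd ℂ _ _ ∘ₗ
      (LinearMap.applyₗ (S.pairOne M η)) ∘ₗ (S.pairLift M).toLinearMap)

theorem rightAct_tmul (x : g) (u : Env S.sub) (m : M) :
    S.rightAct M η x (u ⊗ₜ m) = (S.pairLift M u (S.pairOne M η)).2 x m := rfl

theorem rightAct_one (x : g) (m : M) :
    S.rightAct M η x (1 ⊗ₜ m) = 1 ⊗ₜ M.act (η (S.q x)) m := by
  rw [rightAct_tmul, map_one]; rfl

/-- The first component records u ⊗ m itself, which the recursion needs in order to evaluate the
a-part of [x, a]. -/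
theorem pairLift_fst (u : Env S.sub) (m : M) :
    (S.pairLift M u (S.pairOne M η)).1 m = u ⊗ₜ m := by
  induction u using Env.induction_left with
  | h1 => rw [map_one]; rfl
  | hι x u hu =>
    rw [map_mul, pairLift_ι, Module.End.mul_apply, pairAct_fst]
    exact congrArg (S.leftMul M x) hu
  | ha u v hu hv =>
    rw [map_add, LinearMap.add_apply, Prod.fst_add, LinearMap.add_apply, hu, hv,
      TensorProduct.add_tmul]
  | hs c u hu =>
    rw [map_smul, LinearMap.smul_apply, Prod.smul_fst, LinearMap.smul_apply, hu,
      TensorProduct.smul_tmul']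

theorem rightAct_leftMul_eq (x : g) (a : S.sub) (t : Env S.sub ⊗[ℂ] M) :
    S.rightAct M η x (S.leftMul M a t) = S.leftMul M a (S.rightAct M η (evenProj x) t)
      + S.leftMul M (parity a) (S.rightAct M η (oddProj x) t)
      + S.leftMul M (S.toSub (br x (a : g))) t + S.rightAct M η (S.q (br x (a : g))) t := by
  induction t using TensorProduct.induction_on with
  | zero => simp
  | tmul u m =>
    rw [leftMul_tmul, rightAct_tmul, map_mul]
    rw [pairLift_ι, Module.End.mul_apply]
    change S.leftMul M a ((S.pairLift M u (S.pairOne M η)).2 (evenProj x) m)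
      + S.leftMul M (parity a) ((S.pairLift M u (S.pairOne M η)).2 (oddProj x) m)
      + S.leftMul M (S.toSub (br x (a : g))) ((S.pairLift M u (S.pairOne M η)).1 m)
      + (S.pairLift M u (S.pairOne M η)).2 (S.q (br x (a : g))) m = _
    rw [pairLift_fst]
    rfl
  | add s t hs ht => simp only [map_add, hs, ht]; abel

theorem rightAct_leftMul {i j : ZMod 2} {x : g} {a : S.sub} (hx : x ∈ homog g i)
    (ha : a ∈ homog S.sub j) (t : Env S.sub ⊗[ℂ] M) :
    S.rightAct M η x (S.leftMul M a t) = sgn (i * j) • S.leftMul M a (S.rightAct M η x t)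
      + S.leftMul M (S.toSub (br x (a : g))) t + S.rightAct M η (S.q (br x (a : g))) t := by
  rw [rightAct_leftMul_eq, mem_homog.1 ha]
  rcases zmod2_cases i with rfl | rfl
  · rw [evenProj_of_even hx, oddProj_of_even hx]; simp
  · rw [evenProj_of_odd hx, oddProj_of_odd hx]; simp

/-- Induction over `U(a) ⊗ M` along left multiplications by homogeneous elements. -/
theorem tensor_induction_left {P : Env S.sub ⊗[ℂ] M → Prop} (h1 : ∀ m, P (1 ⊗ₜ m))
    (hl : ∀ (i : ZMod 2), ∀ a ∈ homog S.sub i, ∀ t, P t → P (S.leftMul M a t))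
    (ha : ∀ s t, P s → P t → P (s + t)) (hs : ∀ (c : ℂ) t, P t → P (c • t))
    (t : Env S.sub ⊗[ℂ] M) : P t := by
  induction t using TensorProduct.induction_on with
  | zero => simpa using hs 0 _ (h1 0)
  | add s t hs ht => exact ha s t hs ht
  | tmul u m =>
    induction u using Env.induction_left with
    | h1 => exact h1 m
    | hι x u hu =>
      rw [← leftMul_tmul, ← evenProj_add_oddProj x, map_add, LinearMap.add_apply]
      exact ha _ _ (hl 0 _ (evenProj_mem x) _ hu) (hl 1 _ (oddProj_mem x) _ hu)
    | ha u v hu hv => rw [TensorProduct.add_tmul]; exact ha _ _ hu hv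
    | hs c u hu => rw [← TensorProduct.smul_tmul']; exact hs c _ hu

variable {η}

theorem par_rightAct (hη : ∀ x, η (parity x) = parity (η x)) (x : g) (t : Env S.sub ⊗[ℂ] M) :
    S.par M (S.rightAct M η x t) = S.rightAct M η (parity x) (S.par M t) := by
  revert x
  refine S.tensor_induction_left M (P := fun t => ∀ x, S.par M (S.rightAct M η x t)
    = S.rightAct M η (parity x) (S.par M t)) (fun m x => ?_) (fun i a _ t ht x => ?_)
    (fun s t hs ht x => by simp only [map_add, hs, ht])
    (fun c t ht x => by simp only [map_smul, ht]) t
  · have hpar : ∀ m : M, S.par M (1 ⊗ₜ m) = 1 ⊗ₜ parity m := fun m => by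
      rw [par, TensorProduct.map_tmul]
      exact congrArg (· ⊗ₜ[ℂ] parity m) (map_one (Env.parityHom S.sub))
    rw [rightAct_one, hpar, hpar, rightAct_one, M.parity_act, S.q_parity, hη]
  · have h0 : parity (evenProj x) = evenProj (parity x) := by
      rw [parity_evenProj, evenProj_parity]
    have h1 : parity (oddProj x) = oddProj (parity x) := by
      rw [parity_oddProj, oddProj_parity]
    rw [rightAct_leftMul_eq, S.par_leftMul, rightAct_leftMul_eq, map_add, map_add, map_add,
      S.par_leftMul, S.par_leftMul, S.par_leftMul, ht, ht, ht, h0, h1, ← S.toSub_parity,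
      ← S.q_parity, parity_br, LieSubsuperalgebra.coe_parity]

/-- The action of `g` on `U(a) ⊗ M`. -/
def totalAct (η : g →ₗ[ℂ] h) : g →ₗ[ℂ] Module.End ℂ (Env S.sub ⊗[ℂ] M) :=
  S.leftMul M ∘ₗ S.toSub + S.rightAct M η ∘ₗ S.q

theorem totalAct_apply (x : g) (t : Env S.sub ⊗[ℂ] M) :
    S.totalAct M η x t = S.leftMul M (S.toSub x) t + S.rightAct M η (S.q x) t := rfl

/-- The last two terms of the commutation rule are the a-part and b-part of [x, a], so together they
form the total action of the bracket. -/
theorem rightAct_leftMul' {i j : ZMod 2} {x : g} {a : S.sub} (hx : x ∈ homog g i)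
    (ha : a ∈ homog S.sub j) (t : Env S.sub ⊗[ℂ] M) :
    S.rightAct M η x (S.leftMul M a t) = sgn (i * j) • S.leftMul M a (S.rightAct M η x t)
      + S.totalAct M η (br x (a : g)) t := by
  rw [S.rightAct_leftMul M η hx ha, totalAct_apply, add_assoc]

/-- By induction along left multiplications: on 1 ⊗ M it is the given action of b through η, and the
step moves both x and y past a. -/
theorem rightAct_rightAct
    (hηb : ∀ x y, S.p x = 0 → S.p y = 0 → η (br x y) = br (η x) (η y))
    (hηp : ∀ x, η (parity x) = parity (η x))
    {i j : ZMod 2} {x y : g} (hx : x ∈ homog g i) (hy : y ∈ homog g j) (hpx : S.p x = 0)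
    (hpy : S.p y = 0) (t : Env S.sub ⊗[ℂ] M) :
    S.rightAct M η x (S.rightAct M η y t)
      = sgn (i * j) • S.rightAct M η y (S.rightAct M η x t) + S.rightAct M η (br x y) t := by
  have hηh : ∀ {i : ZMod 2} {x : g}, x ∈ homog g i → η x ∈ homog h i := fun hx => by
    rw [mem_homog] at *; rw [← hηp, hx, map_smul]
  -- All x and y are quantified inside the induction, because the step also uses the hypothesis for
  -- the b-parts of brackets such as [y, a].
  suffices H : ∀ t : Env S.sub ⊗[ℂ] M, ∀ (i j : ZMod 2) (x y : g), x ∈ homog g i →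
      y ∈ homog g j → S.p x = 0 → S.p y = 0 → S.rightAct M η x (S.rightAct M η y t)
      = sgn (i * j) • S.rightAct M η y (S.rightAct M η x t) + S.rightAct M η (br x y) t from
    H t i j x y hx hy hpx hpy
  clear hx hy hpx hpy x y i j t
  intro t
  refine S.tensor_induction_left M (P := fun t => ∀ (i j : ZMod 2) (x y : g), x ∈ homog g i →
      y ∈ homog g j → S.p x = 0 → S.p y = 0 → S.rightAct M η x (S.rightAct M η y t)
      = sgn (i * j) • S.rightAct M η y (S.rightAct M η x t) + S.rightAct M η (br x y) t)
    (fun m i j x y hx hy hpx hpy => ?_) (fun l a ha t ht i j x y hx hy hpx hpy => ?_)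
    (fun s t hs ht i j x y hx hy hpx hpy => ?_) (fun c t ht i j x y hx hy hpx hpy => ?_) t
  · simp only [rightAct_one, S.q_eq_self hpx, S.q_eq_self hpy,
      S.q_eq_self (S.p_br_eq_zero hpx hpy), hηb x y hpx hpy,
      M.act_br i j _ _ (hηh hx) (hηh hy), TensorProduct.tmul_sub, TensorProduct.tmul_smul]
    abel
  · have hρ : ∀ {i k : ZMod 2} {x z : g}, x ∈ homog g i → S.p x = 0 → z ∈ homog g k →
        S.rightAct M η x (S.totalAct M η z t) = sgn (i * k) •
          S.totalAct M η z (S.rightAct M η x t) + S.totalAct M η (br x z) t := by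
      intro i k x z hx hpx hz
      have e1 : br x z = br x (S.p z) + br x (S.q z) := by rw [← map_add, S.p_add_q]
      rw [totalAct_apply, map_add, S.rightAct_leftMul' M hx (S.toSub_mem_homog hz),
        ht i k x (S.q z) hx (S.q_mem_homog hz) hpx (S.p_q z), e1, map_add, LinearMap.add_apply,
        coe_toSub, totalAct_apply S M (br x (S.q z)), totalAct_apply S M z (S.rightAct M η x t),
        S.toSub_eq_zero (S.p_br_eq_zero hpx (S.p_q z)), map_zero,
        S.q_eq_self (S.p_br_eq_zero hpx (S.p_q z)), LinearMap.zero_apply]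
      module
    have hxa := br_mem_homog hx (S.coe_mem_homog ha)
    have hya := br_mem_homog hy (S.coe_mem_homog ha)
    have hq := S.q_eq_self (S.p_br_eq_zero hpx hpy)
    rw [S.rightAct_leftMul' M hy ha, map_add, map_smul, S.rightAct_leftMul' M hx ha,
      hρ hx hpx hya, S.rightAct_leftMul' M hx ha, map_add, map_smul, S.rightAct_leftMul' M hy ha,
      hρ hy hpy hxa, S.rightAct_leftMul' M (br_mem_homog hx hy) ha, ht i j x y hx hy hpx hpy,
      br_jacobi i j l x y _ hx hy (S.coe_mem_homog ha)]
    simp only [map_add, map_smul, LinearMap.add_apply, LinearMap.smul_apply]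
    rcases zmod2_cases i with rfl | rfl <;> rcases zmod2_cases j with rfl | rfl <;>
      rcases zmod2_cases l with rfl | rfl <;>
      simp only [mul_zero, mul_one, add_zero, zero_add, sgn_zero, sgn_one,
        show (1 + 1 : ZMod 2) = 0 from rfl] <;> module
  · simp only [map_add, hs i j x y hx hy hpx hpy, ht i j x y hx hy hpx hpy]; module
  · simp only [map_smul, ht i j x y hx hy hpx hpy]; module

/-- The `g`-module `U(a) ⊗ M`, where `b` acts on `M` through `η`. -/
def module (hηb : ∀ x y, S.p x = 0 → S.p y = 0 → η (br x y) = br (η x) (η y))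
    (hηp : ∀ x, η (parity x) = parity (η x)) : SuperModule g where
  carrier := Env S.sub ⊗[ℂ] M
  superSpace := { parity := S.par M, parity_parity := S.par_par M }
  act := S.totalAct M η
  parity_act := fun x t => by
    change S.par M (S.totalAct M η x t) = S.totalAct M η (parity x) (S.par M t)
    rw [totalAct_apply, totalAct_apply, map_add, par_leftMul, S.par_rightAct M hηp,
      S.toSub_parity, S.q_parity]
  act_br := fun i j x y hx hy t => by
    have hpx := S.toSub_mem_homog hx
    have hpy := S.toSub_mem_homog hy
    have hqx := S.q_mem_homog hx
    have hqy := S.q_mem_homog hy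
    -- Splitting x and y into a-part and b-part reduces the module axiom to four brackets, one for
    -- each kind of pair.
    have e1 := S.leftMul_leftMul M hpx hpy t
    have e2 := S.rightAct_leftMul' M (η := η) hqx hpy t
    have e3 := S.rightAct_leftMul' M (η := η) hqy hpx t
    have e4 := S.rightAct_rightAct M hηb hηp hqx hqy (S.p_q x) (S.p_q y) t
    have f1 : S.leftMul M (br (S.toSub x) (S.toSub y)) t = S.totalAct M η (br (S.p x) (S.p y)) t := by
      have : br (S.p x) (S.p y) = ((br (S.toSub x) (S.toSub y) : S.sub) : g) := rfl
      rw [this, totalAct_apply, S.toSub_coe, S.q_coe, map_zero, LinearMap.zero_apply, add_zero]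
    have f4 : S.rightAct M η (br (S.q x) (S.q y)) t
        = S.totalAct M η (br (S.q x) (S.q y)) t := by
      have := S.p_br_eq_zero (S.p_q x) (S.p_q y)
      rw [totalAct_apply, S.toSub_eq_zero this, S.q_eq_self this, map_zero, LinearMap.zero_apply,
        zero_add]
    have f3 : br (S.q y) (S.p x) = -(sgn (i * j) • br (S.p x) (S.q y)) := by
      rw [br_skew j i _ _ hqy (S.p_mem_homog hx), mul_comm]
    have f5 : br x y = br (S.p x) (S.p y) + br (S.p x) (S.q y) + (br (S.q x) (S.p y)
        + br (S.q x) (S.q y)) := by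
      conv_lhs => rw [← S.p_add_q x, ← S.p_add_q y]
      simp only [map_add, LinearMap.add_apply]
      abel
    rw [coe_toSub] at e2 e3
    rw [f3, mul_comm j i] at e3
    rw [f5]
    rw [f1] at e1
    rw [f4] at e4
    simp only [totalAct_apply S M x, totalAct_apply S M y, map_add, map_smul, map_neg,
      LinearMap.add_apply, LinearMap.smul_apply, LinearMap.neg_apply, e1, e2, e3, e4]
    have hs := sgn_mul_self (i * j)
    rcases zmod2_cases (i * j) with h | h <;> rw [h] <;> simp only [sgn_zero, sgn_one] <;> module

/-- This substitutes for a Poincaré–Birkhoff–Witt basis. Mapping an induced module into this one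
shows that M survives in it. -/
theorem exists_injective
    (hηb : ∀ x y, S.p x = 0 → S.p y = 0 → η (br x y) = br (η x) (η y))
    (hηp : ∀ x, η (parity x) = parity (η x)) :
    ∃ (X : SuperModule.{u, max u v} g) (f : M →ₗ[ℂ] X), Function.Injective f ∧
      (∀ m, f (parity m) = parity (f m)) ∧
      ∀ x, S.p x = 0 → ∀ m, X.act x (f m) = f (M.act (η x) m) := by
  refine ⟨S.module M hηb hηp, TensorProduct.mk ℂ (Env S.sub) M 1, ?_, fun m => ?_,
    fun x hx m => ?_⟩
  -- The augmentation of U(a) gives a left inverse of m ↦ 1 ⊗ m.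
  · let ε : Env S.sub →ₐ[ℂ] ℂ := Env.lift 0 (by simp)
    have : ∀ m : M, TensorProduct.lid ℂ M (TensorProduct.map ε.toLinearMap LinearMap.id
        ((1 : Env S.sub) ⊗ₜ[ℂ] m)) = m := fun m => by simp
    exact Function.LeftInverse.injective (g := fun t => TensorProduct.lid ℂ M
      (TensorProduct.map ε.toLinearMap LinearMap.id t)) this
  · change _ = S.par M (1 ⊗ₜ m)
    rw [par, TensorProduct.map_tmul]
    exact (congrArg (· ⊗ₜ[ℂ] parity m) (map_one (Env.parityHom S.sub))).symm
  · change S.totalAct M η x (1 ⊗ₜ m) = 1 ⊗ₜ M.act (η x) m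
    rw [totalAct_apply, S.toSub_eq_zero hx, map_zero, LinearMap.zero_apply, zero_add,
      rightAct_one, S.q_q, S.q_eq_self hx]

end Splitting

/-! ### The principal grading of `q(n)` -/

section Grading

variable {n : ℕ}

open Classical in
/-- Erase the entries of a matrix outside the diagonals `j - i = k`, `k ∈ K`. -/
def diagonals {m : ℕ} (K : Set ℤ) :
    Matrix (Fin m) (Fin m) ℂ →ₗ[ℂ] Matrix (Fin m) (Fin m) ℂ where
  toFun X := Matrix.of fun i j => if (j : ℤ) - i ∈ K then X i j else 0
  map_add' X Y := by ext i j; by_cases h : (j : ℤ) - i ∈ K <;> simp [h]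
  map_smul' c X := by ext i j; by_cases h : (j : ℤ) - i ∈ K <;> simp [h]

open Classical in
theorem diagonals_apply {m : ℕ} (K : Set ℤ) (X : Matrix (Fin m) (Fin m) ℂ) (i j : Fin m) :
    diagonals K X i j = if (j : ℤ) - i ∈ K then X i j else 0 := rfl

theorem diagonals_trace {m : ℕ} (K : Set ℤ) {X : Matrix (Fin m) (Fin m) ℂ} (hX : X.trace = 0) :
    (diagonals K X).trace = 0 := by
  by_cases h : (0 : ℤ) ∈ K
  · simpa [Matrix.trace, diagonals_apply, h] using hX
  · simp [Matrix.trace, diagonals_apply, h]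

/-- Scalar matrices stay scalar, so the projection descends to the quotient by ℂI. -/
theorem diagonals_one {m : ℕ} (K : Set ℤ) (c : ℂ) :
    ∃ c' : ℂ, diagonals K (c • 1 : Matrix (Fin m) (Fin m) ℂ) = c' • 1 := by
  by_cases h : (0 : ℤ) ∈ K
  · refine ⟨c, ?_⟩
    ext i j
    by_cases hij : i = j
    · subst hij; simp [diagonals_apply, h]
    · simp [diagonals_apply, Matrix.one_apply_ne hij]
  · refine ⟨0, ?_⟩
    ext i j
    by_cases hij : i = j
    · subst hij; simp [diagonals_apply, h]
    · simp [diagonals_apply, Matrix.one_apply_ne hij]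

/-- `diagonals K` on `q̃(n)`. -/
def qTildeDiagonals (n : ℕ) (K : Set ℤ) : qTilde n →ₗ[ℂ] qTilde n :=
  ((diagonals K).prodMap (diagonals K)).restrict fun _ hx => diagonals_trace K hx

/-- The projection of `q(n)` onto the part supported on the diagonals `j - i = k`, `k ∈ K`. -/
def component (n : ℕ) (K : Set ℤ) : Queer n →ₗ[ℂ] Queer n :=
  (qCenter n).toSubmodule.mapQ (qCenter n).toSubmodule (qTildeDiagonals n K) <| by
    rintro x ⟨c, hc⟩
    obtain ⟨c', hc'⟩ := diagonals_one (m := n + 1) K c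
    refine ⟨c', ?_⟩
    change (diagonals K x.1.1, diagonals K x.1.2) = _
    rw [hc, hc', map_zero]

/-- The elements of `q(n)` supported on the diagonals `j - i = k`, `k ∈ K`. -/
def supported (n : ℕ) (K : Set ℤ) : Submodule ℂ (Queer n) := LinearMap.range (component n K)

theorem component_mem (K : Set ℤ) (z : Queer n) : component n K z ∈ supported n K := ⟨z, rfl⟩

theorem qTildeDiagonals_qTildeDiagonals (K L : Set ℤ) (x : qTilde n) :
    qTildeDiagonals n K (qTildeDiagonals n L x) = qTildeDiagonals n (K ∩ L) x := by
  have key : ∀ X : Matrix (Fin (n + 1)) (Fin (n + 1)) ℂ,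
      diagonals K (diagonals L X) = diagonals (K ∩ L) X := by
    intro X
    ext i j
    by_cases h : (j : ℤ) - i ∈ K <;> by_cases h' : (j : ℤ) - i ∈ L <;> simp [diagonals_apply, h, h']
  exact Subtype.ext (Prod.ext (key x.1.1) (key x.1.2))

theorem component_component (K L : Set ℤ) (z : Queer n) :
    component n K (component n L z) = component n (K ∩ L) z := by
  obtain ⟨x, rfl⟩ := (qCenter n).toSubmodule.mkQ_surjective z
  exact congrArg (qMk n) (qTildeDiagonals_qTildeDiagonals K L x)

theorem component_empty (z : Queer n) : component n ∅ z = 0 := by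
  obtain ⟨x, rfl⟩ := (qCenter n).toSubmodule.mkQ_surjective z
  have key : ∀ X : Matrix (Fin (n + 1)) (Fin (n + 1)) ℂ, diagonals ∅ X = 0 := by
    intro X
    ext i j
    simp [diagonals_apply]
  have : qTildeDiagonals n ∅ x = 0 := Subtype.ext (Prod.ext (key x.1.1) (key x.1.2))
  exact (congrArg (qMk n) this).trans (map_zero _)

theorem component_of_mem {K : Set ℤ} {z : Queer n} (hz : z ∈ supported n K) :
    component n K z = z := by
  obtain ⟨z, rfl⟩ := hz
  rw [component_component, Set.inter_self]

theorem component_of_disjoint {K L : Set ℤ} {z : Queer n} (hz : z ∈ supported n L)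
    (h : Disjoint K L) : component n K z = 0 := by
  rw [← component_of_mem hz, component_component, h.inter_eq, component_empty]

theorem component_parity (K : Set ℤ) (z : Queer n) :
    component n K (parity z) = parity (component n K z) := by
  obtain ⟨x, rfl⟩ := (qCenter n).toSubmodule.mkQ_surjective z
  refine congrArg (qMk n) (Subtype.ext (Prod.ext rfl ?_))
  exact map_neg (diagonals K) x.1.2

theorem component_union {K L : Set ℤ} (h : Disjoint K L) (z : Queer n) :
    component n (K ∪ L) z = component n K z + component n L z := by
  obtain ⟨x, rfl⟩ := (qCenter n).toSubmodule.mkQ_surjective z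
  have key : ∀ X : Matrix (Fin (n + 1)) (Fin (n + 1)) ℂ,
      diagonals (K ∪ L) X = diagonals K X + diagonals L X := by
    intro X
    ext i j
    by_cases h1 : (j : ℤ) - i ∈ K
    · have h2 : (j : ℤ) - i ∉ L := Set.disjoint_left.1 h h1
      simp [diagonals_apply, h1, h2]
    · by_cases h2 : (j : ℤ) - i ∈ L <;> simp [diagonals_apply, h1, h2]
  exact congrArg (qMk n) (Subtype.ext (Prod.ext (key x.1.1) (key x.1.2)))

theorem component_univ (z : Queer n) : component n Set.univ z = z := by
  obtain ⟨x, rfl⟩ := (qCenter n).toSubmodule.mkQ_surjective z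
  have key : ∀ X : Matrix (Fin (n + 1)) (Fin (n + 1)) ℂ, diagonals Set.univ X = X := by
    intro X
    ext i j
    simp [diagonals_apply]
  exact congrArg (qMk n) (Subtype.ext (Prod.ext (key x.1.1) (key x.1.2)))

theorem component_add_compl (K : Set ℤ) (z : Queer n) :
    component n K z + component n Kᶜ z = z := by
  rw [← component_union disjoint_compl_right, Set.union_compl_self, component_univ]

/-- In the (i, j) entry of a product the offsets l - i and j - l add to j - i. -/
theorem diagonals_mul {m : ℕ} {K L N : Set ℤ} (h : ∀ k ∈ K, ∀ l ∈ L, k + l ∈ N)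
    (X Y : Matrix (Fin m) (Fin m) ℂ) :
    diagonals N (diagonals K X * diagonals L Y) = diagonals K X * diagonals L Y := by
  ext i j
  rw [diagonals_apply]
  split_ifs with hN
  · rfl
  · rw [Matrix.mul_apply]
    refine (Finset.sum_eq_zero fun l _ => ?_).symm
    rw [diagonals_apply, diagonals_apply]
    split_ifs with h1 h2
    · exact absurd (by simpa using h _ h1 _ h2) hN
    · exact mul_zero _
    · exact zero_mul _
    · exact zero_mul _

theorem br_mem_supported {K L N : Set ℤ} (h : ∀ k ∈ K, ∀ l ∈ L, k + l ∈ N) {z w : Queer n}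
    (hz : z ∈ supported n K) (hw : w ∈ supported n L) : br z w ∈ supported n N := by
  obtain ⟨z, rfl⟩ := hz
  obtain ⟨w, rfl⟩ := hw
  obtain ⟨x, rfl⟩ := (qCenter n).toSubmodule.mkQ_surjective z
  obtain ⟨y, rfl⟩ := (qCenter n).toSubmodule.mkQ_surjective w
  have h' : ∀ l ∈ L, ∀ k ∈ K, l + k ∈ N := fun l hl k hk => add_comm k l ▸ h k hk l hl
  refine ⟨qMk n (br (qTildeDiagonals n K x) (qTildeDiagonals n L y)), ?_⟩
  refine congrArg (qMk n) (Subtype.ext ?_)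
  change (diagonals N (QMat.bracket (diagonals K x.1.1, diagonals K x.1.2)
    (diagonals L y.1.1, diagonals L y.1.2)).1, diagonals N (QMat.bracket
    (diagonals K x.1.1, diagonals K x.1.2) (diagonals L y.1.1, diagonals L y.1.2)).2)
    = QMat.bracket (diagonals K x.1.1, diagonals K x.1.2) (diagonals L y.1.1, diagonals L y.1.2)
  simp only [QMat.bracket_apply, map_add, map_sub, diagonals_mul h, diagonals_mul h']

theorem mem_supported_of_diagonals {K : Set ℤ} {x : qTilde n}
    (h1 : ∀ i j : Fin (n + 1), (j : ℤ) - i ∉ K → x.1.1 i j = 0)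
    (h2 : ∀ i j : Fin (n + 1), (j : ℤ) - i ∉ K → x.1.2 i j = 0) : qMk n x ∈ supported n K := by
  refine ⟨qMk n x, congrArg (qMk n) (Subtype.ext (Prod.ext ?_ ?_))⟩ <;> ext i j
  · change diagonals K x.1.1 i j = _
    rw [diagonals_apply]; split_ifs with h
    · rfl
    · exact (h1 i j h).symm
  · change diagonals K x.1.2 i j = _
    rw [diagonals_apply]; split_ifs with h
    · rfl
    · exact (h2 i j h).symm

theorem cartan_eq_supported : (cartan n).toSubmodule = supported n {0} := by
  ext z
  constructor
  · rintro ⟨x, h1, h2, rfl⟩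
    refine mem_supported_of_diagonals (fun i j h => h1 fun hij => h ?_)
      fun i j h => h2 fun hij => h ?_ <;> simp [hij]
  · rintro ⟨z, rfl⟩
    obtain ⟨x, rfl⟩ := (qCenter n).toSubmodule.mkQ_surjective z
    have key : ∀ X : Matrix (Fin (n + 1)) (Fin (n + 1)) ℂ, (diagonals {0} X).IsDiag := by
      intro X i j hij
      rw [diagonals_apply, if_neg]
      simp only [Set.mem_singleton_iff]
      have : (i : ℕ) ≠ j := fun h => hij (Fin.ext h)
      omega
    exact ⟨qTildeDiagonals n {0} x, key _, key _, rfl⟩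

theorem nPlus_eq_supported : nPlus n = supported n (Set.Ioi 0) := by
  ext z
  constructor
  · rintro ⟨x, h1, h2, rfl⟩
    refine mem_supported_of_diagonals (fun i j h => h1 i j ?_) fun i j h => h2 i j ?_ <;>
      simpa using h
  · rintro ⟨z, rfl⟩
    obtain ⟨x, rfl⟩ := (qCenter n).toSubmodule.mkQ_surjective z
    have key : ∀ (X : Matrix (Fin (n + 1)) (Fin (n + 1)) ℂ) (i j), j ≤ i →
        diagonals (Set.Ioi 0) X i j = 0 := by
      intro X i j hij
      rw [diagonals_apply, if_neg]
      simpa using hij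
    exact ⟨qTildeDiagonals n (Set.Ioi 0) x, key _, key _, rfl⟩

/-- The grading element, the image of `diag(0, -1, …, -n)`. -/
def gradingElement (n : ℕ) : cartanEven n :=
  ⟨⟨qMk n ⟨(Matrix.diagonal fun i => -(i : ℂ), 0), by rw [mem_qTilde]; simp⟩,
    _, Matrix.isDiag_diagonal _, Matrix.isDiag_zero, rfl⟩, by
    rw [mem_homog, sgn_zero, one_smul]
    refine Subtype.ext (congrArg (qMk n) (Subtype.ext (Prod.ext rfl ?_)))
    exact neg_zero⟩

/-- The eigenvalue on the (i, j) entry is (-i) - (-j) = j - i; the minus signs in the grading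
element make strictly upper triangular entries positive. -/
theorem br_gradingElement {k : ℤ} {z : Queer n} (hz : z ∈ supported n {k}) :
    br ((gradingElement n : cartan n) : Queer n) z = (k : ℂ) • z := by
  obtain ⟨z, rfl⟩ := hz
  obtain ⟨x, rfl⟩ := (qCenter n).toSubmodule.mkQ_surjective z
  have key : ∀ X : Matrix (Fin (n + 1)) (Fin (n + 1)) ℂ,
      Matrix.diagonal (fun i : Fin (n + 1) => -(i : ℂ)) * diagonals {k} X
        - diagonals {k} X * Matrix.diagonal (fun i : Fin (n + 1) => -(i : ℂ))
        = (k : ℂ) • diagonals {k} X := by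
    intro X
    ext i j
    simp only [Matrix.sub_apply, Matrix.diagonal_mul, Matrix.mul_diagonal, Matrix.smul_apply,
      diagonals_apply, smul_eq_mul]
    split_ifs with h
    · rw [Set.mem_singleton_iff] at h
      rw [← h]; push_cast; ring
    · simp
  refine congrArg (qMk n) (Subtype.ext ?_)
  change QMat.bracket (Matrix.diagonal (fun i : Fin (n + 1) => -(i : ℂ)), 0)
    (diagonals {k} x.1.1, diagonals {k} x.1.2)
      = ((k : ℂ) • diagonals {k} x.1.1, (k : ℂ) • diagonals {k} x.1.2)
  simp only [QMat.bracket_apply, key, zero_mul, mul_zero, add_zero, sub_zero]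

theorem sum_component (z : Queer n) :
    ∑ k ∈ Finset.Icc (-(n : ℤ)) n, component n {k} z = z := by
  obtain ⟨x, rfl⟩ := (qCenter n).toSubmodule.mkQ_surjective z
  have key : ∀ X : Matrix (Fin (n + 1)) (Fin (n + 1)) ℂ,
      ∑ k ∈ Finset.Icc (-(n : ℤ)) n, diagonals {k} X = X := by
    intro X
    ext i j
    simp only [Matrix.sum_apply, diagonals_apply, Set.mem_singleton_iff]
    rw [Finset.sum_ite_eq, if_pos]
    rw [Finset.mem_Icc]
    omega
  have h : ∑ k ∈ Finset.Icc (-(n : ℤ)) n, qTildeDiagonals n {k} x = x := by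
    refine Subtype.ext ?_
    rw [AddSubmonoidClass.coe_finsetSum]
    exact Prod.ext ((Prod.fst_sum ..).trans (key x.1.1)) ((Prod.snd_sum ..).trans (key x.1.2))
  conv_rhs => rw [← h]
  rw [map_sum]
  rfl

theorem supported_le (K : Set ℤ) : supported n K ≤ ⨆ k ∈ K, supported n {k} := by
  intro z hz
  rw [← sum_component z]
  refine Submodule.sum_mem _ fun k _ => ?_
  by_cases hk : k ∈ K
  · exact Submodule.mem_iSup_of_mem k (Submodule.mem_iSup_of_mem hk (component_mem _ z))
  · rw [component_of_disjoint hz (Set.disjoint_singleton_left.2 hk)]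
    exact Submodule.zero_mem _

end Grading

/-! ### The triangular decomposition of `q(n) ⊗ A` -/

section Triangular

variable (n : ℕ) (A : Type u) [CommRing A] [Algebra ℂ A]

theorem tensor_hom_ext₂ {g X : Type*} [AddCommGroup g] [Module ℂ g] [AddCommGroup X] [Module ℂ X]
    {f f' : g ⊗[ℂ] A →ₗ[ℂ] g ⊗[ℂ] A →ₗ[ℂ] X}
    (h : ∀ x a y b, f (x ⊗ₜ a) (y ⊗ₜ b) = f' (x ⊗ₜ a) (y ⊗ₜ b)) (s t : g ⊗[ℂ] A) :
    f s t = f' s t := by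
  have : f = f' := by ext x a y b; exact h x a y b
  rw [this]

/-- The projection `q(n) → h`. -/
def cartanProj : Queer n →ₗ[ℂ] cartan n :=
  (component n {0}).codRestrict (cartan n).toSubmodule fun z =>
    cartan_eq_supported (n := n) ▸ component_mem _ z

theorem component_Ici (z : Queer n) :
    z - component n (Set.Iio 0) z = component n (Set.Ici 0) z := by
  rw [sub_eq_iff_eq_add', ← Set.compl_Iio, component_add_compl]

theorem component_Ici_eq (z : Queer n) : component n (Set.Ici 0) z
    = component n {0} z + component n (Set.Ioi 0) z := by
  rw [← component_union (by simp), Set.singleton_union, Set.Ioi_insert]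

theorem br_add_add {g : Type*} [AddCommGroup g] [Module ℂ g] [LieSuperalgebra g] (a u a' u' : g) :
    br (a + u) (a' + u') = br a a' + (br u a' + (br a u' + br u u')) := by
  simp only [map_add, LinearMap.add_apply]
  abel

/-- This expresses that n⁺ is an ideal of b: every bracket other than [a, a'] lies on positive
diagonals. Hence the projection from b to h is a homomorphism. -/
theorem component_zero_br_add {a a' u u' : Queer n} (ha : a ∈ supported n {0})
    (ha' : a' ∈ supported n {0}) (hu : u ∈ supported n (Set.Ioi 0))
    (hu' : u' ∈ supported n (Set.Ioi 0)) : component n {0} (br (a + u) (a' + u')) = br a a' := by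
  have hpos : ∀ {z}, z ∈ supported n (Set.Ioi 0) → component n {0} z = 0 := fun hz =>
    component_of_disjoint hz (by simp)
  have h1 : br a a' ∈ supported n {0} := br_mem_supported (by simp) ha ha'
  have h2 : br a u' ∈ supported n (Set.Ioi 0) := br_mem_supported (by simp) ha hu'
  have h3 : br u a' ∈ supported n (Set.Ioi 0) := br_mem_supported (by simp) hu ha'
  have h4 : br u u' ∈ supported n (Set.Ioi 0) :=
    br_mem_supported (fun k hk l hl => add_pos (Set.mem_Ioi.1 hk) (Set.mem_Ioi.1 hl)) hu hu'
  have h5 := Submodule.add_mem _ h3 (Submodule.add_mem _ h2 h4)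
  refine (congrArg (component n {0}) (br_add_add a u a' u')).trans ?_
  exact (LinearMap.map_add _ _ _).trans ((congrArg₂ (· + ·) (component_of_mem h1) (hpos h5)).trans
    (add_zero _))

theorem component_zero_br (x y : Queer n) :
    component n {0} (br (component n (Set.Ici 0) x) (component n (Set.Ici 0) y))
      = br (component n {0} (component n (Set.Ici 0) x))
        (component n {0} (component n (Set.Ici 0) y)) := by
  have h0 : ∀ z : Queer n, component n {0} (component n (Set.Ici 0) z) = component n {0} z := by
    intro z
    rw [component_component]; simp
  rw [h0, h0, component_Ici_eq, component_Ici_eq n y]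
  exact component_zero_br_add n (component_mem _ x) (component_mem _ y) (component_mem _ x)
    (component_mem _ y)

theorem cartanProj_br (x y : Queer n) :
    cartanProj n (br (component n (Set.Ici 0) x) (component n (Set.Ici 0) y))
      = br (cartanProj n (component n (Set.Ici 0) x)) (cartanProj n (component n (Set.Ici 0) y)) :=
  Subtype.ext (component_zero_br n x y)

variable {n} in
theorem cartan_mem_supported (z : cartan n) : (z : Queer n) ∈ supported n {0} :=
  cartan_eq_supported (n := n) ▸ z.2

variable {n} in
theorem nPlus_mem_supported (z : nPlus n) : (z : Queer n) ∈ supported n (Set.Ioi 0) :=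
  nPlus_eq_supported (n := n) ▸ z.2

theorem rTensor_parity {g h : Type*} [AddCommGroup g] [Module ℂ g] [LieSuperalgebra g]
    [AddCommGroup h] [Module ℂ h] [LieSuperalgebra h] {f : g →ₗ[ℂ] h}
    (hf : ∀ x, f (parity x) = parity (f x)) (x : g ⊗[ℂ] A) :
    f.rTensor A (parity x) = parity (f.rTensor A x) := by
  induction x using TensorProduct.induction_on with
  | zero => simp
  | tmul x a => exact congrArg (· ⊗ₜ[ℂ] a) (hf x)
  | add x y hx hy => simp only [map_add, hx, hy]

/-- The map f need only respect brackets on the image of q. Tensored with A, that becomes a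
condition on the elements fixed by q ⊗ 1, which for b ⊗ A is provided by `rTensor_component_Ici`. -/
theorem rTensor_br {g h : Type*} [AddCommGroup g] [Module ℂ g] [LieSuperalgebra g]
    [AddCommGroup h] [Module ℂ h] [LieSuperalgebra h] {f : g →ₗ[ℂ] h} {q : g →ₗ[ℂ] g}
    (hf : ∀ x y, f (br (q x) (q y)) = br (f (q x)) (f (q y))) {x y : g ⊗[ℂ] A}
    (hx : q.rTensor A x = x) (hy : q.rTensor A y = y) :
    f.rTensor A (br x y) = br (f.rTensor A x) (f.rTensor A y) := by
  rw [← hx, ← hy]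
  refine tensor_hom_ext₂ A (f := (br.compl₁₂ (q.rTensor A) (q.rTensor A)).compr₂ (f.rTensor A))
    (f' := br.compl₁₂ (f.rTensor A ∘ₗ q.rTensor A) (f.rTensor A ∘ₗ q.rTensor A)) ?_ x y
  intro x a y b
  exact congrArg (· ⊗ₜ[ℂ] (a * b)) (hf x y)

/-- The decomposition of `q(n) ⊗ A` into `n⁻ ⊗ A` and `b ⊗ A`. -/
def queerSplitting : Splitting (Queer n ⊗[ℂ] A) where
  p := (component n (Set.Iio 0)).rTensor A
  idem x := by
    rw [← LinearMap.comp_apply, ← LinearMap.rTensor_comp]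
    congr 2
    exact LinearMap.ext fun z => component_of_mem (component_mem _ z)
  p_parity x := by
    induction x using TensorProduct.induction_on with
    | zero => simp
    | tmul x a =>
      rw [parity_tmul, LinearMap.rTensor_tmul, LinearMap.rTensor_tmul, parity_tmul,
        component_parity]
    | add x y hx hy => simp only [map_add, hx, hy]
  br_left := by
    refine tensor_hom_ext₂ A
      (f := (br.compl₁₂ _ _).compr₂ ((component n (Set.Iio 0)).rTensor A)) (f' := br.compl₁₂ _ _) ?_
    intro x a y b
    simp only [LinearMap.compr₂_apply, LinearMap.compl₁₂_apply, LinearMap.rTensor_tmul, br_tmul]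
    rw [component_of_mem (br_mem_supported (fun k hk l hl => ?_) (component_mem _ x)
      (component_mem _ y))]
    simp only [Set.mem_Iio] at *
    omega
  br_right := by
    refine tensor_hom_ext₂ A
      (f := (br.compl₁₂ (LinearMap.id - _) (LinearMap.id - _)).compr₂
        ((component n (Set.Iio 0)).rTensor A)) (f' := 0) ?_
    intro x a y b
    simp only [LinearMap.compr₂_apply, LinearMap.compl₁₂_apply, LinearMap.rTensor_tmul,
      LinearMap.sub_apply, LinearMap.id_apply, ← TensorProduct.sub_tmul, br_tmul, component_Ici,
      LinearMap.zero_apply]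
    rw [component_of_disjoint (L := Set.Ici 0) (br_mem_supported (fun k hk l hl => ?_)
      (component_mem _ x) (component_mem _ y)) (by simp), TensorProduct.zero_tmul]
    simp only [Set.mem_Ici] at *
    omega

/-- The projection `q(n) ⊗ A → h ⊗ A`. -/
def cartanMapProj : Queer n ⊗[ℂ] A →ₗ[ℂ] cartan n ⊗[ℂ] A := (cartanProj n).rTensor A

theorem rTensor_component_Ici {x : Queer n ⊗[ℂ] A} (hx : (queerSplitting n A).p x = 0) :
    (component n (Set.Ici 0)).rTensor A x = x := by
  have : (component n (Set.Ici 0)).rTensor A x = x - (queerSplitting n A).p x := by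
    change _ = (LinearMap.id - (component n (Set.Iio 0)).rTensor A : _ →ₗ[ℂ] _) x
    rw [← LinearMap.rTensor_id, ← LinearMap.rTensor_sub]
    congr 2
    exact LinearMap.ext fun z => (component_Ici n z).symm
  rw [this, hx, sub_zero]

theorem cartanMapProj_mapIncl (z : cartan n ⊗[ℂ] A) :
    cartanMapProj n A (((cartan n).mapIncl A).toLin z) = z := by
  change ((cartanProj n).rTensor A) ((cartan n).toSubmodule.subtype.rTensor A z) = z
  rw [← LinearMap.comp_apply, ← LinearMap.rTensor_comp,
    show cartanProj n ∘ₗ (cartan n).toSubmodule.subtype = LinearMap.id from ?_,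
    LinearMap.rTensor_id, LinearMap.id_apply]
  exact LinearMap.ext fun z => Subtype.ext (component_of_mem (cartan_mem_supported z))

theorem splitting_mapIncl (z : cartan n ⊗[ℂ] A) :
    (queerSplitting n A).p (((cartan n).mapIncl A).toLin z) = 0 := by
  change ((component n (Set.Iio 0)).rTensor A) ((cartan n).toSubmodule.subtype.rTensor A z) = 0
  rw [← LinearMap.comp_apply, ← LinearMap.rTensor_comp,
    show component n (Set.Iio 0) ∘ₗ (cartan n).toSubmodule.subtype = 0 from ?_,
    LinearMap.rTensor_zero, LinearMap.zero_apply]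
  exact LinearMap.ext fun z => component_of_disjoint (cartan_mem_supported z) (by simp)

variable {n A}

theorem splitting_nPlusMap {y : Queer n ⊗[ℂ] A} (hy : y ∈ nPlusMap n A) :
    (queerSplitting n A).p y = 0 := by
  obtain ⟨y, rfl⟩ := hy
  change ((component n (Set.Iio 0)).rTensor A) ((nPlus n).subtype.rTensor A y) = 0
  rw [← LinearMap.comp_apply, ← LinearMap.rTensor_comp,
    show component n (Set.Iio 0) ∘ₗ (nPlus n).subtype = 0 from ?_,
    LinearMap.rTensor_zero, LinearMap.zero_apply]
  exact LinearMap.ext fun z => component_of_disjoint (nPlus_mem_supported z)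
    (Set.disjoint_left.2 fun a h h' => lt_asymm (Set.mem_Iio.1 h) (Set.mem_Ioi.1 h'))

theorem cartanMapProj_nPlusMap {y : Queer n ⊗[ℂ] A} (hy : y ∈ nPlusMap n A) :
    cartanMapProj n A y = 0 := by
  obtain ⟨y, rfl⟩ := hy
  change ((cartanProj n).rTensor A) ((nPlus n).subtype.rTensor A y) = 0
  rw [← LinearMap.comp_apply, ← LinearMap.rTensor_comp,
    show cartanProj n ∘ₗ (nPlus n).subtype = 0 from ?_,
    LinearMap.rTensor_zero, LinearMap.zero_apply]
  exact LinearMap.ext fun z => Subtype.ext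
    (component_of_disjoint (nPlus_mem_supported z) (by simp))

theorem exists_decomposition (x : Queer n ⊗[ℂ] A) : ∃ (z : cartan n ⊗[ℂ] A), ∃ y ∈ nPlusMap n A,
    x = (queerSplitting n A).p x + ((cartan n).mapIncl A).toLin z + y := by
  induction x using TensorProduct.induction_on with
  | zero => exact ⟨0, 0, Submodule.zero_mem _, by simp⟩
  | add x x' hx hx' =>
    obtain ⟨z, y, hy, h⟩ := hx
    obtain ⟨z', y', hy', h'⟩ := hx'
    refine ⟨z + z', y + y', Submodule.add_mem _ hy hy', ?_⟩
    conv_lhs => rw [h, h']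
    simp only [map_add]
    abel
  | tmul x a =>
    refine ⟨cartanProj n x ⊗ₜ a, component n (Set.Ioi 0) x ⊗ₜ a, ⟨(⟨_, nPlus_eq_supported (n := n) ▸
      component_mem _ x⟩ : nPlus n) ⊗ₜ a, rfl⟩, ?_⟩
    change x ⊗ₜ a = component n (Set.Iio 0) x ⊗ₜ a + component n {0} x ⊗ₜ a
      + component n (Set.Ioi 0) x ⊗ₜ[ℂ] a
    rw [← TensorProduct.add_tmul, ← TensorProduct.add_tmul, add_assoc, ← component_Ici_eq,
      ← component_Ici, add_sub_cancel]

theorem splitting_exists_add (x : Queer n ⊗[ℂ] A) : ∃ (z : cartan n ⊗[ℂ] A), ∃ y ∈ nPlusMap n A,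
    (queerSplitting n A).q x = ((cartan n).mapIncl A).toLin z + y := by
  obtain ⟨z, y, hy, h⟩ := exists_decomposition x
  refine ⟨z, y, hy, ?_⟩
  rw [Splitting.q_apply, sub_eq_iff_eq_add', ← add_assoc]
  exact h

variable (n A) in
/-- The inclusion `h₀ ⊗ A → q(n) ⊗ A`. -/
def evenIncl : cartanEven n ⊗[ℂ] A →ₗ[ℂ] Queer n ⊗[ℂ] A :=
  ((cartan n).mapIncl A).toLin ∘ₗ (cartanEven n).subtype.rTensor A

variable (n A) in
/-- The grading element of `h₀ ⊗ A`. -/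
def gradingMap : cartanEven n ⊗[ℂ] A := gradingElement n ⊗ₜ 1

theorem rTensor_subtype_mem_homog (z : cartanEven n ⊗[ℂ] A) :
    (cartanEven n).subtype.rTensor A z ∈ homog (cartan n ⊗[ℂ] A) 0 := by
  induction z using TensorProduct.induction_on with
  | zero => rw [map_zero]; exact Submodule.zero_mem _
  | tmul x a =>
    rw [LinearMap.rTensor_tmul, mem_homog, parity_tmul, Submodule.subtype_apply, mem_homog.1 x.2]
    simp
  | add x y hx hy => rw [map_add]; exact Submodule.add_mem _ hx hy

theorem br_evenIncl_gradingMap {k : ℤ} {z : Queer n} (hz : z ∈ supported n {k}) (a : A) :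
    br (evenIncl n A (gradingMap n A)) (z ⊗ₜ[ℂ] a) = (k : ℂ) • (z ⊗ₜ[ℂ] a) := by
  change br ((gradingElement n : cartan n) : Queer n) z ⊗ₜ[ℂ] (1 * a) = _
  rw [br_gradingElement hz, one_mul, TensorProduct.smul_tmul']

/-- The sequence `e` enumerates the eigenvalues by natural numbers; it is m ↦ -(m + 1) for n⁻ and m
↦ m + 1 for n⁺. -/
theorem tmul_mem_iSup_eigenspace {K : Set ℤ} {e : ℕ → ℂ}
    (he : ∀ k ∈ K, ∃ m, e m = k) {z : Queer n} (hz : z ∈ supported n K) (a : A) :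
    z ⊗ₜ[ℂ] a ∈ ⨆ m, Module.End.eigenspace (br (evenIncl n A (gradingMap n A))) (e m) := by
  let S := ⨆ m, Module.End.eigenspace (br (evenIncl n A (gradingMap n A))) (e m)
  have : supported n K ≤ S.comap ((TensorProduct.mk ℂ (Queer n) A).flip a) := by
    refine (supported_le K).trans (iSup₂_le fun k hk z hz => ?_)
    obtain ⟨m, hm⟩ := he k hk
    refine Submodule.mem_iSup_of_mem m (Module.End.mem_eigenspace_iff.2 ?_)
    rw [hm]
    exact br_evenIncl_gradingMap hz a
  exact this hz

theorem splitting_mem_iSup (x : Queer n ⊗[ℂ] A) : (queerSplitting n A).p x ∈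
    ⨆ m : ℕ, Module.End.eigenspace (br (evenIncl n A (gradingMap n A))) (-(m + 1) : ℂ) := by
  induction x using TensorProduct.induction_on with
  | zero => rw [map_zero]; exact Submodule.zero_mem _
  | tmul x a =>
    refine tmul_mem_iSup_eigenspace (K := Set.Iio 0) (fun k hk => ⟨(-k - 1).toNat, ?_⟩)
      (component_mem _ x) a
    have h1 : (((-k - 1).toNat : ℤ) : ℂ) = ((-k - 1 : ℤ) : ℂ) := by
      rw [Int.toNat_of_nonneg]
      rw [Set.mem_Iio] at hk; omega
    rw [Int.cast_natCast] at h1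
    rw [h1]; push_cast; ring
  | add x y hx hy => rw [map_add]; exact Submodule.add_mem _ hx hy

theorem nPlusMap_le_iSup : nPlusMap n A ≤
    ⨆ m : ℕ, Module.End.eigenspace (br (evenIncl n A (gradingMap n A))) (m + 1 : ℂ) := by
  rintro _ ⟨x, rfl⟩
  induction x using TensorProduct.induction_on with
  | zero => rw [map_zero]; exact Submodule.zero_mem _
  | tmul x a =>
    refine tmul_mem_iSup_eigenspace (K := Set.Ioi 0) (fun k hk => ⟨(k - 1).toNat, ?_⟩)
      (nPlus_mem_supported x) a
    have h1 : (((k - 1).toNat : ℤ) : ℂ) = ((k - 1 : ℤ) : ℂ) := by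
      rw [Int.toNat_of_nonneg]
      rw [Set.mem_Ioi] at hk; omega
    rw [Int.cast_natCast] at h1
    rw [h1]; push_cast; ring
  | add x y hx hy => rw [map_add]; exact Submodule.add_mem _ hx hy

end Triangular

/-! ### Highest weight modules -/

namespace SuperModule

section

variable {g : Type u} [AddCommGroup g] [Module ℂ g] [LieSuperalgebra g]

theorem act_br_even (M : SuperModule.{u, v} g) {δ : g} (hδ : δ ∈ homog g 0) (y : g) (v : M) :
    M.act (br δ y) v = M.act δ (M.act y v) - M.act y (M.act δ v) := by
  have h0 := M.act_br 0 0 δ _ hδ (evenProj_mem y) v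
  have h1 := M.act_br 0 1 δ _ hδ (oddProj_mem y) v
  rw [zero_mul, sgn_zero, one_smul] at h0 h1
  rw [← evenProj_add_oddProj y]
  simp only [map_add, LinearMap.add_apply, h0, h1]
  abel

theorem act_mem_eigenspace (M : SuperModule.{u, v} g) {δ y : g} (hδ : δ ∈ homog g 0) {c e : ℂ}
    (hy : y ∈ Module.End.eigenspace (br δ) c) {v : M} (hv : v ∈ (M.act δ).eigenspace e) :
    M.act y v ∈ (M.act δ).eigenspace (e + c) := by
  rw [Module.End.mem_eigenspace_iff] at *
  have h := M.act_br_even hδ y v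
  rw [hy, hv, map_smul, map_smul, LinearMap.smul_apply, eq_sub_iff_add_eq] at h
  rw [← h, add_smul, add_comm]

/-- A drop by m + 1 sends eigenvalue c to c - (m + 1), and c - (k + 1) to c - ((k + m + 1) + 1). -/
theorem act_mem_lowerPart (M : SuperModule.{u, v} g) {δ y : g} (hδ : δ ∈ homog g 0)
    (hy : y ∈ ⨆ m : ℕ, Module.End.eigenspace (br δ) (-(m + 1) : ℂ)) {c : ℂ} {v : M}
    (hv : v ∈ (M.act δ).eigenspace c ⊔ lowerPart (M.act δ) c) :
    M.act y v ∈ lowerPart (M.act δ) c := by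
  induction hy using Submodule.iSup_induction' with
  | zero => rw [map_zero]; exact Submodule.zero_mem _
  | add y y' _ _ hy hy' => rw [map_add]; exact Submodule.add_mem _ hy hy'
  | mem m y hy =>
    obtain ⟨t, ht, s, hs, rfl⟩ := Submodule.mem_sup.1 hv
    rw [map_add]
    refine Submodule.add_mem _ ?_ ?_
    · refine eigenspace_le_lowerPart _ c m ?_
      rw [sub_eq_add_neg]
      exact M.act_mem_eigenspace hδ hy ht
    · have : lowerPart (M.act δ) c ≤ (lowerPart (M.act δ) c).comap (M.act y) := by
        refine iSup_le fun k s hs => eigenspace_le_lowerPart _ c (k + m + 1) ?_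
        have h := M.act_mem_eigenspace hδ hy hs
        rwa [show c - (k + 1) + -(m + 1) = c - (((k + m + 1 : ℕ) : ℂ) + 1) by push_cast; ring] at h
      exact this hs

/-- Plays the role of U(g)T = U(a)U(b)T: if T is b-stable and generates the module over g, it
already generates it over a. -/
theorem eq_top_of_splitting (S : Splitting g) (M : SuperModule.{u, v} g) {T W : Submodule ℂ M}
    (hq : ∀ x, ∀ t ∈ T, M.act (S.q x) t ∈ T)
    (hgen : ∀ W : Submodule ℂ M, (∀ x, ∀ v ∈ W, M.act x v ∈ W) → T ≤ W → W = ⊤) (hT : T ≤ W)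
    (hW : ∀ x, ∀ v ∈ W, M.act (S.p x) v ∈ W) : W = ⊤ := by
  let F : Set (Submodule ℂ M) := {W | T ≤ W ∧ ∀ x, ∀ v ∈ W, M.act (S.p x) v ∈ W}
  have hF : T ≤ sInf F ∧ ∀ x, ∀ v ∈ sInf F, M.act (S.p x) v ∈ sInf F := by
    refine ⟨le_sInf fun W hW => hW.1, fun x v hv => ?_⟩
    rw [Submodule.mem_sInf] at *
    exact fun W hW => hW.2 x v (hv W hW)
  -- Let F₀ be the smallest a-stable subspace containing T. The vectors of F₀ that g sends into F₀
  -- contain T and form an a-stable subspace, so they exhaust F₀, which is therefore g-stable.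
  let R : Submodule ℂ M :=
    { carrier := {v | v ∈ sInf F ∧ ∀ x, M.act x v ∈ sInf F}
      zero_mem' := ⟨Submodule.zero_mem _, fun x => by rw [map_zero]; exact Submodule.zero_mem _⟩
      add_mem' := fun {v w} hv hw => ⟨Submodule.add_mem _ hv.1 hw.1, fun x => by
        rw [map_add]; exact Submodule.add_mem _ (hv.2 x) (hw.2 x)⟩
      smul_mem' := fun c v hv => ⟨Submodule.smul_mem _ c hv.1, fun x => by
        rw [map_smul]; exact Submodule.smul_mem _ c (hv.2 x)⟩ }
  have hR : sInf F ≤ R := by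
    refine sInf_le ⟨fun t ht => ⟨hF.1 ht, fun x => ?_⟩, fun x v hv => ⟨hF.2 x v hv.1, fun y => ?_⟩⟩
    · rw [← S.p_add_q x, map_add, LinearMap.add_apply]
      exact Submodule.add_mem _ (hF.2 x t (hF.1 ht)) (hF.1 (hq x t ht))
    -- For a in the subalgebra, y(av) = [y, a]v ± a(yv), and both terms lie in F₀ when v does
    -- together with gv.
    · have key : ∀ i j, ∀ x ∈ homog g i, ∀ y ∈ homog g j, M.act y (M.act (S.p x) v) ∈ sInf F := by
        intro i j x hx y hy
        have h := M.act_br j i y _ hy (S.p_mem_homog hx) v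
        rw [eq_sub_iff_add_eq] at h
        rw [← h]
        exact Submodule.add_mem _ (hv.2 _) (Submodule.smul_mem _ _ (hF.2 x _ (hv.2 y)))
      rw [← evenProj_add_oddProj x, ← evenProj_add_oddProj y]
      simp only [map_add, LinearMap.add_apply]
      exact Submodule.add_mem _
        (Submodule.add_mem _ (key 0 0 _ (evenProj_mem x) _ (evenProj_mem y))
          (key 0 1 _ (evenProj_mem x) _ (oddProj_mem y)))
        (Submodule.add_mem _ (key 1 0 _ (oddProj_mem x) _ (evenProj_mem y))
          (key 1 1 _ (oddProj_mem x) _ (oddProj_mem y)))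
  have htop := hgen (sInf F) (fun x v hv => (hR hv).2 x) hF.1
  rw [← top_le_iff, ← htop]
  exact sInf_le ⟨hT, hW⟩

theorem isIrreducible_quot_maxSub (M : SuperModule.{u, v} g) (h : M.maxSub ≠ ⊤) :
    (M.quot M.maxSub M.isSub_maxSub).IsIrreducible := by
  refine ⟨Submodule.Quotient.nontrivial_iff.2 h, fun W hW => ?_⟩
  let P : Submodule ℂ M := Submodule.comap M.maxSub.mkQ W
  have hP : M.IsSub P := ⟨fun v hv => hW.1 _ hv, fun x v hv => hW.2 x _ hv⟩
  by_cases htop : P = ⊤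
  · right
    refine (Submodule.eq_top_iff').2 fun w => ?_
    obtain ⟨v, rfl⟩ := M.maxSub.mkQ_surjective w
    exact (htop ▸ Submodule.mem_top : v ∈ P)
  · left
    refine (Submodule.eq_bot_iff _).2 fun w hw => ?_
    obtain ⟨v, rfl⟩ := M.maxSub.mkQ_surjective w
    exact (Submodule.Quotient.mk_eq_zero _).2
      ((le_sSup ⟨hP, htop⟩ : P ≤ M.maxSub) (hw : v ∈ P))

end

end SuperModule

/-- A triangular decomposition `g = n⁻ ⊕ h ⊕ n⁺`, where `h₀` is the image of `i`, and where `n⁻`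
(`n⁺`) is spanned by eigenvectors of `ad (i d)` for negative (positive) integral eigenvalues. -/
structure Triangular (g : Type u) [AddCommGroup g] [Module ℂ g] [LieSuperalgebra g] (h : Type w)
    [AddCommGroup h] [Module ℂ h] [LieSuperalgebra h] (C : Type*) [AddCommMonoid C]
    [Module ℂ C] where
  incl : LieSuperHom h g
  nPlus : Submodule ℂ g
  parity_mem : ∀ y ∈ nPlus, parity y ∈ nPlus
  splitting : Splitting g
  proj : g →ₗ[ℂ] h
  proj_parity : ∀ x, proj (parity x) = parity (proj x)
  proj_br : ∀ x y, splitting.p x = 0 → splitting.p y = 0 → proj (br x y) = br (proj x) (proj y)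
  proj_incl : ∀ z, proj (incl.toLin z) = z
  proj_nPlus : ∀ y ∈ nPlus, proj y = 0
  splitting_incl : ∀ z, splitting.p (incl.toLin z) = 0
  splitting_nPlus : ∀ y ∈ nPlus, splitting.p y = 0
  exists_add : ∀ x, ∃ z, ∃ y ∈ nPlus, splitting.q x = incl.toLin z + y
  i : C →ₗ[ℂ] h
  i_mem : ∀ z, i z ∈ homog h 0
  exists_i : ∀ x ∈ homog h 0, ∃ z, i z = x
  d : C
  br_d : ∀ z, br (i d) z = 0
  splitting_mem : ∀ x, splitting.p x ∈
    ⨆ m : ℕ, Module.End.eigenspace (br (incl.toLin (i d))) (-(m + 1) : ℂ)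
  nPlus_le : nPlus ≤ ⨆ m : ℕ, Module.End.eigenspace (br (incl.toLin (i d))) (m + 1 : ℂ)

/-- `H` is an irreducible finite-dimensional `h`-module on which `i z` acts as the scalar `ψ z`. -/
structure IsScalarModule {h : Type w} [AddCommGroup h] [Module ℂ h] [LieSuperalgebra h] {C : Type*}
    [AddCommMonoid C] [Module ℂ C] (i : C →ₗ[ℂ] h) (ψ : Module.Dual ℂ C)
    (H : SuperModule.{w, v} h) : Prop where
  irreducible : H.IsIrreducible
  finite : FiniteDimensional ℂ H
  act_even : ∀ z (v : H), H.act (i z) v = ψ z • v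

/-! ### Verma modules of a triangular decomposition and their simple quotients. -/

namespace Triangular

open SuperModule

variable {g : Type u} [AddCommGroup g] [Module ℂ g] [LieSuperalgebra g]
variable {h : Type w} [AddCommGroup h] [Module ℂ h] [LieSuperalgebra h]
variable {C : Type*} [AddCommMonoid C] [Module ℂ C] (D : Triangular g h C)

/-- The inclusion `h₀ → g`. -/
def j : C →ₗ[ℂ] g := D.incl.toLin ∘ₗ D.i

theorem j_apply (z : C) : D.j z = D.incl.toLin (D.i z) := rfl

theorem j_mem (z : C) : D.j z ∈ homog g 0 := by
  have := D.i_mem z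
  rw [mem_homog] at *
  rw [j_apply, ← D.incl.map_parity, this, map_smul]

variable {D} {ψ : Module.Dual ℂ C}

/-- T is stable under h and n⁺, and adding the lower eigenspaces makes the sum stable under n⁻,
which lowers eigenvalues. `eq_top_of_splitting` then shows that the sum is everything. -/
theorem isTop_of_generated {M : SuperModule.{u, v} g} {T : Submodule ℂ M} (h0 : T ≠ ⊥)
    (heven : ∀ z, ∀ t ∈ T, M.act (D.j z) t = ψ z • t)
    (hcart : ∀ z, ∀ t ∈ T, M.act (D.incl.toLin z) t ∈ T)
    (hn : ∀ y ∈ D.nPlus, ∀ t ∈ T, M.act y t = 0)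
    (hgen : ∀ W : Submodule ℂ M, (∀ x, ∀ v ∈ W, M.act x v ∈ W) → T ≤ W → W = ⊤) :
    M.IsTop D.j D.d ψ T := by
  have hq : ∀ x, ∀ t ∈ T, M.act (D.splitting.q x) t ∈ T := by
    intro x t ht
    obtain ⟨z, y, hy, h⟩ := D.exists_add x
    rw [h, map_add, LinearMap.add_apply, hn y hy t ht, add_zero]
    exact hcart z t ht
  refine ⟨h0, heven, eq_top_of_splitting D.splitting M hq hgen le_sup_left fun x v hv => ?_⟩
  refine (le_sup_right : _ ≤ T ⊔ _) (M.act_mem_lowerPart (D.j_mem _) (D.splitting_mem x)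
    ((sup_le_sup_right (fun t ht => ?_) _ : T ⊔ lowerPart (M.act (D.j D.d)) (ψ D.d) ≤ _) hv))
  exact Module.End.mem_eigenspace_iff.2 (heven _ t ht)

/-- n⁺ raises eigenvalues of d by positive integers, above ψ(d), where no eigenvectors exist. -/
theorem act_nPlus_eq_zero {X : SuperModule.{u, v} g} {T : Submodule ℂ X}
    (h : X.IsTop D.j D.d ψ T) {y : g} (hy : y ∈ D.nPlus) {t : X} (ht : t ∈ T) :
    X.act y t = 0 := by
  replace hy := D.nPlus_le hy
  induction hy using Submodule.iSup_induction' with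
  | zero => rw [map_zero]; rfl
  | add y y' _ _ hy hy' => rw [map_add, LinearMap.add_apply, hy, hy', add_zero]
  | mem m y hy =>
    have := X.act_mem_eigenspace (D.j_mem D.d) hy (h.eq_eigenspace ▸ ht)
    rwa [h.eigenspace_eq_bot m, Submodule.mem_bot] at this

variable (D) in
/-- The generalized Verma module. -/
abbrev verma (H : SuperModule.{w, v} h) : SuperModule.{u, max u v} g :=
  induced D.incl D.nPlus D.parity_mem H

variable (D) in
/-- The canonical map from `H` to its Verma module. -/
abbrev vermaTop (H : SuperModule.{w, v} h) : H →ₗ[ℂ] D.verma H :=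
  inducedTop D.incl D.nPlus D.parity_mem H

variable (D) in
/-- The quotient of the Verma module by its largest proper submodule. -/
abbrev simple (H : SuperModule.{w, v} h) : SuperModule.{u, max u v} g :=
  (D.verma H).quot (D.verma H).maxSub (D.verma H).isSub_maxSub

variable (H : SuperModule.{w, v} h)

variable (D) in
-- The embedding of H into U(n⁻) ⊗ H factors through the Verma module.
theorem vermaTop_injective : Function.Injective (D.vermaTop H) := by
  obtain ⟨X, f, hf, hfp, hfx⟩ := D.splitting.exists_injective H D.proj_br D.proj_parity
  obtain ⟨Φ, -, -, hΦ⟩ := exists_induced_lift D.incl D.nPlus D.parity_mem H X f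
    (fun x m => by rw [hfx _ (D.splitting_incl x), D.proj_incl])
    (fun y hy m => by
      rw [hfx _ (D.splitting_nPlus y hy), D.proj_nPlus y hy, map_zero, LinearMap.zero_apply,
        map_zero]) hfp
  intro m m' h
  exact hf ((hΦ m).symm.trans ((congrArg Φ h).trans (hΦ m')))

theorem vermaTop_generates (W : Submodule ℂ (D.verma H))
    (hW : ∀ x, ∀ v ∈ W, (D.verma H).act x v ∈ W) (hT : LinearMap.range (D.vermaTop H) ≤ W) :
    W = ⊤ :=
  induced_eq_top _ _ _ _ hW fun m => hT ⟨m, rfl⟩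

variable {H}

theorem isTop_verma (hH : IsScalarModule D.i ψ H) : (D.verma H).IsTop D.j D.d ψ (LinearMap.range (D.vermaTop H)) := by
  have := hH.irreducible.1
  refine isTop_of_generated ?_ ?_ ?_ ?_ (vermaTop_generates H)
  · intro h
    obtain ⟨m, hm⟩ := exists_ne (0 : H)
    refine hm (D.vermaTop_injective H ?_)
    rw [map_zero]
    exact (Submodule.mem_bot ℂ).1 (h ▸ ⟨m, rfl⟩)
  · rintro z _ ⟨m, rfl⟩
    rw [j_apply, inducedTop_act, hH.act_even, map_smul]
  · rintro z _ ⟨m, rfl⟩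
    exact ⟨_, (inducedTop_act _ _ D.parity_mem _ z m).symm⟩
  · rintro y hy _ ⟨m, rfl⟩
    exact inducedTop_act_zero _ _ _ _ hy m

/-- A proper graded submodule meets H in zero, since H is irreducible and generates the Verma
module. The top component of any of its vectors again lies in it, so is zero. Lying in the lower
part is inherited by sums, so the largest proper submodule is proper too. -/
theorem maxSub_verma_le (hH : IsScalarModule D.i ψ H) :
    (D.verma H).maxSub ≤ lowerPart ((D.verma H).act (D.j D.d)) (ψ D.d) := by
  have htop := isTop_verma hH
  refine sSup_le fun P hP v hv => ?_
  have hbot : P.comap (D.vermaTop H) = ⊥ := by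
    refine (hH.irreducible.2 (P.comap (D.vermaTop H)) ⟨fun m hm => ?_, fun z m hm => ?_⟩).resolve_right
      fun h => hP.2 (vermaTop_generates H P hP.1.2 ?_)
    · rw [Submodule.mem_comap, inducedTop_parity]
      exact hP.1.1 _ hm
    · rw [Submodule.mem_comap, ← inducedTop_act]
      exact hP.1.2 _ _ hm
    · rintro _ ⟨m, rfl⟩
      exact (h ▸ Submodule.mem_top : m ∈ P.comap (D.vermaTop H))
  obtain ⟨t, ht, s, hs, rfl⟩ := Submodule.mem_sup.1 (htop.2.2 ▸ Submodule.mem_top :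
    v ∈ LinearMap.range (D.vermaTop H) ⊔ lowerPart ((D.verma H).act (D.j D.d)) (ψ D.d))
  have htP := top_component_mem (hP.1.2 _) (htop.2.1 _ t ht) hs hv
  obtain ⟨m, rfl⟩ := ht
  have hm : m ∈ P.comap (D.vermaTop H) := htP
  rw [hbot, Submodule.mem_bot] at hm
  rw [hm, map_zero, zero_add]
  exact hs

theorem vermaTop_notMem_maxSub (hH : IsScalarModule D.i ψ H) {m : H} (hm : m ≠ 0) :
    D.vermaTop H m ∉ (D.verma H).maxSub := fun h => by
  have h1 := maxSub_verma_le hH h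
  have h2 := Module.End.mem_eigenspace_iff.2 ((isTop_verma hH).2.1 D.d _ ⟨m, rfl⟩)
  have h3 := (Submodule.disjoint_def.1 (disjoint_eigenspace_lowerPart _ _)) _ h2 h1
  exact hm (D.vermaTop_injective H (h3.trans (map_zero _).symm))

theorem isIrreducible_simple (hH : IsScalarModule D.i ψ H) : (D.simple H).IsIrreducible := by
  have := hH.irreducible.1
  obtain ⟨m, hm⟩ := exists_ne (0 : H)
  refine isIrreducible_quot_maxSub _ fun h => vermaTop_notMem_maxSub hH hm ?_
  rw [h]
  exact Submodule.mem_top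

theorem hasTop_simple (hH : IsScalarModule D.i ψ H) : (D.simple H).HasTop D.j D.d ψ := by
  have := hH.irreducible.1
  obtain ⟨m, hm⟩ := exists_ne (0 : H)
  refine ⟨_, (isTop_verma hH).map (f := (D.verma H).maxSub.mkQ) (Y := D.simple H)
    (fun _ _ => rfl) (Submodule.mkQ_surjective _) fun h => vermaTop_notMem_maxSub hH hm ?_⟩
  rw [← Submodule.Quotient.mk_eq_zero]
  exact (Submodule.mem_bot ℂ).1 (h ▸ ⟨_, ⟨m, rfl⟩, rfl⟩)

end Triangular

/-! ### Uniqueness of irreducible modules with a top weight space -/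

/-- Two representations of the Clifford relations by operators that anticommute with an involution
have a nonzero intertwiner. -/
theorem exists_clifford_intertwiner {O V W : Type*} [AddCommGroup O] [Module ℂ O]
    [FiniteDimensional ℂ O] [AddCommGroup V] [Module ℂ V] [Nontrivial V] [AddCommGroup W]
    [Module ℂ W] [Nontrivial W] (B : LinearMap.BilinForm ℂ O) (hB : LinearMap.IsSymm B)
    (a : O →ₗ[ℂ] Module.End ℂ V) (b : O →ₗ[ℂ] Module.End ℂ W) (P : Module.End ℂ V)
    (hPP : ∀ v, P (P v) = v) (hP : ∀ o v, P (a o v) = -a o (P v))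
    (ha : ∀ o p v, a o (a p v) + a p (a o v) = B o p • v)
    (hb : ∀ o p w, b o (b p w) + b p (b o w) = B o p • w)
    (hrad : ∀ o, (∀ p, B o p = 0) → a o = 0 ∧ b o = 0) :
    ∃ T : V →ₗ[ℂ] W, T ≠ 0 ∧ ∀ o v, T (a o v) = b o (T v) := by
  -- In an orthogonal basis distinct generators anticommute, so the basis vectors can be intertwined
  -- one at a time, starting from any nonzero map.
  obtain ⟨e, he⟩ := LinearMap.BilinForm.exists_orthogonal_basis hB
  suffices h : ∀ s : Finset (Fin (Module.finrank ℂ O)), ∃ T : V →ₗ[ℂ] W, T ≠ 0 ∧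
      ∀ k ∈ s, ∀ v, T (a (e k) v) = b (e k) (T v) by
    obtain ⟨T, h0, hT⟩ := h Finset.univ
    refine ⟨T, h0, fun o v => ?_⟩
    have : (LinearMap.llcomp ℂ V V W T) ∘ₗ a = (LinearMap.lcomp ℂ W T) ∘ₗ b :=
      e.ext fun k => LinearMap.ext fun v => hT k (Finset.mem_univ k) v
    exact LinearMap.congr_fun (LinearMap.congr_fun this o) v
  intro s
  induction s using Finset.induction_on with
  | empty =>
    obtain ⟨v, hv⟩ := exists_ne (0 : V)
    obtain ⟨w, hw⟩ := exists_ne (0 : W)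
    obtain ⟨f, hf⟩ : ∃ f : Module.Dual ℂ V, f v ≠ 0 := by
      by_contra! h
      exact hv ((Module.forall_dual_apply_eq_zero_iff ℂ v).1 h)
    refine ⟨f.smulRight w, fun h => ?_, by simp⟩
    have := LinearMap.congr_fun h v
    simp [hf, hw] at this
  | insert k s hk ih =>
    obtain ⟨T, hT0, hT⟩ := ih
    -- A basis vector of norm zero is orthogonal to the whole basis, hence in the radical, and acts
    -- by zero on both sides.
    by_cases hc : B (e k) (e k) = 0
    · have h0 : B (e k) = 0 := e.ext fun l => by
        by_cases hl : k = l
        · rw [← hl, hc]; rfl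
        · exact he hl
      obtain ⟨h1, h2⟩ := hrad (e k) fun p => by rw [h0]; rfl
      refine ⟨T, hT0, fun l hl v => ?_⟩
      rcases Finset.mem_insert.1 hl with rfl | hl
      · rw [h1, h2, LinearMap.zero_apply, LinearMap.zero_apply, map_zero]
      · exact hT l hl v
    · have ha2 : ∀ v, a (e k) (a (e k) v) = (B (e k) (e k) / 2) • v := fun v => by
        have := ha (e k) (e k) v
        rw [← two_smul ℂ] at this
        rw [div_eq_inv_mul, mul_smul, ← this, smul_smul, inv_mul_cancel₀ two_ne_zero, one_smul]
      have hb2 : ∀ w, b (e k) (b (e k) w) = (B (e k) (e k) / 2) • w := fun w => by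
        have := hb (e k) (e k) w
        rw [← two_smul ℂ] at this
        rw [div_eq_inv_mul, mul_smul, ← this, smul_smul, inv_mul_cancel₀ two_ne_zero, one_smul]
      have hc2 : B (e k) (e k) / 2 ≠ 0 := div_ne_zero hc two_ne_zero
      generalize B (e k) (e k) / 2 = c at ha2 hb2 hc2
      have hal : ∀ l ∈ s, ∀ v, a (e k) (a (e l) v) = -a (e l) (a (e k) v) := fun l hl v => by
        have hkl : B (e k) (e l) = 0 := he (fun h => hk (h ▸ hl))
        have := ha (e k) (e l) v
        rwa [hkl, zero_smul, add_eq_zero_iff_eq_neg] at this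
      have hbl : ∀ l ∈ s, ∀ w, b (e k) (b (e l) w) = -b (e l) (b (e k) w) := fun l hl w => by
        have hkl : B (e k) (e l) = 0 := he (fun h => hk (h ▸ hl))
        have := hb (e k) (e l) w
        rwa [hkl, zero_smul, add_eq_zero_iff_eq_neg] at this
      -- Averaging over the generator, whose square is c on both sides; for earlier generators the
      -- signs from two anticommutations cancel.
      let T' : V →ₗ[ℂ] W := T + c⁻¹ • (b (e k) ∘ₗ T ∘ₗ a (e k))
      have hT' : ∀ v, T' v = T v + c⁻¹ • b (e k) (T (a (e k) v)) := fun v => rfl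
      by_cases h0 : T' = 0
      · have hk' : ∀ v, T (a (e k) v) = -b (e k) (T v) := fun v => by
          have h := hT' v
          rw [h0, LinearMap.zero_apply] at h
          have h' := congrArg (b (e k)) h
          rw [map_zero, map_add, map_smul, hb2, smul_smul, inv_mul_cancel₀ hc2, one_smul] at h'
          exact eq_neg_of_add_eq_zero_right h'.symm
        -- If the average vanishes, T anticommutes with the generator. Composing with `a (e k)` and
        -- P corrects this sign and leaves the earlier relations intact.
        refine ⟨T ∘ₗ a (e k) ∘ₗ P, fun h => hT0 (LinearMap.ext fun v => ?_), fun l hl v => ?_⟩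
        · have := LinearMap.congr_fun h (P (a (e k) v))
          simp only [LinearMap.comp_apply, hPP, ha2, map_smul, LinearMap.zero_apply] at this
          exact (smul_eq_zero.1 this).resolve_left hc2
        · simp only [LinearMap.comp_apply]
          rcases Finset.mem_insert.1 hl with rfl | hl
          · rw [hP, map_neg, map_neg, hk' (a (e l) (P v)), neg_neg]
          · rw [hP, map_neg, hal l hl, neg_neg, hT l hl]
      · refine ⟨T', h0, fun l hl v => ?_⟩
        rcases Finset.mem_insert.1 hl with rfl | hl
        · rw [hT', hT', ha2, map_add, map_smul, map_smul, map_smul, hb2, smul_smul,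
            smul_smul, inv_mul_cancel₀ hc2, one_smul, one_smul, add_comm]
        · rw [hT', hT', map_add, map_smul, hT l hl, hal l hl, map_neg, map_neg, hT l hl, hbl l hl,
            neg_neg]

namespace IsScalarModule

open SuperModule

variable {h : Type w} [AddCommGroup h] [Module ℂ h] [LieSuperalgebra h]
variable {C : Type*} [AddCommMonoid C] [Module ℂ C] {i : C →ₗ[ℂ] h} {ψ : Module.Dual ℂ C}

/-- Odd elements which act with square zero and anticommute with all odd elements act by zero. -/
theorem act_eq_zero {H : SuperModule.{w, v} h} (hH : IsScalarModule i ψ H)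
    (hi : ∀ x ∈ homog h 0, ∃ z, i z = x) {x : h} (hx : x ∈ homog h 1)
    (hxy : ∀ y ∈ homog h 1, ∀ v, H.act x (H.act y v) + H.act y (H.act x v) = 0) : H.act x = 0 := by
  have hne := hH.irreducible.1
  -- The kernel is graded and stable, and x² acts by zero, so the kernel cannot be trivial;
  -- irreducibility makes it everything.
  have hsub : H.IsSub (LinearMap.ker (H.act x)) := by
    refine ⟨fun v hv => ?_, fun y v hv => ?_⟩
    · rw [LinearMap.mem_ker] at *
      have := H.parity_act_odd hx v
      rw [hv, map_zero] at this
      exact neg_eq_zero.1 this.symm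
    · rw [LinearMap.mem_ker] at *
      obtain ⟨z, hz⟩ := hi _ (evenProj_mem y)
      have h1 := hxy _ (oddProj_mem y) v
      rw [hv, map_zero, add_zero] at h1
      rw [← evenProj_add_oddProj y, map_add, LinearMap.add_apply, map_add, h1, add_zero, ← hz,
        hH.act_even, map_smul, hv, smul_zero]
  rcases hH.irreducible.2 _ hsub with h0 | h0
  · obtain ⟨v, hv⟩ := exists_ne (0 : H)
    have h2 := hxy x hx v
    rw [← two_smul ℂ, smul_eq_zero] at h2
    have h3 : H.act x v ∈ LinearMap.ker (H.act x) := h2.resolve_left two_ne_zero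
    rw [h0, Submodule.mem_bot] at h3
    have h4 : v ∈ LinearMap.ker (H.act x) := h3
    rw [h0, Submodule.mem_bot] at h4
    exact absurd h4 hv
  · exact LinearMap.ker_eq_top.1 h0

/-- Irreducible modules with the same scalar action of the even part are isomorphic up to a change
of parity. -/
theorem exists_intertwiner {H : SuperModule.{w, v} h} {K : SuperModule.{w, u} h}
    (hH : IsScalarModule i ψ H) (hK : IsScalarModule i ψ K) (hi : ∀ x ∈ homog h 0, ∃ z, i z = x) :
    ∃ (T : H →ₗ[ℂ] K) (ε : ZMod 2), T ≠ 0 ∧ (∀ x v, T (H.act x v) = K.act x (T v)) ∧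
      ∀ v, T (parity v) = sgn ε • parity (T v) := by
  have := hH.irreducible.1
  have := hK.irreducible.1
  have := hH.finite
  have := hK.finite
  -- The odd part of h may be infinite-dimensional, so it is replaced by its image in the operators
  -- on both modules.
  let ρ : homog h 1 →ₗ[ℂ] Module.End ℂ H × Module.End ℂ K :=
    (H.act.prod K.act) ∘ₗ (homog h 1).subtype
  let O := LinearMap.range ρ
  let a : O →ₗ[ℂ] Module.End ℂ H := LinearMap.fst ℂ _ _ ∘ₗ O.subtype
  let b : O →ₗ[ℂ] Module.End ℂ K := LinearMap.snd ℂ _ _ ∘ₗ O.subtype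
  -- The bracket of odd elements acts by a scalar, and the trace of the anticommutator is twice the
  -- trace of one product. The factor 2 / dim H recovers that scalar from operators alone, so B is
  -- well defined on the image.
  let B : LinearMap.BilinForm ℂ O :=
    ((LinearMap.mul ℂ (Module.End ℂ H)).compl₁₂ a a).compr₂
      ((2 / Module.finrank ℂ H : ℂ) • LinearMap.trace ℂ H)
  have hBdef : ∀ o p, B o p = (2 / Module.finrank ℂ H : ℂ) * LinearMap.trace ℂ H (a o * a p) :=
    fun o p => rfl
  have hdim : (Module.finrank ℂ H : ℂ) ≠ 0 := Nat.cast_ne_zero.2 Module.finrank_pos.ne'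
  have hBs : LinearMap.IsSymm B := ⟨fun o p => by
    rw [RingHom.id_apply, hBdef, hBdef, LinearMap.trace_mul_comm]⟩
  have hscal : ∀ o p, (∀ v, a o (a p v) + a p (a o v) = B o p • v) ∧
      ∀ w, b o (b p w) + b p (b o w) = B o p • w := by
    rintro ⟨_, x, rfl⟩ ⟨_, y, rfl⟩
    have hxy := br_mem_homog x.2 y.2
    obtain ⟨z, hz⟩ := hi _ hxy
    have hv : ∀ v : H, H.act x (H.act y v) + H.act y (H.act x v) = ψ z • v := fun v => by
      have := H.act_br 1 1 x y x.2 y.2 v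
      rw [← hz, hH.act_even, mul_one, sgn_one, neg_smul, one_smul, sub_neg_eq_add] at this
      exact this.symm
    have hw : ∀ v : K, K.act x (K.act y v) + K.act y (K.act x v) = ψ z • v := fun v => by
      have := K.act_br 1 1 x y x.2 y.2 v
      rw [← hz, hK.act_even, mul_one, sgn_one, neg_smul, one_smul, sub_neg_eq_add] at this
      exact this.symm
    have hB : B ⟨ρ x, x, rfl⟩ ⟨ρ y, y, rfl⟩ = ψ z := by
      have h1 : H.act x * H.act y + H.act y * H.act x = ψ z • (1 : Module.End ℂ H) :=
        LinearMap.ext hv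
      have h2 := congrArg (LinearMap.trace ℂ H) h1
      rw [map_add, LinearMap.trace_mul_comm ℂ (H.act y), map_smul, LinearMap.trace_one,
        smul_eq_mul] at h2
      have h3 : B ⟨ρ x, x, rfl⟩ ⟨ρ y, y, rfl⟩
        = (2 / Module.finrank ℂ H : ℂ) * LinearMap.trace ℂ H (H.act x * H.act y) := rfl
      rw [h3, div_mul_eq_mul_div, div_eq_iff hdim, ← h2]
      ring
    rw [hB]
    exact ⟨hv, hw⟩
  obtain ⟨T, hT0, hT⟩ := exists_clifford_intertwiner B hBs a b parity parity_parity
    (by rintro ⟨_, x, rfl⟩ v; exact H.parity_act_odd x.2 v)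
    (fun o p => (hscal o p).1) (fun o p => (hscal o p).2) (by
      rintro ⟨_, x, rfl⟩ hB
      refine ⟨hH.act_eq_zero hi x.2 fun y hy v => ?_, hK.act_eq_zero hi x.2 fun y hy v => ?_⟩
      · exact ((hscal ⟨ρ x, x, rfl⟩ ⟨ρ ⟨y, hy⟩, ⟨y, hy⟩, rfl⟩).1 v).trans (by rw [hB, zero_smul])
      · exact ((hscal ⟨ρ x, x, rfl⟩ ⟨ρ ⟨y, hy⟩, ⟨y, hy⟩, rfl⟩).2 v).trans (by rw [hB, zero_smul]))
  have hodd : ∀ x ∈ homog h 1, ∀ v, T (H.act x v) = K.act x (T v) := fun x hx v =>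
    hT ⟨ρ ⟨x, hx⟩, ⟨x, hx⟩, rfl⟩ v
  -- Conjugating by parity gives another intertwiner. T + T' and T - T' are homogeneous and add up
  -- to 2T, so at least one is nonzero.
  let T' : H →ₗ[ℂ] K := parity ∘ₗ T ∘ₗ parity
  have hT' : ∀ v, T' v = parity (T (parity v)) := fun v => rfl
  have hodd' : ∀ x ∈ homog h 1, ∀ v, T' (H.act x v) = K.act x (T' v) := fun x hx v => by
    rw [hT', hT', H.parity_act_odd hx, map_neg, hodd x hx, map_neg, K.parity_act_odd hx, neg_neg]
  have key : ∀ c : ℂ, ∀ x v, (T + c • T') (H.act x v) = K.act x ((T + c • T') v) := by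
    intro c x v
    obtain ⟨S, hS⟩ : ∃ S, S = T + c • T' := ⟨_, rfl⟩
    have h1 : ∀ x ∈ homog h 1, ∀ v, S (H.act x v) = K.act x (S v) :=
      fun x hx v => by
        rw [hS, LinearMap.add_apply, LinearMap.add_apply, LinearMap.smul_apply, LinearMap.smul_apply,
          hodd x hx, hodd' x hx, map_add, map_smul]
    obtain ⟨z, hz⟩ := hi _ (evenProj_mem x)
    rw [← hS, ← evenProj_add_oddProj x, map_add, map_add, LinearMap.add_apply, LinearMap.add_apply,
      map_add, h1 _ (oddProj_mem x), ← hz, hH.act_even, hK.act_even, map_smul]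
  have hpar : ∀ ε v, (T + sgn ε • T') (parity v) = sgn ε • parity ((T + sgn ε • T') v) := by
    intro ε v
    have : sgn ε * sgn ε = 1 := sgn_mul_self ε
    rw [LinearMap.add_apply, LinearMap.add_apply, LinearMap.smul_apply, LinearMap.smul_apply, hT',
      hT', parity_parity, map_add, map_smul, parity_parity, smul_add, smul_smul, this, one_smul,
      add_comm]
  by_cases h0 : T + sgn 0 • T' = 0
  · refine ⟨T + sgn 1 • T', 1, fun h1 => hT0 ?_, key _, hpar 1⟩
    rw [sgn_zero, one_smul] at h0
    rw [sgn_one, neg_smul, one_smul] at h1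
    have : (2 : ℂ) • T = 0 := by
      linear_combination (norm := module) h0 + h1
    exact (smul_eq_zero.1 this).resolve_left two_ne_zero
  · exact ⟨T + sgn 0 • T', 0, h0, key _, hpar 0⟩

end IsScalarModule

namespace SuperModule

variable {g : Type u} [AddCommGroup g] [Module ℂ g] [LieSuperalgebra g]

/-- The module `M` with the even and odd parts exchanged. -/
def flip (M : SuperModule.{u, v} g) : SuperModule.{u, v} g where
  carrier := M
  superSpace :=
    { parity := -parity
      parity_parity := fun v => by simp [parity_parity] }
  act := M.act
  parity_act x v := by simp [M.parity_act]
  act_br := M.act_br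

theorem IsIrreducible.flip {M : SuperModule.{u, v} g} (hM : M.IsIrreducible) :
    M.flip.IsIrreducible :=
  ⟨hM.1, fun W hW => hM.2 W ⟨fun v hv => by
    have : -parity (V := M) v ∈ (W : Submodule ℂ M) := hW.1 v hv
    exact neg_mem_iff.1 this, hW.2⟩⟩

theorem Iso.of_flip {M N : SuperModule.{u, v} g} (h : M.flip.Iso N) : M.Iso N := h

/-- An irreducible quotient of `M` is isomorphic to the quotient by the largest proper submodule. -/
theorem Iso.of_surjective {M X : SuperModule.{u, v} g} (hX : X.IsIrreducible)
    (hM : M.maxSub ≠ ⊤) {Φ : M →ₗ[ℂ] X} (hΦ : ∀ x v, Φ (M.act x v) = X.act x (Φ v))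
    (hΦp : ∀ v, Φ (parity v) = parity (Φ v)) (h0 : Φ ≠ 0) :
    X.Iso (M.quot M.maxSub M.isSub_maxSub) := by
  have hsurj : LinearMap.range Φ = ⊤ := by
    refine (hX.2 (LinearMap.range Φ) ⟨?_, ?_⟩).resolve_left fun h =>
      h0 (LinearMap.range_eq_bot.1 h)
    · rintro _ ⟨v, rfl⟩
      exact ⟨_, hΦp v⟩
    · rintro x _ ⟨v, rfl⟩
      exact ⟨_, hΦ x v⟩
  have hle : LinearMap.ker Φ ≤ M.maxSub := by
    refine le_sSup ⟨⟨fun v hv => ?_, fun x v hv => ?_⟩, fun h => h0 (LinearMap.ker_eq_top.1 h)⟩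
    · rw [LinearMap.mem_ker, hΦp, LinearMap.mem_ker.1 hv, map_zero]
    · rw [LinearMap.mem_ker, hΦ, LinearMap.mem_ker.1 hv, map_zero]
  have hge : M.maxSub ≤ LinearMap.ker Φ := by
    have hsub : X.IsSub (M.maxSub.map Φ) := by
      refine ⟨?_, ?_⟩
      · rintro _ ⟨v, hv, rfl⟩
        exact ⟨_, M.isSub_maxSub.1 v hv, hΦp v⟩
      · rintro x _ ⟨v, hv, rfl⟩
        exact ⟨_, M.isSub_maxSub.2 x v hv, hΦ x v⟩
    rcases hX.2 _ hsub with h | h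
    · exact LinearMap.le_ker_iff_map.2 h
    · refine absurd ((Submodule.eq_top_iff').2 fun v => ?_) hM
      obtain ⟨w, hw, hwv⟩ : Φ v ∈ M.maxSub.map Φ := by rw [h]; exact Submodule.mem_top
      have h1 : v - w ∈ M.maxSub := hle (by rw [LinearMap.mem_ker, map_sub, hwv, sub_self])
      simpa using Submodule.add_mem _ h1 hw
  let e := (Submodule.quotEquivOfEq _ _ (le_antisymm hge hle)).trans
    (Φ.quotKerEquivOfSurjective (LinearMap.range_eq_top.1 hsurj))
  have he : ∀ v, e (M.maxSub.mkQ v) = Φ v := fun v => rfl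
  refine ⟨e.symm, fun x v => ?_⟩
  obtain ⟨w, rfl⟩ := LinearMap.range_eq_top.1 hsurj v
  have h1 : e.symm (X.act x (Φ w)) = M.maxSub.mkQ (M.act x w) := by
    rw [LinearEquiv.symm_apply_eq, he, hΦ]
  have h2 : e.symm (Φ w) = M.maxSub.mkQ w := by rw [LinearEquiv.symm_apply_eq, he]
  exact h1.trans (congrArg ((M.quot M.maxSub M.isSub_maxSub).act x) h2.symm)

end SuperModule

/-! ### Irreducible modules are determined by their top weight. -/

namespace Triangular

open SuperModule

variable {g : Type u} [AddCommGroup g] [Module ℂ g] [LieSuperalgebra g]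
variable {h : Type w} [AddCommGroup h] [Module ℂ h] [LieSuperalgebra h]
variable {C : Type*} [AddCommMonoid C] [Module ℂ C] {D : Triangular g h C}
variable {ψ : Module.Dual ℂ C} {H : SuperModule.{w, v} h}

/-- The element d commutes with h, so h preserves its eigenspaces. -/
theorem incl_mem_top {X : SuperModule.{u, v} g} {T : Submodule ℂ X} (hT : X.IsTop D.j D.d ψ T)
    (x : h) {t : X} (ht : t ∈ T) : X.act (D.incl.toLin x) t ∈ T := by
  rw [hT.eq_eigenspace] at *
  have : D.incl.toLin x ∈ Module.End.eigenspace (br (D.j D.d)) 0 := by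
    rw [Module.End.mem_eigenspace_iff, zero_smul, j_apply, ← D.incl.map_br, D.br_d, map_zero]
  have := X.act_mem_eigenspace (D.j_mem D.d) this ht
  rwa [add_zero] at this

theorem parity_mem_top {X : SuperModule.{u, v} g} {T : Submodule ℂ X} (hT : X.IsTop D.j D.d ψ T)
    {t : X} (ht : t ∈ T) : parity t ∈ T := by
  rw [hT.eq_eigenspace, Module.End.mem_eigenspace_iff] at *
  rw [← X.parity_act_even (D.j_mem D.d), ht, map_smul]

/-- An irreducible finite-dimensional module with a top weight space of weight `ψ` is the simple
quotient of the Verma module. -/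
theorem iso_simple {X : SuperModule.{u, max u v} g} (hX : X.IsIrreducible)
    [FiniteDimensional ℂ X] (htop : X.HasTop D.j D.d ψ) (hH : IsScalarModule D.i ψ H) :
    X.Iso (D.simple H) := by
  obtain ⟨T, hT⟩ := htop
  have hTsub : (X.comap D.incl).IsSub T :=
    ⟨fun t ht => parity_mem_top hT ht, fun x t ht => incl_mem_top hT x ht⟩
  let Y := (X.comap D.incl).sub T hTsub
  have : FiniteDimensional ℂ Y := inferInstanceAs (FiniteDimensional ℂ T)
  have : Nontrivial Y := (Submodule.nontrivial_iff_ne_bot (p := T)).2 hT.1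
  -- The top space may be a reducible h-module; one irreducible submodule is enough to receive a
  -- nonzero map from H.
  obtain ⟨W, hW, hirr⟩ := Y.exists_irreducible_sub
  have hK : IsScalarModule D.i ψ (Y.sub W hW) :=
    ⟨hirr, inferInstanceAs (FiniteDimensional ℂ W), fun z v =>
      Subtype.ext (Subtype.ext (hT.2.1 z v.1.1 v.1.2))⟩
  obtain ⟨φ, ε, hφ0, hφ, hφp⟩ := hH.exists_intertwiner hK D.exists_i
  have hmax : (D.verma H).maxSub ≠ ⊤ :=
    Submodule.Quotient.nontrivial_iff.1 (isIrreducible_simple hH).1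
  let φ' : H →ₗ[ℂ] X := (T.subtype : T →ₗ[ℂ] X) ∘ₗ (W.subtype : W →ₗ[ℂ] T) ∘ₗ φ
  have hφ'0 : φ' ≠ 0 := fun h => hφ0 (LinearMap.ext fun m =>
    Subtype.ext (Subtype.ext (LinearMap.congr_fun h m)))
  have hφ' : ∀ x m, φ' (H.act x m) = X.act (D.incl.toLin x) (φ' m) := fun x m =>
    congrArg (fun v => (T.subtype : T →ₗ[ℂ] X) ((W.subtype : W →ₗ[ℂ] T) v)) (hφ x m)
  have hφ'p : ∀ m, φ' (parity m) = sgn ε • parity (φ' m) := fun m =>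
    congrArg (fun v => (T.subtype : T →ₗ[ℂ] X) ((W.subtype : W →ₗ[ℂ] T) v)) (hφp m)
  have hφ'n : ∀ y ∈ D.nPlus, ∀ m, X.act y (φ' m) = 0 := fun y hy m =>
    act_nPlus_eq_zero hT hy (φ m).1.2
  have main : ∀ X' : SuperModule.{u, max u v} g, X'.IsIrreducible → ∀ φ : H →ₗ[ℂ] X', φ ≠ 0 →
      (∀ x m, φ (H.act x m) = X'.act (D.incl.toLin x) (φ m)) →
      (∀ m, φ (parity m) = parity (φ m)) → (∀ y ∈ D.nPlus, ∀ m, X'.act y (φ m) = 0) →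
      X'.Iso (D.simple H) := by
    intro X' hX' φ h0 h1 h2 h3
    obtain ⟨Φ, hΦ, hΦp, hΦφ⟩ := exists_induced_lift D.incl D.nPlus D.parity_mem H X' φ h1 h3 h2
    refine Iso.of_surjective hX' hmax hΦ hΦp fun h => h0 (LinearMap.ext fun m => ?_)
    rw [← hΦφ, h]
    rfl
  rcases zmod2_cases ε with rfl | rfl
  · exact main X hX φ' hφ'0 hφ' (fun m => by rw [hφ'p, sgn_zero, one_smul]) hφ'n
  -- A parity-reversing map becomes parity-preserving after exchanging the two parts of X, which
  -- does not affect `Iso`.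
  · refine Iso.of_flip (main X.flip hX.flip φ' hφ'0 hφ' (fun m => ?_) hφ'n)
    have hm := hφ'p m
    rw [sgn_one, neg_smul, one_smul] at hm
    exact hm

end Triangular

/-! ### Products of modules with coprime annihilators -/

namespace SuperModule

variable {g : Type u} [AddCommGroup g] [Module ℂ g] [LieSuperalgebra g]

theorem Iso.trans {X Y Z : SuperModule.{u, v} g} (h : X.Iso Y) (h' : Y.Iso Z) : X.Iso Z := by
  obtain ⟨e, he⟩ := h
  obtain ⟨e', he'⟩ := h'
  exact ⟨e.trans e', fun x v => by simp only [LinearEquiv.trans_apply, he, he']⟩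

theorem Iso.directSum {X Y X' Y' : SuperModule.{u, v} g} (h : X.Iso X') (h' : Y.Iso Y') :
    (X.directSum Y).Iso (X'.directSum Y') := by
  obtain ⟨e, he⟩ := h
  obtain ⟨e', he'⟩ := h'
  exact ⟨e.prodCongr e', fun x v => Prod.ext (he x v.1) (he' x v.2)⟩

theorem IsIrreducible.comap {g' : Type w} [AddCommGroup g'] [Module ℂ g'] [LieSuperalgebra g']
    {M : SuperModule.{u, v} g} (hM : M.IsIrreducible) (f : LieSuperHom g' g)
    (hf : ∀ x, ∃ y, M.act (f.toLin y) = M.act x) : (M.comap f).IsIrreducible := by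
  refine ⟨hM.1, fun W hW => hM.2 W ⟨hW.1, fun x v hv => ?_⟩⟩
  obtain ⟨y, hy⟩ := hf x
  rw [← hy]
  exact hW.2 y v hv

/-! ### The Chinese remainder theorem for g ⊗ A-modules. -/

section Coprime

variable {A : Type w} [CommRing A] [Algebra ℂ A]

theorem act_lTensor_eq (V : SuperModule.{max u w, v} (g ⊗[ℂ] A)) {I : Ideal A}
    (hI : ∀ (x : g), ∀ a ∈ I, ∀ v : V, V.act (x ⊗ₜ a) v = 0) {a b : A} (hab : a - b ∈ I)
    (x : g ⊗[ℂ] A) : V.act ((LinearMap.mulLeft ℂ a).lTensor g x)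
      = V.act ((LinearMap.mulLeft ℂ b).lTensor g x) := by
  induction x using TensorProduct.induction_on with
  | zero => simp
  | add x y hx hy => simp only [map_add, hx, hy]
  | tmul x c =>
    rw [LinearMap.lTensor_tmul, LinearMap.lTensor_tmul, ← sub_eq_zero, ← map_sub,
      ← TensorProduct.tmul_sub, LinearMap.mulLeft_apply, LinearMap.mulLeft_apply, ← sub_mul]
    exact LinearMap.ext fun v => hI x _ (I.mul_mem_right c hab) v

/-- The elements all of whose multiples act by zero form an ideal containing every ideal in the
family, hence their sum. -/
theorem act_sSup_ideal (V : SuperModule.{max u w, v} (g ⊗[ℂ] A)) (x : g) (a : A)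
    (ha : a ∈ sSup {I : Ideal A | ∀ (x : g), ∀ a ∈ I, ∀ v : V, V.act (x ⊗ₜ a) v = 0}) (v : V) :
    V.act (x ⊗ₜ a) v = 0 := by
  let J : Ideal A :=
    { carrier := {a | ∀ b : A, ∀ x : g, ∀ w : V, V.act (x ⊗ₜ (b * a)) w = 0}
      zero_mem' := fun b x w => by rw [mul_zero, TensorProduct.tmul_zero, map_zero]; rfl
      add_mem' := fun {a a'} ha ha' b x w => by
        rw [mul_add, TensorProduct.tmul_add, map_add, LinearMap.add_apply, ha, ha', add_zero]
      smul_mem' := fun c a ha b x w => by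
        rw [smul_eq_mul, ← mul_assoc]
        exact ha (b * c) x w }
  have hJ : sSup {I : Ideal A | ∀ (x : g), ∀ a ∈ I, ∀ v : V, V.act (x ⊗ₜ a) v = 0} ≤ J :=
    sSup_le fun I hI a ha b x w => hI x _ (I.mul_mem_left b ha) w
  have := hJ ha 1 x v
  rwa [one_mul] at this

theorem br_tmul_eq_zero {x : g} (hx : ∀ y, br x y = 0) (a : A) (z : g ⊗[ℂ] A) :
    br (x ⊗ₜ[ℂ] a) z = 0 := by
  induction z using TensorProduct.induction_on with
  | zero => simp
  | add x y hx hy => rw [map_add, hx, hy, add_zero]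
  | tmul x a => rw [br_tmul, hx, TensorProduct.zero_tmul]

/-- The Chinese remainder theorem provides eⱼ ≡ δᵢⱼ modulo Iᵢ, and the sum of the eⱼxⱼ acts on the
i-th module like xᵢ. -/
theorem exists_act_eq {ι : Type*} [Fintype ι] [DecidableEq ι]
    (V : ι → SuperModule.{max u w, v} (g ⊗[ℂ] A)) {I : ι → Ideal A}
    (hI : ∀ i, ∀ (x : g), ∀ a ∈ I i, ∀ v : V i, (V i).act (x ⊗ₜ a) v = 0)
    (hco : Pairwise fun i j => IsCoprime (I i) (I j)) (x : ι → g ⊗[ℂ] A) :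
    ∃ y, ∀ i, (V i).act y = (V i).act (x i) := by
  choose e he using fun j : ι => Ideal.exists_forall_sub_mem_ideal hco
    (fun i => if i = j then (1 : A) else 0)
  refine ⟨∑ j, (LinearMap.mulLeft ℂ (e j)).lTensor g (x j), fun i => ?_⟩
  rw [map_sum, Finset.sum_eq_single i]
  · rw [act_lTensor_eq (V i) (hI i) (he i i), if_pos rfl, LinearMap.mulLeft_one,
      LinearMap.lTensor_id, LinearMap.id_apply]
  · intro j _ hj
    rw [act_lTensor_eq (V i) (hI i) (he j i), if_neg hj.symm, LinearMap.mulLeft_zero_eq_zero,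
      LinearMap.lTensor_zero, LinearMap.zero_apply, map_zero]
  · exact fun h => absurd (Finset.mem_univ i) h

theorem independent_of_isCoprime {V W : SuperModule.{max u w, v} (g ⊗[ℂ] A)} {I J : Ideal A}
    (hI : ∀ (x : g), ∀ a ∈ I, ∀ v : V, V.act (x ⊗ₜ a) v = 0)
    (hJ : ∀ (x : g), ∀ a ∈ J, ∀ v : W, W.act (x ⊗ₜ a) v = 0) (hIJ : IsCoprime I J) :
    Independent V W := by
  have key : ∀ x y : g ⊗[ℂ] A, ∃ z, V.act z = V.act x ∧ W.act z = W.act y := by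
    intro x y
    obtain ⟨z, hz⟩ := exists_act_eq (fun b : Bool => cond b V W) (I := fun b => cond b I J)
      (by rintro (_ | _); exacts [hJ, hI])
      (by rintro (_ | _) (_ | _) h <;> first | exact absurd rfl h | exact hIJ | exact hIJ.symm)
      (fun b => cond b x y)
    exact ⟨z, hz true, hz false⟩
  refine ⟨fun x => ?_, fun x => ?_⟩
  · obtain ⟨z, h1, h2⟩ := key x 0
    exact ⟨z, h1, h2.trans (map_zero _)⟩
  · obtain ⟨z, h1, h2⟩ := key 0 x
    exact ⟨z, h1.trans (map_zero _), h2⟩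

end Coprime

end SuperModule

/-! ### Identification of the products by irreducibility and top weight. -/

namespace Triangular

open SuperModule

variable {g : Type u} [AddCommGroup g] [Module ℂ g] [LieSuperalgebra g]
variable {h : Type w} [AddCommGroup h] [Module ℂ h] [LieSuperalgebra h]
variable {C : Type*} [AddCommMonoid C] [Module ℂ C] {D : Triangular g h C}

theorem tensor_iso {ψ₁ ψ₂ : Module.Dual ℂ C} {H : SuperModule.{w, v} h}
    {M N : SuperModule.{u, max u v} g} (hM : M.IsIrreducible) (hN : N.IsIrreducible)
    [FiniteDimensional ℂ M] [FiniteDimensional ℂ N] (hMN : Independent M N)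
    (hM' : M.HasTop D.j D.d ψ₁) (hN' : N.HasTop D.j D.d ψ₂)
    (hH : IsScalarModule D.i (ψ₁ + ψ₂) H) :
    (M.tensor N).Iso (D.simple H) ∨
      (M.tensor N).Iso ((D.simple H).directSum (D.simple H)) := by
  obtain ⟨h1, h2, h3⟩ := hM.irrProd hN hMN
  have h4 := iso_simple h1 (IsoOneOrTwo.hasTop h3 (HasTop.tensor D.j_mem hM' hN')) hH
  exact h3.imp (fun h => h.trans h4) fun h => h.trans (h4.directSum h4)

/-- Over g ⊕ ⋯ ⊕ g independence of the factors is automatic. The hypothesis `hind` then says that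
each tuple acts like a diagonal one, so irreducibility survives restriction to the diagonal. -/
theorem irrProdFamily_iso {k : ℕ} {ψ : Fin (k + 1) → Module.Dual ℂ C} {H : SuperModule.{w, v} h}
    {V : Fin (k + 1) → SuperModule.{u, max u v} g} (hV : ∀ i, (V i).IsIrreducible)
    (hfd : ∀ i, FiniteDimensional ℂ (V i))
    (hind : ∀ x : Fin (k + 1) → g, ∃ y, ∀ i, (V i).act y = (V i).act (x i))
    (htop : ∀ i, (V i).HasTop D.j D.d (ψ i)) (hH : IsScalarModule D.i (∑ i, ψ i) H) :
    (irrProdFamily k V).Iso (D.simple H) := by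
  obtain ⟨h1, h2, h3, h4⟩ := iterIrrProd_properties
    -- Weights are taken along the diagonal from the outset, so the top statement needs no change
    -- after restriction.
    (j := (LieSuperHom.diag g (k + 1)).toLin ∘ₗ D.j) (d := D.d)
    (fun z => funext fun _ => D.j_mem z) k (fun i => (V i).comap (LieSuperHom.proj g i)) ψ
    (fun i => (hV i).comap _ fun x => ⟨fun _ => x, rfl⟩) hfd (fun x => ⟨fun i => x i i, fun _ => rfl⟩)
    htop
  have hirr : (irrProdFamily k V).IsIrreducible := by
    refine h1.comap _ fun x => ?_
    obtain ⟨y, hy⟩ := hind x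
    refine ⟨y, ?_⟩
    rw [← sub_eq_zero, ← map_sub]
    refine h4 _ fun i => ?_
    change (V i).act (y - x i) = 0
    rw [map_sub, hy, sub_self]
  have : FiniteDimensional ℂ (irrProdFamily k V) := h2
  exact iso_simple hirr h3 hH

end Triangular

/-! ### The case of `q(n) ⊗ A` -/

section Queer

open SuperModule

variable {n : ℕ} {A : Type u} [CommRing A] [Algebra ℂ A]

theorem exists_rTensor_subtype {x : cartan n ⊗[ℂ] A} (hx : x ∈ homog (cartan n ⊗[ℂ] A) 0) :
    ∃ z, (cartanEven n).subtype.rTensor A z = x := by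
  refine homog_tensor_induction (p := fun x => ∃ z, (cartanEven n).subtype.rTensor A z = x)
    ⟨0, map_zero _⟩ (fun x hx a => ⟨⟨x, hx⟩ ⊗ₜ a, rfl⟩) ?_ x hx
  rintro _ _ ⟨z, rfl⟩ ⟨z', rfl⟩
  exact ⟨z + z', map_add _ _ _⟩

variable (n A) in
/-- The triangular decomposition of `q(n) ⊗ A`. -/
def queerTriangular :
    Triangular (Queer n ⊗[ℂ] A) (cartan n ⊗[ℂ] A) (cartanEven n ⊗[ℂ] A) where
  incl := (cartan n).mapIncl A
  nPlus := nPlusMap n A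
  parity_mem := parity_mem_nPlusMap
  splitting := queerSplitting n A
  proj := cartanMapProj n A
  proj_parity := rTensor_parity A fun x => Subtype.ext (component_parity _ x)
  proj_br _ _ hx hy := rTensor_br A (cartanProj_br n)
    (rTensor_component_Ici n A hx) (rTensor_component_Ici n A hy)
  proj_incl := cartanMapProj_mapIncl n A
  proj_nPlus _ hy := cartanMapProj_nPlusMap hy
  splitting_incl := splitting_mapIncl n A
  splitting_nPlus _ hy := splitting_nPlusMap hy
  exists_add := splitting_exists_add
  i := (cartanEven n).subtype.rTensor A
  i_mem := rTensor_subtype_mem_homog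
  exists_i _ hx := exists_rTensor_subtype hx
  d := gradingMap n A
  br_d := br_tmul_eq_zero (cartan_even_central (gradingElement n).2) 1
  splitting_mem := splitting_mem_iSup
  nPlus_le := nPlusMap_le_iSup

theorem isScalarModule_HModule (ψ : weightFunctionals n A) :
    IsScalarModule (queerTriangular n A).i ψ.1 (HModule ψ) :=
  ⟨(isCartanModule_HModule ψ).irreducible, (isCartanModule_HModule ψ).finite,
    (isCartanModule_HModule ψ).act_even⟩

theorem VModule_eq (ψ : weightFunctionals n A) :
    VModule ψ = (queerTriangular n A).simple (HModule ψ) := rfl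

theorem act_annihilator (V : SuperModule.{u, v} (Queer n ⊗[ℂ] A)) (x : Queer n) (a : A)
    (ha : a ∈ annihilator V) (w : V) : V.act (x ⊗ₜ a) w = 0 :=
  act_sSup_ideal V x a ha w

/-- If the sum of the annihilators were proper, a maximal ideal containing it would lie in both
supports. -/
theorem isCoprime_annihilator {V W : SuperModule.{u, v} (Queer n ⊗[ℂ] A)}
    (h : Disjoint (support V) (support W)) : IsCoprime (annihilator V) (annihilator W) := by
  rw [Ideal.isCoprime_iff_sup_eq]
  by_contra hne
  obtain ⟨m, hm, hle⟩ := Ideal.exists_le_maximal _ hne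
  exact Set.disjoint_left.1 h
    (show (⟨m, hm⟩ : MaximalSpectrum A) ∈ support V from le_sup_left.trans hle)
    (show (⟨m, hm⟩ : MaximalSpectrum A) ∈ support W from le_sup_right.trans hle)

end Queer

theorem IsScalarModule.of_eq {h : Type w} [AddCommGroup h] [Module ℂ h] [LieSuperalgebra h]
    {C : Type*} [AddCommMonoid C] [Module ℂ C] {i : C →ₗ[ℂ] h} {ψ ψ' : Module.Dual ℂ C}
    {H : SuperModule.{w, v} h} (hH : IsScalarModule i ψ H) (hψ : ψ = ψ') : IsScalarModule i ψ' H :=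
  hψ ▸ hH

/-! ### Application to the modules V(ψ). -/

section Queer

open SuperModule

variable {n : ℕ} {A : Type u} [CommRing A] [Algebra ℂ A]

theorem isIrreducible_VModule (ψ : weightFunctionals n A) : (VModule ψ).IsIrreducible :=
  Triangular.isIrreducible_simple (D := queerTriangular n A) (isScalarModule_HModule ψ)

theorem hasTop_VModule (ψ : weightFunctionals n A) :
    (VModule ψ).HasTop (queerTriangular n A).j (queerTriangular n A).d ψ.1 :=
  Triangular.hasTop_simple (D := queerTriangular n A) (isScalarModule_HModule ψ)

theorem independent_of_disjoint_support {V W : SuperModule.{u, v} (Queer n ⊗[ℂ] A)}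
    (h : Disjoint (support V) (support W)) : Independent V W :=
  independent_of_isCoprime (I := annihilator V) (J := annihilator W) (act_annihilator V)
    (act_annihilator W) (isCoprime_annihilator h)

theorem exists_act_eq_of_disjoint_support {k : ℕ} {V : Fin k → SuperModule.{u, v} (Queer n ⊗[ℂ] A)}
    (h : ∀ i j, i ≠ j → Disjoint (support (V i)) (support (V j))) (x : Fin k → Queer n ⊗[ℂ] A) :
    ∃ y, ∀ i, (V i).act y = (V i).act (x i) :=
  exists_act_eq V (I := fun i => annihilator (V i)) (fun i => act_annihilator (V i))
    (fun i j hij => isCoprime_annihilator (h i j hij)) x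

theorem tensor_VModule_iso (ψ₁ ψ₂ : weightFunctionals n A) (h₁ : FiniteDimensional ℂ (VModule ψ₁))
    (h₂ : FiniteDimensional ℂ (VModule ψ₂)) (h : Independent (VModule ψ₁) (VModule ψ₂)) :
    ((VModule ψ₁).tensor (VModule ψ₂)).Iso (VModule (ψ₁ + ψ₂)) ∨
      ((VModule ψ₁).tensor (VModule ψ₂)).Iso
        ((VModule (ψ₁ + ψ₂)).directSum (VModule (ψ₁ + ψ₂))) := by
  rw [VModule_eq (ψ₁ + ψ₂)]
  exact Triangular.tensor_iso (D := queerTriangular n A) (ψ₁ := ψ₁.1) (ψ₂ := ψ₂.1)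
    (isIrreducible_VModule ψ₁) (isIrreducible_VModule ψ₂) h (hasTop_VModule ψ₁) (hasTop_VModule ψ₂)
    (isScalarModule_HModule (ψ₁ + ψ₂))

theorem irrProdFamily_VModule_iso {k : ℕ} (ψ : Fin (k + 1) → weightFunctionals n A)
    (hfd : ∀ i, FiniteDimensional ℂ (VModule (ψ i)))
    (hind : ∀ x : Fin (k + 1) → Queer n ⊗[ℂ] A, ∃ y, ∀ i,
      (VModule (ψ i)).act y = (VModule (ψ i)).act (x i)) :
    (irrProdFamily k fun i => VModule (ψ i)).Iso (VModule (∑ i, ψ i)) := by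
  have hsum : (∑ i, ψ i : weightFunctionals n A).1 = ∑ i, (ψ i).1 :=
    AddSubmonoidClass.coe_finsetSum _ _
  have hH := (isScalarModule_HModule (∑ i, ψ i)).of_eq hsum
  rw [VModule_eq (∑ i, ψ i)]
  exact Triangular.irrProdFamily_iso (D := queerTriangular n A) (ψ := fun i => (ψ i).1)
    (fun i => isIrreducible_VModule (ψ i)) hfd hind (fun i => hasTop_VModule (ψ i)) hH

end Queer

end MapQueer

end

open MapQueer

theorem proposition6p3 (n : ℕ) (hn : 2 ≤ n) (A : Type*) [CommRing A] [Algebra ℂ A] :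
    (∀ ψ₁ ψ₂ : weightFunctionals n A,
      FiniteDimensional ℂ (VModule ψ₁) → FiniteDimensional ℂ (VModule ψ₂) →
      Disjoint (support (VModule ψ₁)) (support (VModule ψ₂)) →
        ((VModule ψ₁).tensor (VModule ψ₂)).Iso (VModule (ψ₁ + ψ₂)) ∨
        ((VModule ψ₁).tensor (VModule ψ₂)).Iso
          ((VModule (ψ₁ + ψ₂)).directSum (VModule (ψ₁ + ψ₂)))) ∧
    (∀ (k : ℕ) (ψ : Fin (k + 1) → weightFunctionals n A),
      (∀ i, FiniteDimensional ℂ (VModule (ψ i))) →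
      (∀ i j, i ≠ j → Disjoint (support (VModule (ψ i))) (support (VModule (ψ j)))) →
        (SuperModule.irrProdFamily k fun i => VModule (ψ i)).Iso (VModule (∑ i, ψ i))) := by
  refine ⟨fun ψ₁ ψ₂ h₁ h₂ hdisj => ?_, fun k ψ hfd hdisj => ?_⟩
  · exact tensor_VModule_iso ψ₁ ψ₂ h₁ h₂ (independent_of_disjoint_support hdisj)
  · exact irrProdFamily_VModule_iso ψ hfd (exists_act_eq_of_disjoint_support hdisj)
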